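/- **Theorem (Gray).** Let $M$ be a connected smooth six-manifold with an $SU(3)$-structure, i.e. a Riemannian metric $\langle\cdot,\cdot\rangle$, an orthogonal almost complex structure $I$, and a complex volume form $\Psi=\psi_++i\psi_-$: a smooth complex-valued $3$-form that is complex multilinear for $I$, so $\Psi(IX,Y,Z)=i\Psi(X,Y,Z)$, with $\langle\Psi,\Psi\rangle_{\mathbb C}=\frac1{3!}\sum_{i,j,k=1}^{3}|\Psi(u_i,u_j,u_k)|^2=1$ for every basis $u_1,u_2,u_3$ of a tangent space that is unitary for $\langle\cdot,\cdot\rangle+i\omega$, where $\omega(X,Y)=\langle X,IY\rangle$. Let $\nabla$ be the Levi-Civita connection, $R_{X,Y}=\nabla_{[X,Y]}-[\nabla_X,\nabla_Y]$ and, for an orthonormal basis $(e_i)$, $$\mathrm{Ric}(X,Y)=\sum_i\langle R_{X,e_i}Y,e_i\rangle,\qquad \mathrm{Ric}^*(X,Y)=\sum_i\langle R_{X,e_i}IY,Ie_i\rangle .$$ The intrinsic torsion is the unique section $T$ of $T^*M\otimes\mathfrak{su}(3)^\perp$ ($\perp$ taken in $\mathfrak{so}(6)$) such that $\nabla+T$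 is an $SU(3)$-connection, i.e. annihilates $\omega,\psi_+,\psi_-$. Let $\mathcal W_5=T^*M\otimes\mathbb R I$ be the space of tensors $\eta_XY=\hat\eta(X)IY$ with $\hat\eta$ a one-form; let $\mathcal W_1$ be the space of $\xi\in T^*M\otimes\mathfrak u(3)^\perp$ for which the tensor $a=-\xi\omega$, $a(X,Y,Z)=\omega(\xi_XY,Z)+\omega(Y,\xi_XZ)$, satisfies $a(X,X,Z)=0$; and let $\mathcal W_1^+$ (resp. $\mathcal W_1^-$) consist of the $\xi\in\mathcal W_1$ for which the bilinear form $r(X,Y)=\frac12\langle X\lrcorner\psi_+,Y\lrcorner a\rangle$ is symmetric (resp. skew-symmetric), where $\langle b,c\rangle=\frac1{2!}\sum_{i,j}b(e_i,e_j)c(e_i,e_j)$ for two-forms $b,c$. The structure is said to be of type $\mathcal W$ if its intrinsic torsion lies in $\mathcal W$ at every point. Suppose that the structure is of type $\mathcal W_1^++\mathcal W_1^-+\mathcal W_5$ and not of type $\mathcal W_5$. Then there are smooth functions $w_1^+,w_1^-$ on $M$ with $\nabla\omega=w_1^+\psi_++w_1^-\psi_-$, that is, $(\nabla_X\omega)(Y,Z)=w_1^+\psi_+(X,Y,Z)+w_1^-\psi_-(X,Y,Z)$;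 the function $\alpha=(w_1^+)^2+(w_1^-)^2$ is a positive constant; and $$\mathrm{Ric}=5\,\mathrm{Ric}^*=5\alpha\,\langle\cdot,\cdot\rangle .$$ In particular $M$ is an Einstein manifold. -/

import Mathlib

set_option linter.unusedSectionVars false

open Bundle FiberBundle VectorField
open scoped Manifold ContDiff Topology

noncomputable section LeviCivita

variable {E : Type*} [NormedAddCommGroup E] [NormedSpace ℝ E] [FiniteDimensional ℝ E]
  {H : Type*} [TopologicalSpace H] {I : ModelWithCorners ℝ E H}
  {M : Type*} [TopologicalSpace M] [ChartedSpace H M] [IsManifold I ∞ M]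
  [RiemannianBundle (fun x : M ↦ TangentSpace I x)]
  [IsContMDiffRiemannianBundle I ∞ E (fun x : M ↦ TangentSpace I x)]

local notation "⟪" u ", " v "⟫" => inner ℝ u v

/-- Tangent spaces are finite-dimensional. -/
instance tangentSpace_finiteDimensional (x : M) : FiniteDimensional ℝ (TangentSpace I x) :=
  inferInstanceAs (FiniteDimensional ℝ E)

/-- The Koszul expression: half of `X⟨Y, Z⟩ + Y⟨X, Z⟩ - Z⟨X, Y⟩ + ⟨[X, Y], Z⟩ - ⟨[X, Z], Y⟩ - ⟨[Y, Z], X⟩`,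
which equals `⟨∇_X Y, Z⟩` for the Levi-Civita connection `∇`. -/
def koszul (X Y Z : Π x : M, TangentSpace I x) (x : M) : ℝ :=
  (1 / 2) * (d% (fun y ↦ ⟪Y y, Z y⟫) x (X x) + d% (fun y ↦ ⟪X y, Z y⟫) x (Y x)
    - d% (fun y ↦ ⟪X y, Y y⟫) x (Z x)
    + ⟪mlieBracket I X Y x, Z x⟫ - ⟪mlieBracket I X Z x, Y x⟫ - ⟪mlieBracket I Y Z x, X x⟫)

theorem mdifferentiableAt_inner {x : M} {X Y : Π x : M, TangentSpace I x}
    (hX : MDiffAt (T% X) x) (hY : MDiffAt (T% Y) x) : MDiffAt (fun y ↦ ⟪X y, Y y⟫) x :=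
  MDifferentiableAt.inner_bundle (F := E) (E := fun x : M ↦ TangentSpace I x) (b := id) hX hY

theorem koszul_tensorial_left {x : M} {Y Z : Π x : M, TangentSpace I x}
    (hY : MDiffAt (T% Y) x) (hZ : MDiffAt (T% Z) x) :
    TensorialAt I E (fun X ↦ koszul X Y Z x) x where
  smul {f X} hf hX := by
    have e1 : (fun y ↦ ⟪(f • X) y, Z y⟫) = fun y ↦ f y * ⟪X y, Z y⟫ := by
      ext y; simp [inner_smul_left]
    have e2 : (fun y ↦ ⟪(f • X) y, Y y⟫) = fun y ↦ f y * ⟪X y, Y y⟫ := by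
      ext y; simp [inner_smul_left]
    simp only [koszul, e1, e2, mvfderiv_fun_mul hf (mdifferentiableAt_inner hX hZ),
      mvfderiv_fun_mul hf (mdifferentiableAt_inner hX hY), mlieBracket_smul_left hf hX]
    simp [inner_add_left, inner_smul_left, inner_smul_right, real_inner_comm]
    ring
  add {X X'} hX hX' := by
    have e1 : (fun y ↦ ⟪(X + X') y, Z y⟫) = fun y ↦ ⟪X y, Z y⟫ + ⟪X' y, Z y⟫ := by
      ext y; simp [inner_add_left]
    have e2 : (fun y ↦ ⟪(X + X') y, Y y⟫) = fun y ↦ ⟪X y, Y y⟫ + ⟪X' y, Y y⟫ := by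
      ext y; simp [inner_add_left]
    simp only [koszul, e1, e2, mvfderiv_fun_add (mdifferentiableAt_inner hX hZ) (mdifferentiableAt_inner hX' hZ),
      mvfderiv_fun_add (mdifferentiableAt_inner hX hY) (mdifferentiableAt_inner hX' hY), mlieBracket_add_left hX hX']
    simp [inner_add_left, inner_add_right]
    ring

theorem koszul_tensorial_right {x : M} {X Y : Π x : M, TangentSpace I x}
    (hX : MDiffAt (T% X) x) (hY : MDiffAt (T% Y) x) :
    TensorialAt I E (fun Z ↦ koszul X Y Z x) x where
  smul {f Z} hf hZ := by
    have e1 : (fun y ↦ ⟪X y, (f • Z) y⟫) = fun y ↦ f y * ⟪X y, Z y⟫ := by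
      ext y; simp [inner_smul_right]
    have e2 : (fun y ↦ ⟪Y y, (f • Z) y⟫) = fun y ↦ f y * ⟪Y y, Z y⟫ := by
      ext y; simp [inner_smul_right]
    simp only [koszul, e1, e2, mvfderiv_fun_mul hf (mdifferentiableAt_inner hX hZ),
      mvfderiv_fun_mul hf (mdifferentiableAt_inner hY hZ), mlieBracket_smul_right hf hZ]
    simp [inner_add_left, inner_smul_left, inner_smul_right, real_inner_comm]
    ring
  add {Z Z'} hZ hZ' := by
    have e1 : (fun y ↦ ⟪X y, (Z + Z') y⟫) = fun y ↦ ⟪X y, Z y⟫ + ⟪X y, Z' y⟫ := by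
      ext y; simp [inner_add_right]
    have e2 : (fun y ↦ ⟪Y y, (Z + Z') y⟫) = fun y ↦ ⟪Y y, Z y⟫ + ⟪Y y, Z' y⟫ := by
      ext y; simp [inner_add_right]
    simp only [koszul, e1, e2, mvfderiv_fun_add (mdifferentiableAt_inner hX hZ) (mdifferentiableAt_inner hX hZ'),
      mvfderiv_fun_add (mdifferentiableAt_inner hY hZ) (mdifferentiableAt_inner hY hZ'), mlieBracket_add_right hZ hZ']
    simp [inner_add_left, inner_add_right]
    ring

/-- For a vector field `Y` differentiable at `x`, the Koszul expression as a bilinear form in the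
values of `X` and `Z` at `x`. -/
def koszulHom (Y : Π x : M, TangentSpace I x) {x : M} (hY : MDiffAt (T% Y) x) :
    TangentSpace I x →L[ℝ] TangentSpace I x →L[ℝ] ℝ :=
  TensorialAt.mkHom₂ (I := I) (F := E) (F' := E) (fun X Z ↦ koszul X Y Z x) x
    (fun _ hZ ↦ koszul_tensorial_left hY hZ) (fun _ hX ↦ koszul_tensorial_right hX hY)

open scoped Classical in
/-- `leviCivitaFun Y x u` is the vector `∇_u Y` determined by the Koszul formula, with value `0`
where `Y` is not differentiable. -/
def leviCivitaFun (Y : Π x : M, TangentSpace I x) (x : M) :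
    TangentSpace I x →L[ℝ] TangentSpace I x :=
  if hY : MDiffAt (T% Y) x then
    ∑ i, ((koszulHom Y hY).flip (stdOrthonormalBasis ℝ (TangentSpace I x) i)).smulRight
      (stdOrthonormalBasis ℝ (TangentSpace I x) i)
  else 0

theorem inner_leviCivitaFun {X Y Z : Π x : M, TangentSpace I x} {x : M}
    (hX : MDiffAt (T% X) x) (hY : MDiffAt (T% Y) x) (hZ : MDiffAt (T% Z) x) :
    ⟪leviCivitaFun Y x (X x), Z x⟫ = koszul X Y Z x := by
  have h : koszulHom Y hY (X x) (Z x) = koszul X Y Z x :=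
    TensorialAt.mkHom₂_apply (I := I) (F := E) (F' := E) (Φ := fun X Z ↦ koszul X Y Z x)
      (fun _ hZ ↦ koszul_tensorial_left hY hZ) (fun _ hX ↦ koszul_tensorial_right hX hY) hX hZ
  rw [← h]
  conv_rhs => rw [← (stdOrthonormalBasis ℝ (TangentSpace I x)).sum_repr' (Z x)]
  simp [leviCivitaFun, hY, sum_inner, inner_smul_left, mul_comm]

theorem ext_inner_extend {x : M} {A B : TangentSpace I x →L[ℝ] TangentSpace I x}
    (h : ∀ X Z : Π x : M, TangentSpace I x, MDiffAt (T% X) x → MDiffAt (T% Z) x →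
      ⟪A (X x), Z x⟫ = ⟪B (X x), Z x⟫) : A = B := by
  ext u
  refine ext_inner_right ℝ fun v ↦ ?_
  have := h (extend E u) (extend E v) (mdifferentiableAt_extend I E u)
    (mdifferentiableAt_extend I E v)
  simpa using this

variable (I M) in
/-- The Levi-Civita connection of the Riemannian metric; `leviCivita I M Y x u` is `∇_u Y` at `x`. -/
def leviCivita : CovariantDerivative I E (fun x : M ↦ TangentSpace I x) where
  toFun := leviCivitaFun
  isCovariantDerivativeOnUniv :=
    { add := by
        intro Y Y' x hY hY' _
        refine ext_inner_extend fun X Z hX hZ ↦ ?_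
        have hs : MDiffAt (T% (Y + Y')) x := mdifferentiableAt_add_section hY hY'
        have e1 : (fun y ↦ ⟪(Y + Y') y, Z y⟫) = fun y ↦ ⟪Y y, Z y⟫ + ⟪Y' y, Z y⟫ := by
          ext y; simp [inner_add_left]
        have e2 : (fun y ↦ ⟪X y, (Y + Y') y⟫) = fun y ↦ ⟪X y, Y y⟫ + ⟪X y, Y' y⟫ := by
          ext y; simp [inner_add_right]
        rw [inner_leviCivitaFun hX hs hZ, add_apply, inner_add_left,
          inner_leviCivitaFun hX hY hZ, inner_leviCivitaFun hX hY' hZ]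
        simp only [koszul, e1, e2, mvfderiv_fun_add (mdifferentiableAt_inner hY hZ) (mdifferentiableAt_inner hY' hZ),
          mvfderiv_fun_add (mdifferentiableAt_inner hX hY) (mdifferentiableAt_inner hX hY'),
          mlieBracket_add_left hY hY', mlieBracket_add_right hY hY']
        simp [inner_add_left, inner_add_right]
        ring
      leibniz := by
        intro Y f x hY hf _
        refine ext_inner_extend fun X Z hX hZ ↦ ?_
        have hs : MDiffAt (T% (f • Y)) x := hf.smul_section hY
        have e1 : (fun y ↦ ⟪(f • Y) y, Z y⟫) = fun y ↦ f y * ⟪Y y, Z y⟫ := by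
          ext y; simp [inner_smul_left]
        have e2 : (fun y ↦ ⟪X y, (f • Y) y⟫) = fun y ↦ f y * ⟪X y, Y y⟫ := by
          ext y; simp [inner_smul_right]
        rw [inner_leviCivitaFun hX hs hZ, add_apply, inner_add_left,
          smul_apply, inner_smul_left, inner_leviCivitaFun hX hY hZ]
        simp only [koszul, e1, e2, mvfderiv_fun_mul hf (mdifferentiableAt_inner hY hZ),
          mvfderiv_fun_mul hf (mdifferentiableAt_inner hX hY),
          mlieBracket_smul_left hf hY, mlieBracket_smul_right hf hY]
        simp [inner_add_left, inner_smul_left, inner_smul_right, real_inner_comm]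
        ring }

/-- The Levi-Civita connection is metric: `X⟨Y, Z⟩ = ⟨∇_X Y, Z⟩ + ⟨Y, ∇_X Z⟩`. -/
theorem leviCivita_metric {x : M} {X Y Z : Π x : M, TangentSpace I x} (hX : MDiffAt (T% X) x)
    (hY : MDiffAt (T% Y) x) (hZ : MDiffAt (T% Z) x) :
    d% (fun y ↦ ⟪Y y, Z y⟫) x (X x) =
      ⟪leviCivita I M Y x (X x), Z x⟫ + ⟪Y x, leviCivita I M Z x (X x)⟫ := by
  have h1 := inner_leviCivitaFun hX hY hZ
  have h2 := inner_leviCivitaFun hX hZ hY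
  rw [real_inner_comm] at h2
  change _ = ⟪leviCivitaFun Y x (X x), Z x⟫ + ⟪Y x, leviCivitaFun Z x (X x)⟫
  rw [h1, h2]
  have e : (fun y ↦ ⟪Z y, Y y⟫) = fun y ↦ ⟪Y y, Z y⟫ := by
    ext y; exact real_inner_comm _ _
  simp only [koszul, e, mlieBracket_swap_apply (V := Z) (W := Y)]
  simp
  ring

/-- The Levi-Civita connection is torsion-free. -/
theorem leviCivita_torsion : (leviCivita I M).torsion = 0 := by
  rw [CovariantDerivative.torsion_eq_zero_iff]
  intro X Y x hX hY
  refine ext_inner_right ℝ fun v ↦ ?_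
  have hZ := mdifferentiableAt_extend I E v
  have h1 := inner_leviCivitaFun hX hY hZ
  have h2 := inner_leviCivitaFun hY hX hZ
  rw [extend_apply_self] at h1 h2
  rw [inner_sub_left]
  change ⟪leviCivitaFun Y x (X x), v⟫ - ⟪leviCivitaFun X x (Y x), v⟫ = _
  rw [h1, h2]
  have e : (fun y ↦ ⟪Y y, X y⟫) = fun y ↦ ⟪X y, Y y⟫ := by
    ext y; exact real_inner_comm _ _
  simp only [koszul, e, mlieBracket_swap_apply (V := Y) (W := X), extend_apply_self]
  simp
  ring

variable (I M) in
/-- The curvature operator `R_{u,v} w` at `x`, for the sign convention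
`R_{X,Y} = ∇_{[X,Y]} - [∇_X, ∇_Y]`, computed on local smooth extensions of the tangent vectors. -/
def curvature (x : M) (u v w : TangentSpace I x) : TangentSpace I x :=
  let X : Π y : M, TangentSpace I y := extend E u
  let Y : Π y : M, TangentSpace I y := extend E v
  let Z : Π y : M, TangentSpace I y := extend E w
  leviCivita I M Z x (mlieBracket I X Y x)
    - (leviCivita I M (fun y ↦ leviCivita I M Z y (Y y)) x u
      - leviCivita I M (fun y ↦ leviCivita I M Z y (X y)) x v)

variable (I M) in
/-- The Ricci curvature `Ric(u, v) = ∑ᵢ ⟨R_{u,eᵢ} v, eᵢ⟩`, `(eᵢ)` an orthonormal basis. -/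
def ricci (x : M) (u v : TangentSpace I x) : ℝ :=
  ∑ i, ⟪curvature I M x u (stdOrthonormalBasis ℝ (TangentSpace I x) i) v,
    stdOrthonormalBasis ℝ (TangentSpace I x) i⟫

variable (M) in
/-- The `*`-Ricci curvature `Ric*(u, v) = ∑ᵢ ⟨R_{u,eᵢ} Jv, J eᵢ⟩` of an almost Hermitian structure
with almost complex structure `J`. -/
def ricciStar (J : Π x : M, TangentSpace I x →L[ℝ] TangentSpace I x) (x : M)
    (u v : TangentSpace I x) : ℝ :=
  ∑ i, ⟪curvature I M x u (stdOrthonormalBasis ℝ (TangentSpace I x) i) (J x v),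
    J x (stdOrthonormalBasis ℝ (TangentSpace I x) i)⟫

/-- The covariant derivative of a field of `k`-linear forms:
`(∇_u φ)(v₁, …, v_k) = u(φ(V₁, …, V_k)) - ∑ᵢ φ(v₁, …, ∇_u Vᵢ, …, v_k)`
for local smooth extensions `Vᵢ` of the tangent vectors `vᵢ`. -/
def covDerivForm {k : ℕ} (φ : Π x : M, (Fin k → TangentSpace I x) → ℝ) (x : M)
    (u : TangentSpace I x) (v : Fin k → TangentSpace I x) : ℝ :=
  d% (fun y ↦ φ y (fun i ↦ extend E (v i) y)) x u
    - ∑ i, φ x (Function.update v i (leviCivita I M (extend E (v i)) x u))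

end LeviCivita

/-- The natural action of an endomorphism `A` on a `k`-form `φ`:
`(A φ)(v₁, …, v_k) = -∑ᵢ φ(v₁, …, A vᵢ, …, v_k)`. -/
def endAction {V : Type*} [AddCommGroup V] [Module ℝ V] {k : ℕ} (A : V →ₗ[ℝ] V)
    (φ : (Fin k → V) → ℝ) (v : Fin k → V) : ℝ :=
  -∑ i, φ (Function.update v i (A (v i)))

noncomputable section SpecialAlmostHermitian

/-- The model space of six-dimensional manifolds. -/
abbrev E6 : Type := EuclideanSpace ℝ (Fin 6)

local notation "⟪" u ", " v "⟫" => inner ℝ u v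

/-- An `SU(3)`-structure on a Riemannian six-manifold `M` (so that `M` is a special almost Hermitian
six-manifold): an orthogonal almost complex structure `J` and a complex volume form `Ψ`, both smooth.

`Ψ` is a complex-valued 3-form that is complex multilinear for `J`, normalised by `⟨Ψ, Ψ⟩_ℂ = 1`,
where `⟨Ψ, Ψ⟩_ℂ = (1 / 3!) ∑ Ψ(u_i, u_j, u_k) conj Ψ(u_i, u_j, u_k)` for a basis `u` that is unitary
for the Hermitian product `⟨·,·⟩ + i ω`, `ω(u, v) = ⟨u, Jv⟩`. -/
structure SU3Structure (M : Type*) [TopologicalSpace M] [ChartedSpace E6 M]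
    [IsManifold (𝓡 6) ∞ M] [RiemannianBundle (fun x : M ↦ TangentSpace (𝓡 6) x)] where
  /-- the almost complex structure -/
  J : Π x : M, TangentSpace (𝓡 6) x →L[ℝ] TangentSpace (𝓡 6) x
  contMDiff_J : ContMDiff (𝓡 6) ((𝓡 6).prod 𝓘(ℝ, E6 →L[ℝ] E6)) ∞
    (fun x ↦ TotalSpace.mk' (E6 →L[ℝ] E6)
      (E := fun x : M ↦ TangentSpace (𝓡 6) x →L[ℝ] TangentSpace (𝓡 6) x) x (J x))
  J_J : ∀ (x : M) (u : TangentSpace (𝓡 6) x), J x (J x u) = -u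
  inner_J_J : ∀ (x : M) (u v : TangentSpace (𝓡 6) x), ⟪J x u, J x v⟫ = ⟪u, v⟫
  /-- the complex volume form -/
  Ψ : Π x : M, (TangentSpace (𝓡 6) x) [⋀^Fin 3]→ₗ[ℝ] ℂ
  contMDiff_Ψ : ∀ (X : Fin 3 → Π x : M, TangentSpace (𝓡 6) x) (x : M),
    (∀ i, ContMDiffAt (𝓡 6) (𝓡 6).tangent ∞ (fun y ↦ (⟨y, X i y⟩ : TangentBundle (𝓡 6) M)) x) →
      ContMDiffAt (𝓡 6) 𝓘(ℝ, ℂ) ∞ (fun y ↦ Ψ y (fun i ↦ X i y)) x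
  Ψ_J : ∀ (x : M) (u v w : TangentSpace (𝓡 6) x),
    Ψ x ![J x u, v, w] = Complex.I * Ψ x ![u, v, w]
  Ψ_norm : ∀ (x : M) (u : Fin 3 → TangentSpace (𝓡 6) x),
    (∀ i j, (⟪u i, u j⟫ : ℂ) + Complex.I * (⟪u i, J x (u j)⟫ : ℝ) = if i = j then 1 else 0) →
      (1 / (Nat.factorial 3 : ℂ)) * ∑ i, ∑ j, ∑ k,
        Ψ x ![u i, u j, u k] * (starRingEnd ℂ) (Ψ x ![u i, u j, u k]) = 1

namespace SU3Structure

variable {M : Type*} [TopologicalSpace M] [ChartedSpace E6 M] [IsManifold (𝓡 6) ∞ M]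
  [RiemannianBundle (fun x : M ↦ TangentSpace (𝓡 6) x)]
  [IsContMDiffRiemannianBundle (𝓡 6) ∞ E6 (fun x : M ↦ TangentSpace (𝓡 6) x)]

variable (S : SU3Structure M)

/-- The Kähler form `ω(u, v) = ⟨u, Jv⟩`. -/
def kahlerForm (x : M) (v : Fin 2 → TangentSpace (𝓡 6) x) : ℝ := ⟪v 0, S.J x (v 1)⟫

/-- The real part `ψ₊` of the complex volume form. -/
def ψp (x : M) (v : Fin 3 → TangentSpace (𝓡 6) x) : ℝ := (S.Ψ x v).re

/-- The imaginary part `ψ₋` of the complex volume form. -/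
def ψm (x : M) (v : Fin 3 → TangentSpace (𝓡 6) x) : ℝ := (S.Ψ x v).im

/-- `(∇_u ω)(v, w)`, as a trilinear form in `(u, v, w)`. -/
def nablaKahler (x : M) (u v w : TangentSpace (𝓡 6) x) : ℝ := covDerivForm S.kahlerForm x u ![v, w]

/-- The Lie algebra `so(6)` of `T_x M`. -/
def so (x : M) : Set (Module.End ℝ (TangentSpace (𝓡 6) x)) :=
  {A | ∀ u v, ⟪A u, v⟫ = -⟪u, A v⟫}

/-- The Lie algebra `u(3)` of `T_x M`: skew endomorphisms that are complex linear. -/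
def unitaryAlg (x : M) : Set (Module.End ℝ (TangentSpace (𝓡 6) x)) :=
  {A | A ∈ so x ∧ ∀ u, A (S.J x u) = S.J x (A u)}

/-- The Lie algebra `su(3)` of `T_x M`: the elements of `u(3)` with vanishing complex trace
(the real part of the complex trace of a skew endomorphism vanishes; the imaginary part is a multiple
of the real trace of `J A`). -/
def specialUnitaryAlg (x : M) : Set (Module.End ℝ (TangentSpace (𝓡 6) x)) :=
  {A | A ∈ S.unitaryAlg x ∧
    LinearMap.trace ℝ (TangentSpace (𝓡 6) x) ((S.J x : Module.End ℝ (TangentSpace (𝓡 6) x)) * A) = 0}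

/-- The orthogonal complement in `so(6)` of a subset of `so(6)`, for the inner product
`-tr(A B)` (up to a factor). -/
def perp (x : M) (𝔤 : Set (Module.End ℝ (TangentSpace (𝓡 6) x))) :
    Set (Module.End ℝ (TangentSpace (𝓡 6) x)) :=
  {A | A ∈ so x ∧ ∀ B ∈ 𝔤, LinearMap.trace ℝ (TangentSpace (𝓡 6) x) (A * B) = 0}

/-- Elements of `T*M ⊗ End(TM)` at `x`: `T u v` is `T_u v`. -/
abbrev Torsion (x : M) : Type := TangentSpace (𝓡 6) x →ₗ[ℝ] Module.End ℝ (TangentSpace (𝓡 6) x)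

/-- `T` is the intrinsic torsion at `x` of the `SU(3)`-structure: it takes values in `su(3)^⊥` and
`∇ + T` is an `SU(3)`-connection, i.e. annihilates `ω`, `ψ₊` and `ψ₋` (it is metric since `T` takes
values in `so(6)`). These conditions determine `T` uniquely. -/
structure IsIntrinsicTorsion (x : M) (T : Torsion x) : Prop where
  mem_perp : ∀ u, T u ∈ perp x (S.specialUnitaryAlg x)
  parallel_kahlerForm : ∀ u v, covDerivForm S.kahlerForm x u v + endAction (T u) (S.kahlerForm x) v = 0
  parallel_ψp : ∀ u v, covDerivForm S.ψp x u v + endAction (T u) (S.ψp x) v = 0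
  parallel_ψm : ∀ u v, covDerivForm S.ψm x u v + endAction (T u) (S.ψm x) v = 0

/-- The tensor `a = -ξω ∈ T*M ⊗ Λ²T*M` associated with `ξ`. If `ξ + η` is the intrinsic torsion
(with `η ∈ T*M ⊗ ℝω`), then `a = ∇ω`. -/
def torsionForm (x : M) (ξ : Torsion x) (u v w : TangentSpace (𝓡 6) x) : ℝ :=
  -endAction (ξ u) (S.kahlerForm x) ![v, w]

/-- The Gray-Hervella module `W₁ ⊂ T*M ⊗ u(3)^⊥`: the tensors `ξ` for which `a = -ξω` satisfies
`a(u, u, w) = 0`. -/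
def W1 (x : M) : Set (Torsion x) :=
  {ξ | (∀ u, ξ u ∈ perp x (S.unitaryAlg x)) ∧ ∀ u w, S.torsionForm x ξ u u w = 0}

/-- The bilinear form `r(a)`, `2 r(a)(u, v) = ⟨u ⌟ ψ₊, v ⌟ a⟩` for `a = -ξω`, with the inner product
`⟨b, c⟩ = (1 / 2!) ∑ᵢⱼ b(eᵢ, eⱼ) c(eᵢ, eⱼ)` of 2-forms. -/
def r (x : M) (ξ : Torsion x) (u v : TangentSpace (𝓡 6) x) : ℝ :=
  (1 / 2) * ((1 / 2) * ∑ i, ∑ j,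
    S.ψp x ![u, stdOrthonormalBasis ℝ (TangentSpace (𝓡 6) x) i,
        stdOrthonormalBasis ℝ (TangentSpace (𝓡 6) x) j] *
      S.torsionForm x ξ v (stdOrthonormalBasis ℝ (TangentSpace (𝓡 6) x) i)
        (stdOrthonormalBasis ℝ (TangentSpace (𝓡 6) x) j))

/-- The `SU(3)`-module `W₁⁺`: elements of `W₁` with `r` symmetric. -/
def W1p (x : M) : Set (Torsion x) := {ξ | ξ ∈ S.W1 x ∧ ∀ u v, S.r x ξ u v = S.r x ξ v u}

/-- The `SU(3)`-module `W₁⁻`: elements of `W₁` with `r` skew-symmetric. -/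
def W1m (x : M) : Set (Torsion x) := {ξ | ξ ∈ S.W1 x ∧ ∀ u v, S.r x ξ u v = -S.r x ξ v u}

/-- The module `W₅ = T*M ⊗ ℝω`: the tensors `η_u v = η̂(u) Jv` with `η̂` a one-form. -/
def W5 (x : M) : Set (Torsion x) :=
  {η | ∃ ηhat : TangentSpace (𝓡 6) x →ₗ[ℝ] ℝ, ∀ u v, η u v = ηhat u • S.J x v}

/-- The structure is of type `𝒲`, where `𝒲 x ⊆ T*_x M ⊗ su(3)^⊥`: at each point the intrinsic
torsion lies in `𝒲`. -/
def IsOfType (𝒲 : Π x : M, Set (Torsion x)) : Prop :=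
  ∀ x : M, ∃ T : Torsion x, S.IsIntrinsicTorsion x T ∧ T ∈ 𝒲 x

/-- The sum `W₁⁺ + W₁⁻ + W₅`. -/
def W1pW1mW5 (x : M) : Set (Torsion x) :=
  {T | ∃ ξp ∈ S.W1p x, ∃ ξm ∈ S.W1m x, ∃ η ∈ S.W5 x, T = ξp + ξm + η}

end SU3Structure

end SpecialAlmostHermitian

/-! ### Calculus in the chart centred at a point: commuting extensions and functions with zero
differential. -/

noncomputable section ManifoldCalculus

variable {E : Type*} [NormedAddCommGroup E] [NormedSpace ℝ E] [FiniteDimensional ℝ E]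
  {M : Type*} [TopologicalSpace M] [ChartedSpace E M] [IsManifold 𝓘(ℝ, E) ∞ M]

local notation "⟪" u ", " v "⟫" => inner ℝ u v

/-! Write the intrinsic torsion as `ξ + η ⊗ J` with `ξ ∈ W₁`. An element of `W₁` is skew,
anticommutes with `J` and satisfies `ξ_u u = 0`, so `(∇_u ω)(v, y) = 2⟨ξ_u v, Jy⟩` is a three-form
of type (3,0) + (0,3). It is therefore `Re(w̄Ψ)` for a complex function `w = w₁⁺ + i w₁⁻`
(`exists_hasTorsion`). Since `w` is recovered from `∇ω` and `Ψ` by linear algebra, it is smooth.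

Because `∇ + T` preserves `Ψ`, the form `χ = Re(w̄Ψ)` satisfies `∇_u χ = -|w|² ⟨u, ·⟩ ∧ ω +
Re(β(u)Ψ)` with `β = dw̄ + 3iηw̄` (`mvfderiv_volRe`). The first term is `ξ_u` acting on its own
three-form (`re_conj_mul_eq`). Everything then follows from two Ricci identities.

The Ricci identity for `ω` says that `K = R - |w|² R_sphere` commutes with `J` up to the
antisymmetrisation of `β ⊗ Ψ` (`riemann_J`). The Bianchi identity for `K`, and the fact that there
are no (4,0)-forms in complex dimension three, force `β = 0` (`eq_zero_of_curvature`). Hence `dw =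
3iηw`, and `α = |w|²` is constant on the connected manifold. It is positive, for `w = 0` everywhere
would make the torsion equal to `η ⊗ J`, which is type `W₅`.

Now `K` takes values in `u(3)` and `∇χ = -α ⟨u, ·⟩ ∧ ω`. The Ricci identity for `χ` says that `K`
annihilates `χ` (`volRe_curvatureSubSphere`). As `w ≠ 0`, an element of `u(3)` that annihilates
`Re(w̄Ψ)` has zero complex trace, and a curvature tensor with values in `su(3)` is Ricci-flat
(`ricci_eq_zero`). So `Ric` and `Ric*` are `α` times those of the unit six-sphere, namely `5α` and
`α` times the metric. -/

theorem contMDiffAt_mvfderiv_apply {f : M → ℝ} {X : Π x : M, TangentSpace 𝓘(ℝ, E) x} {x : M}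
    (hf : CMDiffAt ∞ f x) (hX : CMDiffAt ∞ (T% X) x) :
    CMDiffAt ∞ (fun y ↦ d% f y (X y)) x := by
  have h := hf.mfderiv_const (m := ∞) le_rfl
  have h2 := ContMDiffAt.clm_apply_of_inCoordinates (b₁ := id) h hX hf
  rw [contMDiffAt_totalSpace] at h2
  simpa [mvfderiv] using! h2.2

theorem eventually_contMDiffAt_extend {x : M} (u : TangentSpace 𝓘(ℝ, E) x) :
    ∀ᶠ y in 𝓝 x, CMDiffAt ∞ (T% (extend E u)) y := by
  obtain ⟨s, hs, h⟩ := exists_contMDiffOn_extend (k := ∞) 𝓘(ℝ, E) E u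
  filter_upwards [eventually_mem_nhds_iff.2 hs] with y hy
  exact h.contMDiffAt hy

/-- In the chart at `x`, the field `extend E u` is constant. -/
theorem extend_eq_mfderiv_symm {x : M} (u : TangentSpace 𝓘(ℝ, E) x) :
    ∃ w : E, ∀ y ∈ (chartAt E x).source, (extend E u : Π y : M, TangentSpace 𝓘(ℝ, E) y) y =
      mfderiv 𝓘(ℝ, E) 𝓘(ℝ, E) (extChartAt 𝓘(ℝ, E) x).symm (extChartAt 𝓘(ℝ, E) x y) w := by
  refine ⟨(trivializationAt E (TangentSpace 𝓘(ℝ, E)) x ⟨x, u⟩).2, fun y hy ↦ ?_⟩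
  have := TangentBundle.symmL_trivializationAt (I := 𝓘(ℝ, E)) hy
  rw [modelWithCornersSelf_coe, Set.range_id, mfderivWithin_univ] at this
  have h2 := (trivializationAt E (TangentSpace 𝓘(ℝ, E)) x).symmL_apply (R := ℝ) (b := y)
    (by simpa using hy) (trivializationAt E (TangentSpace 𝓘(ℝ, E)) x ⟨x, u⟩).2
  rw [this] at h2
  exact h2.symm

/-- The constant vector field on a vector space. -/
def constVectorField (w : E) : Π z : E, TangentSpace 𝓘(ℝ, E) z := fun _ ↦ w

/-- The pullback form of the constancy in the chart, suited to the naturality of the Lie bracket. -/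
theorem extend_eq_mpullback {x : M} (u : TangentSpace 𝓘(ℝ, E) x) :
    ∃ w : E, ∀ y ∈ (chartAt E x).source, (extend E u : Π y : M, TangentSpace 𝓘(ℝ, E) y) y =
      mpullback 𝓘(ℝ, E) 𝓘(ℝ, E) (extChartAt 𝓘(ℝ, E) x) (constVectorField w) y := by
  obtain ⟨w, hw⟩ := extend_eq_mfderiv_symm u
  refine ⟨w, fun y hy ↦ ?_⟩
  rw [hw y hy, mpullback_apply]
  have hinv := isInvertible_mfderiv_extChartAt (I := 𝓘(ℝ, E)) (x := x) (y := y) (by simpa using hy)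
  have h2 := mfderiv_extChartAt_comp_mfderivWithin_extChartAt_symm' (I := 𝓘(ℝ, E)) (x := x) (y := y) (by simpa using hy)
  rw [modelWithCornersSelf_coe, Set.range_id, mfderivWithin_univ] at h2
  have h3 := DFunLike.congr_fun h2 w
  exact ((hinv.inverse_apply_eq).2 h3.symm).symm

theorem mlieBracket_constVectorField (a b : E) :
    mlieBracket 𝓘(ℝ, E) (constVectorField a) (constVectorField b) = 0 := by
  rw [← mlieBracketWithin_univ, mlieBracketWithin_eq_lieBracketWithin]
  ext z
  have h (a : E) : fderivWithin ℝ (constVectorField a) Set.univ z = 0 :=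
    fderivWithin_const_apply (c := a)
  simp only [lieBracketWithin, h]
  exact sub_self (0 : E)

/-- Both fields are pulled back from constant fields by one chart. Vanishing on the whole chart
domain, not only at `x`, is what lets the identity be differentiated later. -/
theorem mlieBracket_extend {x : M} (u v : TangentSpace 𝓘(ℝ, E) x) :
    ∀ y ∈ (chartAt E x).source,
      mlieBracket 𝓘(ℝ, E) (extend E u : Π y : M, TangentSpace 𝓘(ℝ, E) y) (extend E v) y = 0 := by
  intro y hy
  obtain ⟨a, ha⟩ := extend_eq_mpullback u
  obtain ⟨b, hb⟩ := extend_eq_mpullback v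
  have hs : (chartAt E x).source ∈ 𝓝 y := (chartAt E x).open_source.mem_nhds hy
  rw [Filter.EventuallyEq.mlieBracket_vectorField_eq (Filter.eventuallyEq_of_mem hs ha)
    (Filter.eventuallyEq_of_mem hs hb)]
  have hc (a : E) : MDiffAt (T% (constVectorField a)) (extChartAt 𝓘(ℝ, E) x y) := by
    rw [mdifferentiableAt_section]
    simpa [constVectorField] using! mdifferentiableAt_const
  have h2 : (2 : ℕ∞ω) ≤ ∞ := by
    norm_cast
  have : IsManifold 𝓘(ℝ, E) (minSmoothness ℝ 2) M := by
    simp only [minSmoothness_of_isRCLikeNormedField]; exact IsManifold.of_le (n := ∞) h2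
  have hm := mpullback_mlieBracket (n := ∞) (I := 𝓘(ℝ, E)) (hc a) (hc b) (contMDiffAt_extChartAt' (I := 𝓘(ℝ, E)) (n := ∞) hy)
    (by simpa only [minSmoothness_of_isRCLikeNormedField] using h2)
  rw [← hm, mlieBracket_constVectorField]
  simp [mpullback_apply]

/-- The direction `w` is the same for all points of the chart domain and all functions, so iterated
derivatives along extensions become iterated directional derivatives in the chart. -/
theorem mvfderiv_extend {x : M} (u : TangentSpace 𝓘(ℝ, E) x) :
    ∃ w : E, ∀ y ∈ (chartAt E x).source, ∀ {f : M → ℝ}, MDiffAt f y →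
    d% f y ((extend E u : Π y : M, TangentSpace 𝓘(ℝ, E) y) y) =
      fderiv ℝ (f ∘ (extChartAt 𝓘(ℝ, E) x).symm) (extChartAt 𝓘(ℝ, E) x y) w := by
  obtain ⟨w, hw⟩ := extend_eq_mfderiv_symm u
  refine ⟨w, fun y hy f hf ↦ ?_⟩
  rw [hw y hy]
  have hinv : (extChartAt 𝓘(ℝ, E) x).symm (extChartAt 𝓘(ℝ, E) x y) = y :=
    (extChartAt 𝓘(ℝ, E) x).left_inv (by simpa using hy)
  have hs : MDiffAt (extChartAt 𝓘(ℝ, E) x).symm (extChartAt 𝓘(ℝ, E) x y) := by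
    have := mdifferentiableWithinAt_extChartAt_symm (I := 𝓘(ℝ, E)) (x := x)
      (z := extChartAt 𝓘(ℝ, E) x y) ((extChartAt 𝓘(ℝ, E) x).map_source (by simpa using hy))
    rwa [modelWithCornersSelf_coe, Set.range_id, mdifferentiableWithinAt_univ] at this
  have := mvfderiv_comp_apply_of_eq (I := 𝓘(ℝ, E)) (extChartAt 𝓘(ℝ, E) x y) hf hs hinv w
  rw [← this, mvfderiv, mfderiv_eq_fderiv]
  rfl

theorem mvfderiv_congr {f g : M → ℝ} {x : M} (h : f =ᶠ[𝓝 x] g) : d% f x = d% g x := by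
  ext u
  have := h.mfderiv_eq (I := 𝓘(ℝ, E)) (I' := 𝓘(ℝ, ℝ))
  simp only [mvfderiv]
  exact DFunLike.congr_fun this u

/-- Symmetry of the second derivative of `f` read in the chart; this is the only source of
commutation in the Ricci identities. -/
theorem mvfderiv_extend_comm {x : M} {f : M → ℝ} (hf : ∀ᶠ y in 𝓝 x, CMDiffAt ∞ f y)
    (u v : TangentSpace 𝓘(ℝ, E) x) :
    d% (fun y ↦ d% f y ((extend E v : Π y : M, TangentSpace 𝓘(ℝ, E) y) y)) x u =
      d% (fun y ↦ d% f y ((extend E u : Π y : M, TangentSpace 𝓘(ℝ, E) y) y)) x v := by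
  set φ := extChartAt 𝓘(ℝ, E) x with hφ
  set F : E → ℝ := f ∘ φ.symm with hF
  have hx : x ∈ (chartAt E x).source := mem_chart_source E x
  have hs : (chartAt E x).source ∈ 𝓝 x := (chartAt E x).open_source.mem_nhds hx
  have hd : ∀ w : TangentSpace 𝓘(ℝ, E) x,
      MDiffAt (fun y ↦ d% f y ((extend E w : Π y : M, TangentSpace 𝓘(ℝ, E) y) y)) x := fun w ↦
    (contMDiffAt_mvfderiv_apply hf.self_of_nhds
      (eventually_contMDiffAt_extend w).self_of_nhds).mdifferentiableAt (by simp)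
  have hF : ContDiffAt ℝ ∞ F (φ x) := by
    have h1 := (contMDiffAt_iff.1 hf.self_of_nhds).2
    rw [modelWithCornersSelf_coe, Set.range_id, contDiffWithinAt_univ] at h1
    simpa only [extChartAt_model_space_eq_id] using! h1
  have hF2 : DifferentiableAt ℝ (fderiv ℝ F) (φ x) :=
    (hF.fderiv_right (m := ∞) le_rfl).differentiableAt (by simp)
  have key : ∀ (w : TangentSpace 𝓘(ℝ, E) x) (c : E),
      (∀ y ∈ (chartAt E x).source, ∀ {f : M → ℝ}, MDiffAt f y →
        d% f y ((extend E w : Π y : M, TangentSpace 𝓘(ℝ, E) y) y) =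
          fderiv ℝ (f ∘ φ.symm) (φ y) c) →
      (fun y ↦ d% f y ((extend E w : Π y : M, TangentSpace 𝓘(ℝ, E) y) y)) ∘ φ.symm =ᶠ[𝓝 (φ x)]
        fun z ↦ fderiv ℝ F z c := by
    intro w c hc
    have hcont := continuousAt_extChartAt_symm (I := 𝓘(ℝ, E)) x
    have hxx : φ.symm (φ x) = x := (extChartAt 𝓘(ℝ, E) x).left_inv (by simp)
    have h1 := hcont.eventually (by rw [hxx]; exact hs)
    have h2 := hcont.eventually (by rw [hxx]; exact hf)
    filter_upwards [(isOpen_extChartAt_target (I := 𝓘(ℝ, E)) x).mem_nhds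
      (mem_extChartAt_target x), h1, h2] with z hz hz1 hz2
    simp only [Function.comp]
    rw [hc _ hz1 (hz2.mdifferentiableAt (by simp)), φ.right_inv hz]
  obtain ⟨a, ha⟩ := mvfderiv_extend u
  obtain ⟨b, hb⟩ := mvfderiv_extend v
  have h1 := ha x hx (hd v)
  have h2 := hb x hx (hd u)
  rw [extend_apply_self, (key v b hb).fderiv_eq, fderiv_clm_apply hF2 (by fun_prop)] at h1
  rw [extend_apply_self, (key u a ha).fderiv_eq, fderiv_clm_apply hF2 (by fun_prop)] at h2
  rw [h1, h2]
  have hsymm : IsSymmSndFDerivAt ℝ F (φ x) := hF.isSymmSndFDerivAt (by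
    simp only [minSmoothness_of_isRCLikeNormedField]; norm_cast)
  simpa using hsymm a b

/-- On a ball inside the chart target the mean value theorem makes `f` constant, so `f` is locally
constant. -/
theorem exists_eq_of_mvfderiv_eq_zero [ConnectedSpace M] {f : M → ℝ}
    (hf : ContMDiff 𝓘(ℝ, E) 𝓘(ℝ, ℝ) ∞ f) (h : ∀ x, d% f x = 0) : ∃ c, ∀ x, f x = c := by
  have hloc : IsLocallyConstant f := by
    rw [IsLocallyConstant.iff_eventually_eq]
    intro x
    set φ := extChartAt 𝓘(ℝ, E) x with hφ
    obtain ⟨ε, hε, hb⟩ := Metric.isOpen_iff.1 (isOpen_extChartAt_target (I := 𝓘(ℝ, E)) x) _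
      (mem_extChartAt_target x)
    have hsymm : ∀ z ∈ φ.target, MDiffAt φ.symm z := by
      intro z hz
      have := mdifferentiableWithinAt_extChartAt_symm (I := 𝓘(ℝ, E)) hz
      rwa [modelWithCornersSelf_coe, Set.range_id, mdifferentiableWithinAt_univ] at this
    have hd : ∀ z ∈ φ.target, MDiffAt (f ∘ φ.symm) z := fun z hz ↦
      ((hf _).mdifferentiableAt (by simp)).comp z (hsymm z hz)
    have hd0 : ∀ z ∈ φ.target, fderiv ℝ (f ∘ φ.symm) z = 0 := by
      intro z hz
      ext w
      have := mvfderiv_comp_apply (I := 𝓘(ℝ, E)) z ((hf (φ.symm z)).mdifferentiableAt (by simp)) (hsymm z hz) w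
      rw [h, mvfderiv, mfderiv_eq_fderiv] at this
      exact this
    have hconst : ∀ z ∈ Metric.ball (φ x) ε, (f ∘ φ.symm) z = (f ∘ φ.symm) (φ x) := by
      intro z hz
      refine (convex_ball (φ x) ε).is_const_of_fderivWithin_eq_zero (𝕜 := ℝ)
        (fun y hy ↦ (hd y (hb hy)).differentiableAt.differentiableWithinAt) ?_ hz
        (Metric.mem_ball_self hε)
      intro y hy
      rw [fderivWithin_of_isOpen Metric.isOpen_ball hy, hd0 y (hb hy)]
    have hc := (continuousAt_extChartAt (I := 𝓘(ℝ, E)) x).eventually (Metric.ball_mem_nhds _ hε)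
    filter_upwards [hc, extChartAt_source_mem_nhds (I := 𝓘(ℝ, E)) x] with y hy hys
    have := hconst _ hy
    simp only [Function.comp] at this
    rwa [φ.left_inv hys, φ.left_inv (mem_extChartAt_source x)] at this
  obtain ⟨x₀⟩ : Nonempty M := inferInstance
  exact ⟨f x₀, fun x ↦ hloc.apply_eq_of_preconnectedSpace x x₀⟩

end ManifoldCalculus

/-! ### Smoothness of the Levi-Civita connection on smooth fields. -/

noncomputable section LeviCivitaSmooth

variable {E : Type*} [NormedAddCommGroup E] [NormedSpace ℝ E] [FiniteDimensional ℝ E]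
  {M : Type*} [TopologicalSpace M] [ChartedSpace E M] [IsManifold 𝓘(ℝ, E) ∞ M]
  [RiemannianBundle (fun x : M ↦ TangentSpace 𝓘(ℝ, E) x)]
  [IsContMDiffRiemannianBundle 𝓘(ℝ, E) ∞ E (fun x : M ↦ TangentSpace 𝓘(ℝ, E) x)]

local notation "⟪" u ", " v "⟫" => inner ℝ u v

theorem contMDiffAt_inner {x : M} {X Y : Π x : M, TangentSpace 𝓘(ℝ, E) x}
    (hX : CMDiffAt ∞ (T% X) x) (hY : CMDiffAt ∞ (T% Y) x) : CMDiffAt ∞ (fun y ↦ ⟪X y, Y y⟫) x :=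
  ContMDiffAt.inner_bundle (F := E) (E := fun x : M ↦ TangentSpace 𝓘(ℝ, E) x) (b := id) hX hY

theorem contMDiffAt_mlieBracket {x : M} {X Y : Π x : M, TangentSpace 𝓘(ℝ, E) x}
    (hX : CMDiffAt ∞ (T% X) x) (hY : CMDiffAt ∞ (T% Y) x) :
    CMDiffAt ∞ (T% (mlieBracket 𝓘(ℝ, E) X Y)) x := by
  have : IsManifold 𝓘(ℝ, E) (minSmoothness ℝ 2) M := by
    simp only [minSmoothness_of_isRCLikeNormedField]
    exact IsManifold.of_le (n := ∞) (by norm_cast)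
  have : IsManifold 𝓘(ℝ, E) (((⊤ : ℕ∞) : ℕ∞ω) + 1) M := ‹IsManifold 𝓘(ℝ, E) ∞ M›
  exact ContMDiffAt.mlieBracket_vectorField (m := ⊤) (n := ⊤) hX hY
    (by simp only [minSmoothness_of_isRCLikeNormedField]; exact le_rfl)

theorem contMDiffAt_koszul {x : M} {X Y Z : Π x : M, TangentSpace 𝓘(ℝ, E) x}
    (hX : CMDiffAt ∞ (T% X) x) (hY : CMDiffAt ∞ (T% Y) x) (hZ : CMDiffAt ∞ (T% Z) x) :
    CMDiffAt ∞ (fun y ↦ koszul X Y Z y) x := by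
  unfold koszul
  have h1 := contMDiffAt_mvfderiv_apply (contMDiffAt_inner hY hZ) hX
  have h2 := contMDiffAt_mvfderiv_apply (contMDiffAt_inner hX hZ) hY
  have h3 := contMDiffAt_mvfderiv_apply (contMDiffAt_inner hX hY) hZ
  have h4 := contMDiffAt_inner (contMDiffAt_mlieBracket hX hY) hZ
  have h5 := contMDiffAt_inner (contMDiffAt_mlieBracket hX hZ) hY
  have h6 := contMDiffAt_inner (contMDiffAt_mlieBracket hY hZ) hX
  exact contMDiffAt_const.mul (((((h1.add h2).sub h3).add h4).sub h5).sub h6)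

theorem contMDiffAt_det {n : Type*} [Fintype n] [DecidableEq n] {G : M → Matrix n n ℝ} {x : M}
    (hG : ∀ i j, CMDiffAt ∞ (fun y ↦ G y i j) x) : CMDiffAt ∞ (fun y ↦ (G y).det) x := by
  simp only [Matrix.det_apply, Units.smul_def, zsmul_eq_mul]
  exact ContMDiffAt.sum fun σ _ ↦ contMDiffAt_const.mul (ContMDiffAt.prod fun i _ ↦ hG _ _)

/-- A vector field is smooth at `x` if its inner products with all smooth fields are smooth. -/
theorem contMDiffAt_of_inner {x : M} {Z : Π x : M, TangentSpace 𝓘(ℝ, E) x}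
    (h : ∀ Y : Π x : M, TangentSpace 𝓘(ℝ, E) x, (∀ᶠ y in 𝓝 x, CMDiffAt ∞ (T% Y) y) →
      CMDiffAt ∞ (fun y ↦ ⟪Z y, Y y⟫) x) : CMDiffAt ∞ (T% Z) x := by
  let t := trivializationAt E (TangentSpace 𝓘(ℝ, E) : M → Type _) x
  have hx : x ∈ t.baseSet := FiberBundle.mem_baseSet_trivializationAt E (TangentSpace 𝓘(ℝ, E) : M → Type _) x
  let b := Module.finBasis ℝ E
  let s := t.localFrame b
  have hs (i) : ∀ᶠ y in 𝓝 x, CMDiffAt ∞ (T% (s i)) y := by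
    filter_upwards [t.open_baseSet.mem_nhds hx] with y hy
    exact contMDiffAt_localFrame_of_mem ∞ _ b i hy
  -- The coefficients of `Z` in the frame solve the linear system with Gram matrix `G` and
  -- right-hand side `d`. Cramer's rule writes them as quotients of determinants with smooth
  -- entries.
  let G : M → Matrix (Fin (Module.finrank ℝ E)) (Fin (Module.finrank ℝ E)) ℝ :=
    fun y ↦ Matrix.gram ℝ (fun i ↦ s i y)
  let d : M → Fin (Module.finrank ℝ E) → ℝ := fun y j ↦ ⟪Z y, s j y⟫
  have hfr := t.isLocalFrameOn_localFrame_baseSet 𝓘(ℝ, E) ∞ b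
  have hdet : ∀ y ∈ t.baseSet, (G y).det ≠ 0 := fun y hy ↦
    Matrix.det_gram_ne_zero_iff_linearIndependent.2 (hfr.linearIndependent hy)
  have hG (i j) : CMDiffAt ∞ (fun y ↦ G y i j) x :=
    contMDiffAt_inner (hs i).self_of_nhds (hs j).self_of_nhds
  refine hfr.contMDiffAt_of_coeff (fun i ↦ ?_) (t.open_baseSet.mem_nhds hx)
  have hnum : CMDiffAt ∞ (fun y ↦ ((G y).updateCol i (d y)).det) x := by
    refine contMDiffAt_det fun j k ↦ ?_
    by_cases hk : k = i
    · subst hk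
      simpa [Matrix.updateCol_apply] using! h _ (hs j)
    · simpa [Matrix.updateCol_apply, hk] using! hG j k
  refine (hnum.div₀ (contMDiffAt_det hG) (hdet x hx)).congr_of_eventuallyEq ?_
  filter_upwards [t.open_baseSet.mem_nhds hx] with y hy
  have hd : d y = (G y).mulVec fun i ↦ hfr.coeff i y (Z y) := by
    ext j
    have := hfr.coeff_sum_eq Z hy
    simp only [d, Matrix.mulVec, dotProduct, G, Matrix.gram_apply]
    conv_lhs => rw [this]
    rw [sum_inner]
    refine Finset.sum_congr rfl fun k _ ↦ ?_
    rw [inner_smul_left, real_inner_comm, mul_comm]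
    rfl
  have hcr : (G y).cramer (d y) = (G y).det • fun i ↦ hfr.coeff i y (Z y) := by
    rw [hd, Matrix.cramer_eq_adjugate_mulVec, Matrix.mulVec_mulVec, Matrix.adjugate_mul,
      Matrix.smul_mulVec, Matrix.one_mulVec]
  have := congrFun hcr i
  rw [Matrix.cramer_apply] at this
  change hfr.coeff i y (Z y) = ((G y).updateCol i (d y)).det / (G y).det
  rw [this, eq_div_iff (hdet y hy), mul_comm]
  rfl

/-- Pairing with a smooth test field gives the Koszul expression, which is smooth. The identity is
needed near `x`, hence the hypotheses on neighbourhoods. -/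
theorem contMDiffAt_leviCivita {x : M} {X Y : Π x : M, TangentSpace 𝓘(ℝ, E) x}
    (hX : ∀ᶠ y in 𝓝 x, CMDiffAt ∞ (T% X) y) (hY : ∀ᶠ y in 𝓝 x, CMDiffAt ∞ (T% Y) y) :
    CMDiffAt ∞ (T% (fun y ↦ leviCivita 𝓘(ℝ, E) M Y y (X y))) x := by
  refine contMDiffAt_of_inner fun Z hZ ↦ ?_
  refine (contMDiffAt_koszul hX.self_of_nhds hY.self_of_nhds hZ.self_of_nhds).congr_of_eventuallyEq ?_
  filter_upwards [hX, hY, hZ] with y hX hY hZ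
  exact inner_leviCivitaFun (hX.mdifferentiableAt (by simp)) (hY.mdifferentiableAt (by simp))
    (hZ.mdifferentiableAt (by simp))

end LeviCivitaSmooth

/-! ### Tensoriality of the covariant derivative of forms. -/

noncomputable section FormDerivative

variable {E : Type*} [NormedAddCommGroup E] [NormedSpace ℝ E] [FiniteDimensional ℝ E]
  {M : Type*} [TopologicalSpace M] [ChartedSpace E M] [IsManifold 𝓘(ℝ, E) ∞ M]

section

variable {k : ℕ} {φ : Π y : M, MultilinearMap ℝ (fun _ : Fin k ↦ TangentSpace 𝓘(ℝ, E) y) ℝ} {x : M}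

/-- A field of multilinear forms that is differentiable on smooth vector fields is differentiable
on differentiable vector fields. -/
theorem mdifferentiableAt_multilinear
    (hφ : ∀ V : Fin k → Π y : M, TangentSpace 𝓘(ℝ, E) y, (∀ i, CMDiffAt ∞ (T% (V i)) x) →
      MDiffAt (fun y ↦ φ y (fun i ↦ V i y)) x)
    {V : Fin k → Π y : M, TangentSpace 𝓘(ℝ, E) y} (hV : ∀ i, MDiffAt (T% (V i)) x) :
    MDiffAt (fun y ↦ φ y (fun i ↦ V i y)) x := by
  classical
  let t := trivializationAt E (TangentSpace 𝓘(ℝ, E) : M → Type _) x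
  have hx : x ∈ t.baseSet :=
    FiberBundle.mem_baseSet_trivializationAt E (TangentSpace 𝓘(ℝ, E) : M → Type _) x
  let b := Module.finBasis ℝ E
  let s := t.localFrame b
  let c := t.localFrameCoeff 𝓘(ℝ, E) b
  have hs (i) : CMDiffAt ∞ (T% (s i)) x := contMDiffAt_localFrame_of_mem ∞ _ b i hx
  have hc (i) (j) : MDiffAt (fun y ↦ c i y (V j y)) x :=
    mdifferentiableAt_localFrameCoeff b hx (hV j) i
  -- Expanding every argument in a smooth local frame leaves differentiable coefficients times
  -- values of `φ` on smooth fields.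
  have hsum : MDiffAt (fun y ↦ ∑ r : Fin k → Fin (Module.finrank ℝ E),
      (∏ i, c (r i) y (V i y)) * φ y (fun i ↦ s (r i) y)) x := by
    have := MDifferentiableAt.sum (I := 𝓘(ℝ, E)) (t := Finset.univ) (z := x)
      (f := fun (r : Fin k → Fin (Module.finrank ℝ E)) y ↦
        (∏ i, c (r i) y (V i y)) * φ y (fun i ↦ s (r i) y)) fun r _ ↦ by
      refine MDifferentiableAt.mul ?_ (hφ (fun i ↦ s (r i)) fun i ↦ hs (r i))
      have := MDifferentiableAt.prod (I := 𝓘(ℝ, E)) (t := Finset.univ) (z := x)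
        (f := fun i y ↦ c (r i) y (V i y)) fun i _ ↦ hc (r i) i
      convert this using 1
      ext y
      simp
    convert this using 1
    ext y
    simp
  refine hsum.congr_of_eventuallyEq ?_
  filter_upwards [t.open_baseSet.mem_nhds hx] with y hy
  have he : (fun i ↦ V i y) = fun i ↦ ∑ j, c j y (V i y) • s j y := by
    ext i
    exact t.eq_sum_localFrameCoeff_smul (I := 𝓘(ℝ, E)) (b := b) (s := V i) hy
  conv_lhs => rw [he]
  rw [MultilinearMap.map_sum]
  refine Finset.sum_congr rfl fun r _ ↦ ?_
  rw [MultilinearMap.map_smul_univ, smul_eq_mul]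

variable [RiemannianBundle (fun x : M ↦ TangentSpace 𝓘(ℝ, E) x)]
  [IsContMDiffRiemannianBundle 𝓘(ℝ, E) ∞ E (fun x : M ↦ TangentSpace 𝓘(ℝ, E) x)]

variable (φ x) in
/-- `u(φ(V₁, …, V_k)) - ∑ᵢ φ(V₁, …, ∇_u Vᵢ, …, V_k)` for vector fields `Vᵢ`. -/
def formDeriv (u : TangentSpace 𝓘(ℝ, E) x) (V : Fin k → Π y : M, TangentSpace 𝓘(ℝ, E) y) : ℝ :=
  d% (fun y ↦ φ y (fun i ↦ V i y)) x u
    - ∑ i, φ x (Function.update (fun j ↦ V j x) i (leviCivita 𝓘(ℝ, E) M (V i) x u))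

theorem covDerivForm_eq_formDeriv (u : TangentSpace 𝓘(ℝ, E) x)
    (v : Fin k → TangentSpace 𝓘(ℝ, E) x) :
    covDerivForm (fun y ↦ φ y) x u v = formDeriv φ x u (fun i ↦ extend E (v i)) := by
  simp [covDerivForm, formDeriv]

theorem update_apply_field (V : Fin k → Π y : M, TangentSpace 𝓘(ℝ, E) y) (i : Fin k)
    (σ : Π y : M, TangentSpace 𝓘(ℝ, E) y) (y : M) :
    (fun j ↦ Function.update V i σ j y) = Function.update (fun j ↦ V j y) i (σ y) := by
  ext j
  by_cases h : j = i
  · subst h; simp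
  · simp [h]

theorem formDeriv_update (u : TangentSpace 𝓘(ℝ, E) x)
    (V : Fin k → Π y : M, TangentSpace 𝓘(ℝ, E) y) (i : Fin k)
    (σ : Π y : M, TangentSpace 𝓘(ℝ, E) y) :
    formDeriv φ x u (Function.update V i σ) =
      d% (fun y ↦ φ y (Function.update (fun j ↦ V j y) i (σ y))) x u
      - (φ x (Function.update (fun j ↦ V j x) i (leviCivita 𝓘(ℝ, E) M σ x u))
      + ∑ j ∈ Finset.univ.erase i, φ x (Function.update (Function.update (fun j ↦ V j x) j
          (leviCivita 𝓘(ℝ, E) M (V j) x u)) i (σ x))) := by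
  simp only [formDeriv, update_apply_field]
  rw [← Finset.add_sum_erase _ _ (Finset.mem_univ i)]
  simp only [Function.update_self, Function.update_idem]
  congr 2
  refine Finset.sum_congr rfl fun j hj ↦ ?_
  have hji : j ≠ i := Finset.ne_of_mem_erase hj
  rw [Function.update_of_ne hji, Function.update_comm hji.symm]

/-- The derivative of the factor `f` appears once from differentiating the value of `φ` and once
from the Leibniz rule for `∇`, with opposite signs. -/
theorem formDeriv_tensorialAt
    (hφ : ∀ V : Fin k → Π y : M, TangentSpace 𝓘(ℝ, E) y, (∀ i, MDiffAt (T% (V i)) x) →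
      MDiffAt (fun y ↦ φ y (fun i ↦ V i y)) x)
    (u : TangentSpace 𝓘(ℝ, E) x)
    {V : Fin k → Π y : M, TangentSpace 𝓘(ℝ, E) y} (hV : ∀ i, MDiffAt (T% (V i)) x) (i : Fin k) :
    TensorialAt 𝓘(ℝ, E) E (fun σ ↦ formDeriv φ x u (Function.update V i σ)) x := by
  have hd {σ : Π y : M, TangentSpace 𝓘(ℝ, E) y} (hσ : MDiffAt (T% σ) x) :
      MDiffAt (fun y ↦ φ y (Function.update (fun j ↦ V j y) i (σ y))) x := by
    have := hφ (Function.update V i σ) (fun j ↦ by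
      by_cases h : j = i
      · subst h; simpa using hσ
      · simpa [h] using hV j)
    simpa only [update_apply_field] using this
  constructor
  · intro f σ hf hσ
    simp only [formDeriv_update, Pi.smul_apply', MultilinearMap.map_update_smul, smul_eq_mul]
    rw [mvfderiv_fun_mul hf (hd hσ), (leviCivita 𝓘(ℝ, E) M).isCovariantDerivativeOn.leibniz hσ hf]
    simp [MultilinearMap.map_update_add, MultilinearMap.map_update_smul, ← Finset.mul_sum]
    ring
  · intro σ σ' hσ hσ'
    simp only [formDeriv_update, Pi.add_apply, MultilinearMap.map_update_add]
    rw [mvfderiv_fun_add (hd hσ) (hd hσ'), (leviCivita 𝓘(ℝ, E) M).isCovariantDerivativeOn.add hσ hσ']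
    simp [MultilinearMap.map_update_add, Finset.sum_add_distrib]
    ring

/-- `covDerivForm` is defined through particular extensions; this frees it from that choice. -/
theorem formDeriv_congr
    (hφ : ∀ V : Fin k → Π y : M, TangentSpace 𝓘(ℝ, E) y, (∀ i, MDiffAt (T% (V i)) x) →
      MDiffAt (fun y ↦ φ y (fun i ↦ V i y)) x)
    (u : TangentSpace 𝓘(ℝ, E) x)
    {V V' : Fin k → Π y : M, TangentSpace 𝓘(ℝ, E) y} (hV : ∀ i, MDiffAt (T% (V i)) x)
    (hV' : ∀ i, MDiffAt (T% (V' i)) x) (h : ∀ i, V i x = V' i x) :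
    formDeriv φ x u V = formDeriv φ x u V' := by
  classical
  -- The arguments are exchanged one slot at a time, using tensoriality in each slot.
  suffices H : ∀ s : Finset (Fin k), formDeriv φ x u V = formDeriv φ x u (s.piecewise V' V) by
    simpa using H Finset.univ
  intro s
  induction s using Finset.induction_on with
  | empty => simp
  | insert j s hj ih =>
    rw [ih, Finset.piecewise_insert]
    have hP : ∀ i, MDiffAt (T% (s.piecewise V' V i)) x := fun i ↦ by
      by_cases hi : i ∈ s
      · simpa [hi] using hV' i
      · simpa [hi] using hV i
    conv_lhs => rw [← Function.update_eq_self j (s.piecewise V' V)]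
    refine (formDeriv_tensorialAt hφ u hP j).pointwise (hP j) (hV' j) ?_
    simp [hj, h]

/-- The Leibniz rule for a field of multilinear forms. -/
theorem mvfderiv_form
    (hφ : ∀ V : Fin k → Π y : M, TangentSpace 𝓘(ℝ, E) y, (∀ i, MDiffAt (T% (V i)) x) →
      MDiffAt (fun y ↦ φ y (fun i ↦ V i y)) x)
    (u : TangentSpace 𝓘(ℝ, E) x)
    {V : Fin k → Π y : M, TangentSpace 𝓘(ℝ, E) y} (hV : ∀ i, MDiffAt (T% (V i)) x) :
    d% (fun y ↦ φ y (fun i ↦ V i y)) x u =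
      ∑ i, φ x (Function.update (fun j ↦ V j x) i (leviCivita 𝓘(ℝ, E) M (V i) x u))
      + covDerivForm (fun y ↦ φ y) x u (fun i ↦ V i x) := by
  rw [covDerivForm_eq_formDeriv, ← formDeriv_congr hφ u hV
    (fun i ↦ mdifferentiableAt_extend 𝓘(ℝ, E) E (V i x)) (fun i ↦ by simp), formDeriv]
  ring

end

end FormDerivative

/-! ### Curvature symmetries and the Ricci identities for bilinear and trilinear forms. -/

noncomputable section RicciIdentity

variable {E : Type*} [NormedAddCommGroup E] [NormedSpace ℝ E] [FiniteDimensional ℝ E]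
  {M : Type*} [TopologicalSpace M] [ChartedSpace E M] [IsManifold 𝓘(ℝ, E) ∞ M]
  [RiemannianBundle (fun x : M ↦ TangentSpace 𝓘(ℝ, E) x)]
  [IsContMDiffRiemannianBundle 𝓘(ℝ, E) ∞ E (fun x : M ↦ TangentSpace 𝓘(ℝ, E) x)]

local notation "⟪" u ", " v "⟫" => inner ℝ u v

/-- The vector field `X` is smooth in a neighbourhood of `x`. -/
def SmoothNear (x : M) (X : Π y : M, TangentSpace 𝓘(ℝ, E) y) : Prop :=
  ∀ᶠ y in 𝓝 x, CMDiffAt ∞ (T% X) y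

namespace SmoothNear

variable {x : M} {X Y : Π y : M, TangentSpace 𝓘(ℝ, E) y}

theorem contMDiffAt (h : SmoothNear x X) : CMDiffAt ∞ (T% X) x := h.self_of_nhds

theorem mdifferentiableAt (h : SmoothNear x X) : MDiffAt (T% X) x :=
  h.contMDiffAt.mdifferentiableAt (by simp)

theorem extend (u : TangentSpace 𝓘(ℝ, E) x) : SmoothNear x (extend E u) :=
  eventually_contMDiffAt_extend u

theorem leviCivita (hX : SmoothNear x X) (hY : SmoothNear x Y) :
    SmoothNear x (fun y ↦ leviCivita 𝓘(ℝ, E) M Y y (X y)) := by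
  filter_upwards [hX.eventually_nhds, hY.eventually_nhds] with y hX hY
  exact contMDiffAt_leviCivita hX hY

end SmoothNear

/-- `∇_U A` for the local extension `U` of the tangent vector `u`. -/
def nablaExtend {x : M} (u : TangentSpace 𝓘(ℝ, E) x) (A : Π y : M, TangentSpace 𝓘(ℝ, E) y) :
    Π y : M, TangentSpace 𝓘(ℝ, E) y :=
  fun y ↦ leviCivita 𝓘(ℝ, E) M A y ((extend E u : Π y : M, TangentSpace 𝓘(ℝ, E) y) y)

theorem SmoothNear.nablaExtend {x : M} (u : TangentSpace 𝓘(ℝ, E) x)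
    {A : Π y : M, TangentSpace 𝓘(ℝ, E) y} (hA : SmoothNear x A) :
    SmoothNear x (nablaExtend u A) := (SmoothNear.extend u).leviCivita hA

theorem nablaExtend_apply_self {x : M} (u : TangentSpace 𝓘(ℝ, E) x)
    (A : Π y : M, TangentSpace 𝓘(ℝ, E) y) :
    nablaExtend u A x = leviCivita 𝓘(ℝ, E) M A x u := by
  simp [_root_.nablaExtend]

/-- The torsion is zero and the extensions commute near `x`. -/
theorem nablaExtend_extend_comm {x : M} (u v : TangentSpace 𝓘(ℝ, E) x) :
    ∀ᶠ y in 𝓝 x, nablaExtend u (extend E v) y = nablaExtend v (extend E u) y := by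
  filter_upwards [(chartAt E x).open_source.mem_nhds (mem_chart_source E x),
    SmoothNear.extend u, SmoothNear.extend v] with y hy hu hv
  have h := (CovariantDerivative.torsion_eq_zero_iff (leviCivita 𝓘(ℝ, E) M)).1
    (leviCivita_torsion (I := 𝓘(ℝ, E)) (M := M))
    (hu.mdifferentiableAt (by simp)) (hv.mdifferentiableAt (by simp))
  rw [mlieBracket_extend u v y hy, sub_eq_zero] at h
  exact h

theorem leviCivita_congr {x : M} {X Y : Π y : M, TangentSpace 𝓘(ℝ, E) y}
    (hX : MDiffAt (T% X) x) (hY : MDiffAt (T% Y) x) (h : ∀ᶠ y in 𝓝 x, X y = Y y) :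
    leviCivita 𝓘(ℝ, E) M X x = leviCivita 𝓘(ℝ, E) M Y x :=
  (leviCivita 𝓘(ℝ, E) M).isCovariantDerivativeOn.congr_of_eventuallyEq hX hY Filter.univ_mem h

/-- The bracket term drops out because the two extensions commute. -/
theorem curvature_eq {x : M} (u v w : TangentSpace 𝓘(ℝ, E) x) :
    curvature 𝓘(ℝ, E) M x u v w = leviCivita 𝓘(ℝ, E) M (nablaExtend u (extend E w)) x v
      - leviCivita 𝓘(ℝ, E) M (nablaExtend v (extend E w)) x u := by
  have h := mlieBracket_extend u v x (mem_chart_source E x)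
  simp only [curvature, h, map_zero, zero_sub, neg_sub]
  rfl

theorem curvature_swap {x : M} (u v w : TangentSpace 𝓘(ℝ, E) x) :
    curvature 𝓘(ℝ, E) M x u v w = -curvature 𝓘(ℝ, E) M x v u w := by
  rw [curvature_eq, curvature_eq, neg_sub]

/-- Expanded, the sum has six second derivatives, which cancel in pairs since `∇_U V = ∇_V U` near
`x`. -/
theorem curvature_bianchi {x : M} (u v w : TangentSpace 𝓘(ℝ, E) x) :
    curvature 𝓘(ℝ, E) M x u v w + curvature 𝓘(ℝ, E) M x v w u
      + curvature 𝓘(ℝ, E) M x w u v = 0 := by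
  have key (a b : TangentSpace 𝓘(ℝ, E) x) :
      leviCivita 𝓘(ℝ, E) M (nablaExtend a (extend E b)) x =
        leviCivita 𝓘(ℝ, E) M (nablaExtend b (extend E a)) x :=
    leviCivita_congr ((SmoothNear.extend b).nablaExtend a).mdifferentiableAt
      ((SmoothNear.extend a).nablaExtend b).mdifferentiableAt (nablaExtend_extend_comm a b)
  rw [curvature_eq, curvature_eq, curvature_eq, key u w, key v u, key w v]
  abel

theorem mvfderiv_add_three {f g h : M → ℝ} {x : M} (hf : MDiffAt f x) (hg : MDiffAt g x)
    (hh : MDiffAt h x) (u : TangentSpace 𝓘(ℝ, E) x) :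
    d% (fun y ↦ f y + g y + h y) x u = d% f x u + d% g x u + d% h x u := by
  have h1 := mvfderiv_fun_add (hf.add hg) hh
  have h2 := mvfderiv_fun_add hf hg
  have h3 := DFunLike.congr_fun h1 u
  have h4 := DFunLike.congr_fun h2 u
  simp only [Pi.add_apply, add_apply] at h3 h4 ⊢
  rw [h3, ← h4]
  rfl

theorem mvfderiv_add_four {f g h k : M → ℝ} {x : M} (hf : MDiffAt f x) (hg : MDiffAt g x)
    (hh : MDiffAt h x) (hk : MDiffAt k x) (u : TangentSpace 𝓘(ℝ, E) x) :
    d% (fun y ↦ f y + g y + h y + k y) x u = d% f x u + d% g x u + d% h x u + d% k x u := by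
  have h1 := mvfderiv_fun_add ((hf.add hg).add hh) hk
  rw [← mvfderiv_add_three hf hg hh]
  exact DFunLike.congr_fun h1 u

/-- The Ricci identity for a field of bilinear forms `φ`, where `χ` is the covariant derivative
of `φ` and `θ` is the covariant derivative of `χ`. -/
theorem ricci_identity_two {φ : Π y : M, TangentSpace 𝓘(ℝ, E) y → TangentSpace 𝓘(ℝ, E) y → ℝ}
    {χ : Π y : M, TangentSpace 𝓘(ℝ, E) y → TangentSpace 𝓘(ℝ, E) y → TangentSpace 𝓘(ℝ, E) y → ℝ}
    {θ : Π y : M, TangentSpace 𝓘(ℝ, E) y → TangentSpace 𝓘(ℝ, E) y → TangentSpace 𝓘(ℝ, E) y →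
      TangentSpace 𝓘(ℝ, E) y → ℝ}
    (φs : ∀ (y : M) (A B : Π y : M, TangentSpace 𝓘(ℝ, E) y), CMDiffAt ∞ (T% A) y →
      CMDiffAt ∞ (T% B) y → CMDiffAt ∞ (fun z ↦ φ z (A z) (B z)) y)
    (χs : ∀ (y : M) (A B C : Π y : M, TangentSpace 𝓘(ℝ, E) y), CMDiffAt ∞ (T% A) y →
      CMDiffAt ∞ (T% B) y → CMDiffAt ∞ (T% C) y → MDiffAt (fun z ↦ χ z (A z) (B z) (C z)) y)
    (hφ : ∀ (y : M) (A B : Π y : M, TangentSpace 𝓘(ℝ, E) y), CMDiffAt ∞ (T% A) y →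
      CMDiffAt ∞ (T% B) y → ∀ u, d% (fun z ↦ φ z (A z) (B z)) y u =
        φ y (leviCivita 𝓘(ℝ, E) M A y u) (B y) + φ y (A y) (leviCivita 𝓘(ℝ, E) M B y u)
        + χ y u (A y) (B y))
    (hχ : ∀ (y : M) (A B C : Π y : M, TangentSpace 𝓘(ℝ, E) y), CMDiffAt ∞ (T% A) y →
      CMDiffAt ∞ (T% B) y → CMDiffAt ∞ (T% C) y → ∀ u, d% (fun z ↦ χ z (A z) (B z) (C z)) y u =
        χ y (leviCivita 𝓘(ℝ, E) M A y u) (B y) (C y) + χ y (A y) (leviCivita 𝓘(ℝ, E) M B y u) (C y)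
        + χ y (A y) (B y) (leviCivita 𝓘(ℝ, E) M C y u) + θ y u (A y) (B y) (C y))
    (φ_sub_left : ∀ (y : M) (a b c : TangentSpace 𝓘(ℝ, E) y), φ y (a - b) c = φ y a c - φ y b c)
    (φ_sub_right : ∀ (y : M) (a b c : TangentSpace 𝓘(ℝ, E) y), φ y c (a - b) = φ y c a - φ y c b)
    {x : M} (u v a b : TangentSpace 𝓘(ℝ, E) x) :
    φ x (curvature 𝓘(ℝ, E) M x u v a) b + φ x a (curvature 𝓘(ℝ, E) M x u v b) =
      θ x u v a b - θ x v u a b := by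
  have ha := SmoothNear.extend a
  have hb := SmoothNear.extend b
  -- All terms of this expansion that contain only first derivatives of the fields are symmetric in
  -- `u` and `v`, the one with `∇_U V` by vanishing torsion. Comparing with `u` and `v` exchanged
  -- leaves only the curvature terms and `θ`.
  have second (u v : TangentSpace 𝓘(ℝ, E) x) :
      d% (fun y ↦ d% (fun z ↦ φ z ((extend E a : Π y : M, TangentSpace 𝓘(ℝ, E) y) z)
        ((extend E b : Π y : M, TangentSpace 𝓘(ℝ, E) y) z)) y
          ((extend E v : Π y : M, TangentSpace 𝓘(ℝ, E) y) y)) x u =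
      φ x (leviCivita 𝓘(ℝ, E) M (nablaExtend v (extend E a)) x u) b
      + φ x (nablaExtend v (extend E a) x) (nablaExtend u (extend E b) x)
      + χ x u (nablaExtend v (extend E a) x) b
      + (φ x (nablaExtend u (extend E a) x) (nablaExtend v (extend E b) x)
      + φ x a (leviCivita 𝓘(ℝ, E) M (nablaExtend v (extend E b)) x u)
      + χ x u a (nablaExtend v (extend E b) x))
      + (χ x (nablaExtend u (extend E v) x) a b + χ x v (nablaExtend u (extend E a) x) b
      + χ x v a (nablaExtend u (extend E b) x) + θ x u v a b) := by
    have hv := SmoothNear.extend v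
    have hva := ha.nablaExtend v
    have hvb := hb.nablaExtend v
    have ev : (fun y ↦ d% (fun z ↦ φ z ((extend E a : Π y : M, TangentSpace 𝓘(ℝ, E) y) z)
        ((extend E b : Π y : M, TangentSpace 𝓘(ℝ, E) y) z)) y
          ((extend E v : Π y : M, TangentSpace 𝓘(ℝ, E) y) y)) =ᶠ[𝓝 x]
        fun y ↦ φ y (nablaExtend v (extend E a) y) (extend E b y)
          + φ y (extend E a y) (nablaExtend v (extend E b) y)
          + χ y (extend E v y) (extend E a y) (extend E b y) := by
      filter_upwards [ha, hb] with y ha hb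
      exact hφ y _ _ ha hb _
    have d1 := (φs x _ _ hva.contMDiffAt hb.contMDiffAt).mdifferentiableAt (by simp)
    have d2 := (φs x _ _ ha.contMDiffAt hvb.contMDiffAt).mdifferentiableAt (by simp)
    have d3 := χs x _ _ _ hv.contMDiffAt ha.contMDiffAt hb.contMDiffAt
    rw [mvfderiv_congr ev, mvfderiv_add_three d1 d2 d3, hφ x _ _ hva.contMDiffAt hb.contMDiffAt, hφ x _ _ ha.contMDiffAt hvb.contMDiffAt,
      hχ x _ _ _ hv.contMDiffAt ha.contMDiffAt hb.contMDiffAt]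
    simp only [extend_apply_self, nablaExtend_apply_self]
  have hsymm := mvfderiv_extend_comm (x := x)
    (f := fun z ↦ φ z ((extend E a : Π y : M, TangentSpace 𝓘(ℝ, E) y) z)
        ((extend E b : Π y : M, TangentSpace 𝓘(ℝ, E) y) z)) (by
      filter_upwards [ha, hb] with y ha hb using φs y _ _ ha hb) u v
  rw [second, second, (nablaExtend_extend_comm u v).self_of_nhds] at hsymm
  rw [curvature_eq, curvature_eq, φ_sub_left, φ_sub_right]
  linarith

/-- The Ricci identity for a field of trilinear forms `χ`, where `θ` is the covariant derivative
of `χ` and `κ` is the covariant derivative of `θ`. -/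
theorem ricci_identity_three
    {χ : Π y : M, TangentSpace 𝓘(ℝ, E) y → TangentSpace 𝓘(ℝ, E) y → TangentSpace 𝓘(ℝ, E) y → ℝ}
    {θ : Π y : M, TangentSpace 𝓘(ℝ, E) y → TangentSpace 𝓘(ℝ, E) y → TangentSpace 𝓘(ℝ, E) y →
      TangentSpace 𝓘(ℝ, E) y → ℝ}
    {κ : Π y : M, TangentSpace 𝓘(ℝ, E) y → TangentSpace 𝓘(ℝ, E) y → TangentSpace 𝓘(ℝ, E) y →
      TangentSpace 𝓘(ℝ, E) y → TangentSpace 𝓘(ℝ, E) y → ℝ}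
    (χs : ∀ (y : M) (A B C : Π y : M, TangentSpace 𝓘(ℝ, E) y), CMDiffAt ∞ (T% A) y →
      CMDiffAt ∞ (T% B) y → CMDiffAt ∞ (T% C) y → CMDiffAt ∞ (fun z ↦ χ z (A z) (B z) (C z)) y)
    (θs : ∀ (y : M) (A B C D : Π y : M, TangentSpace 𝓘(ℝ, E) y), CMDiffAt ∞ (T% A) y →
      CMDiffAt ∞ (T% B) y → CMDiffAt ∞ (T% C) y → CMDiffAt ∞ (T% D) y →
      MDiffAt (fun z ↦ θ z (A z) (B z) (C z) (D z)) y)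
    (hχ : ∀ (y : M) (A B C : Π y : M, TangentSpace 𝓘(ℝ, E) y), CMDiffAt ∞ (T% A) y →
      CMDiffAt ∞ (T% B) y → CMDiffAt ∞ (T% C) y → ∀ u, d% (fun z ↦ χ z (A z) (B z) (C z)) y u =
        χ y (leviCivita 𝓘(ℝ, E) M A y u) (B y) (C y) + χ y (A y) (leviCivita 𝓘(ℝ, E) M B y u) (C y)
        + χ y (A y) (B y) (leviCivita 𝓘(ℝ, E) M C y u) + θ y u (A y) (B y) (C y))
    (hθ : ∀ (y : M) (A B C D : Π y : M, TangentSpace 𝓘(ℝ, E) y), CMDiffAt ∞ (T% A) y →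
      CMDiffAt ∞ (T% B) y → CMDiffAt ∞ (T% C) y → CMDiffAt ∞ (T% D) y →
      ∀ u, d% (fun z ↦ θ z (A z) (B z) (C z) (D z)) y u =
        θ y (leviCivita 𝓘(ℝ, E) M A y u) (B y) (C y) (D y)
        + θ y (A y) (leviCivita 𝓘(ℝ, E) M B y u) (C y) (D y)
        + θ y (A y) (B y) (leviCivita 𝓘(ℝ, E) M C y u) (D y)
        + θ y (A y) (B y) (C y) (leviCivita 𝓘(ℝ, E) M D y u) + κ y u (A y) (B y) (C y) (D y))
    (χ_sub₁ : ∀ (y : M) (a a' b c : TangentSpace 𝓘(ℝ, E) y),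
      χ y (a - a') b c = χ y a b c - χ y a' b c)
    (χ_sub₂ : ∀ (y : M) (a b b' c : TangentSpace 𝓘(ℝ, E) y),
      χ y a (b - b') c = χ y a b c - χ y a b' c)
    (χ_sub₃ : ∀ (y : M) (a b c c' : TangentSpace 𝓘(ℝ, E) y),
      χ y a b (c - c') = χ y a b c - χ y a b c')
    {x : M} (u v a b c : TangentSpace 𝓘(ℝ, E) x) :
    χ x (curvature 𝓘(ℝ, E) M x u v a) b c + χ x a (curvature 𝓘(ℝ, E) M x u v b) c
      + χ x a b (curvature 𝓘(ℝ, E) M x u v c) = κ x u v a b c - κ x v u a b c := by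
  have ha := SmoothNear.extend a
  have hb := SmoothNear.extend b
  have hc := SmoothNear.extend c
  -- As in the bilinear case, only the second derivatives of the fields and `κ` survive
  -- antisymmetrisation in `u` and `v`.
  have second (u v : TangentSpace 𝓘(ℝ, E) x) :
      d% (fun y ↦ d% (fun z ↦ χ z ((extend E a : Π y : M, TangentSpace 𝓘(ℝ, E) y) z)
        ((extend E b : Π y : M, TangentSpace 𝓘(ℝ, E) y) z)
        ((extend E c : Π y : M, TangentSpace 𝓘(ℝ, E) y) z)) y
          ((extend E v : Π y : M, TangentSpace 𝓘(ℝ, E) y) y)) x u =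
      χ x (leviCivita 𝓘(ℝ, E) M (nablaExtend v (extend E a)) x u) b c
      + χ x (nablaExtend v (extend E a) x) (nablaExtend u (extend E b) x) c
      + χ x (nablaExtend v (extend E a) x) b (nablaExtend u (extend E c) x)
      + θ x u (nablaExtend v (extend E a) x) b c
      + (χ x (nablaExtend u (extend E a) x) (nablaExtend v (extend E b) x) c
      + χ x a (leviCivita 𝓘(ℝ, E) M (nablaExtend v (extend E b)) x u) c
      + χ x a (nablaExtend v (extend E b) x) (nablaExtend u (extend E c) x)
      + θ x u a (nablaExtend v (extend E b) x) c)
      + (χ x (nablaExtend u (extend E a) x) b (nablaExtend v (extend E c) x)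
      + χ x a (nablaExtend u (extend E b) x) (nablaExtend v (extend E c) x)
      + χ x a b (leviCivita 𝓘(ℝ, E) M (nablaExtend v (extend E c)) x u)
      + θ x u a b (nablaExtend v (extend E c) x))
      + (θ x (nablaExtend u (extend E v) x) a b c + θ x v (nablaExtend u (extend E a) x) b c
      + θ x v a (nablaExtend u (extend E b) x) c + θ x v a b (nablaExtend u (extend E c) x)
      + κ x u v a b c) := by
    have hv := SmoothNear.extend v
    have hva := ha.nablaExtend v
    have hvb := hb.nablaExtend v
    have hvc := hc.nablaExtend v
    have ev : (fun y ↦ d% (fun z ↦ χ z ((extend E a : Π y : M, TangentSpace 𝓘(ℝ, E) y) z)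
        ((extend E b : Π y : M, TangentSpace 𝓘(ℝ, E) y) z)
        ((extend E c : Π y : M, TangentSpace 𝓘(ℝ, E) y) z)) y
          ((extend E v : Π y : M, TangentSpace 𝓘(ℝ, E) y) y)) =ᶠ[𝓝 x]
        fun y ↦ χ y (nablaExtend v (extend E a) y) (extend E b y) (extend E c y)
          + χ y (extend E a y) (nablaExtend v (extend E b) y) (extend E c y)
          + χ y (extend E a y) (extend E b y) (nablaExtend v (extend E c) y)
          + θ y (extend E v y) (extend E a y) (extend E b y) (extend E c y) := by
      filter_upwards [ha, hb, hc] with y ha hb hc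
      exact hχ y _ _ _ ha hb hc _
    have d1 := (χs x _ _ _ hva.contMDiffAt hb.contMDiffAt hc.contMDiffAt).mdifferentiableAt
      (by simp)
    have d2 := (χs x _ _ _ ha.contMDiffAt hvb.contMDiffAt hc.contMDiffAt).mdifferentiableAt
      (by simp)
    have d3 := (χs x _ _ _ ha.contMDiffAt hb.contMDiffAt hvc.contMDiffAt).mdifferentiableAt
      (by simp)
    have d4 := θs x _ _ _ _ hv.contMDiffAt ha.contMDiffAt hb.contMDiffAt hc.contMDiffAt
    rw [mvfderiv_congr ev, mvfderiv_add_four d1 d2 d3 d4,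
      hχ x _ _ _ hva.contMDiffAt hb.contMDiffAt hc.contMDiffAt,
      hχ x _ _ _ ha.contMDiffAt hvb.contMDiffAt hc.contMDiffAt,
      hχ x _ _ _ ha.contMDiffAt hb.contMDiffAt hvc.contMDiffAt,
      hθ x _ _ _ _ hv.contMDiffAt ha.contMDiffAt hb.contMDiffAt hc.contMDiffAt]
    simp only [extend_apply_self, nablaExtend_apply_self]
  have hsymm := mvfderiv_extend_comm (x := x)
    (f := fun z ↦ χ z ((extend E a : Π y : M, TangentSpace 𝓘(ℝ, E) y) z)
        ((extend E b : Π y : M, TangentSpace 𝓘(ℝ, E) y) z)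
        ((extend E c : Π y : M, TangentSpace 𝓘(ℝ, E) y) z)) (by
      filter_upwards [ha, hb, hc] with y ha hb hc using χs y _ _ _ ha hb hc) u v
  rw [second, second, (nablaExtend_extend_comm u v).self_of_nhds] at hsymm
  rw [curvature_eq, curvature_eq, curvature_eq, χ_sub₁, χ_sub₂, χ_sub₃]
  linarith

/-- The Levi-Civita connection is metric, in a form with a tangent vector. -/
theorem mvfderiv_inner {x : M} {Y Z : Π x : M, TangentSpace 𝓘(ℝ, E) x}
    (hY : MDiffAt (T% Y) x) (hZ : MDiffAt (T% Z) x) (u : TangentSpace 𝓘(ℝ, E) x) :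
    d% (fun y ↦ ⟪Y y, Z y⟫) x u =
      ⟪leviCivita 𝓘(ℝ, E) M Y x u, Z x⟫ + ⟪Y x, leviCivita 𝓘(ℝ, E) M Z x u⟫ := by
  have := leviCivita_metric (mdifferentiableAt_extend 𝓘(ℝ, E) E u) hY hZ
  simpa only [extend_apply_self] using this

/-- The Ricci identity for the metric, which is parallel, so that `χ` and `θ` are zero. -/
theorem inner_curvature_skew {x : M} (u v a b : TangentSpace 𝓘(ℝ, E) x) :
    ⟪curvature 𝓘(ℝ, E) M x u v a, b⟫ = -⟪curvature 𝓘(ℝ, E) M x u v b, a⟫ := by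
  have := ricci_identity_two (E := E) (M := M) (φ := fun y a b ↦ ⟪a, b⟫) (χ := fun _ _ _ _ ↦ 0)
    (θ := fun _ _ _ _ _ ↦ 0) (fun y A B hA hB ↦ contMDiffAt_inner hA hB)
    (fun y A B C _ _ _ ↦ mdifferentiableAt_const)
    (fun y A B hA hB u ↦ by
      rw [mvfderiv_inner (hA.mdifferentiableAt (by simp)) (hB.mdifferentiableAt (by simp)), add_zero])
    (fun y A B C _ _ _ u ↦ by simp [mvfderiv_const]) (fun y a b c ↦ inner_sub_left _ _ _)
    (fun y a b c ↦ inner_sub_right _ _ _) u v a b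
  rw [real_inner_comm a (curvature 𝓘(ℝ, E) M x u v b)]
  linarith

end RicciIdentity

/-! ### Special unitary coordinates on a Hermitian vector space of real dimension six. -/

noncomputable section HermitianAlgebra

local notation "⟪" u ", " v "⟫" => inner ℝ u v

variable {V : Type*} [NormedAddCommGroup V] [InnerProductSpace ℝ V]

theorem exists_unit_orthogonal [FiniteDimensional ℝ V] {n : ℕ} (hn : n < Module.finrank ℝ V) (f : Fin n → V) :
    ∃ e : V, ⟪e, e⟫ = 1 ∧ ∀ i, ⟪f i, e⟫ = 0 := by
  have hlt : Module.finrank ℝ (Submodule.span ℝ (Set.range f)) < Module.finrank ℝ V :=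
    lt_of_le_of_lt ((finrank_range_le_card (R := ℝ) f).trans (by simp)) hn
  have hpos : 0 < Module.finrank ℝ (Submodule.span ℝ (Set.range f))ᗮ := by
    have := (Submodule.span ℝ (Set.range f)).finrank_add_finrank_orthogonal
    omega
  have : Nontrivial (Submodule.span ℝ (Set.range f))ᗮ := Module.finrank_pos_iff.1 hpos
  obtain ⟨⟨w, hw⟩, hw0⟩ := exists_ne (0 : (Submodule.span ℝ (Set.range f))ᗮ)
  have hw0 : w ≠ 0 := fun h ↦ hw0 (by simpa using h)
  refine ⟨‖w‖⁻¹ • w, ?_, fun i ↦ ?_⟩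
  · rw [real_inner_self_eq_norm_sq, norm_smul, norm_inv, norm_norm,
      inv_mul_cancel₀ (norm_ne_zero_iff.2 hw0), one_pow]
  · rw [inner_smul_right, (Submodule.mem_orthogonal _ _).1 hw _
      (Submodule.subset_span (Set.mem_range_self i)), mul_zero]

/-- `J` is an orthogonal complex structure on `V`. -/
structure IsHermitian (J : V →ₗ[ℝ] V) : Prop where
  J_J : ∀ u, J (J u) = -u
  inner_J_J : ∀ u v, ⟪J u, J v⟫ = ⟪u, v⟫

/-- `e` is a unitary frame of the Hermitian vector space `(V, J)`. -/
structure IsUnitaryFrame (J : V →ₗ[ℝ] V) (e : Fin 3 → V) : Prop where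
  inner_eq : ∀ i j, ⟪e i, e j⟫ = if i = j then 1 else 0
  inner_J_eq : ∀ i j, ⟪e i, J (e j)⟫ = 0

namespace IsHermitian

variable {J : V →ₗ[ℝ] V}

theorem inner_J_left (hJ : IsHermitian J) (u v : V) : ⟪J u, v⟫ = -⟪u, J v⟫ := by
  rw [← hJ.inner_J_J u (J v), hJ.J_J, inner_neg_right, neg_neg]

theorem inner_J_self (hJ : IsHermitian J) (u : V) : ⟪u, J u⟫ = 0 := by
  have := hJ.inner_J_left u u
  rw [real_inner_comm] at this
  linarith

/-- Complex Gram–Schmidt: each new unit vector is orthogonal to the earlier ones and to their images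
under `J`, that is to 0, 2 and then 4 vectors in dimension six. -/
theorem exists_isUnitaryFrame [FiniteDimensional ℝ V] (hJ : IsHermitian J) (hV : Module.finrank ℝ V = 6) : ∃ e, IsUnitaryFrame J e := by
  obtain ⟨a, ha, -⟩ := exists_unit_orthogonal (V := V) (n := 0) (by omega) ![]
  obtain ⟨b, hb, hb'⟩ := exists_unit_orthogonal (V := V) (n := 2) (by omega) ![a, J a]
  obtain ⟨c, hc, hc'⟩ := exists_unit_orthogonal (V := V) (n := 4) (by omega) ![a, J a, b, J b]
  have hab := hb' 0
  have hJab := hb' 1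
  have hac := hc' 0
  have hJac := hc' 1
  have hbc := hc' 2
  have hJbc := hc' 3
  simp only [Matrix.cons_val] at hab hJab hac hJac hbc hJbc
  have hJab' := hJ.inner_J_left a b
  have hJac' := hJ.inner_J_left a c
  have hJbc' := hJ.inner_J_left b c
  have h1 : ⟪b, J a⟫ = 0 := by rw [real_inner_comm]; exact hJab
  have h2 : ⟪c, J a⟫ = 0 := by rw [real_inner_comm]; exact hJac
  have h3 : ⟪c, J b⟫ = 0 := by rw [real_inner_comm]; exact hJbc
  have h4 : ⟪b, a⟫ = 0 := by rw [real_inner_comm]; exact hab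
  have h5 : ⟪c, a⟫ = 0 := by rw [real_inner_comm]; exact hac
  have h6 : ⟪c, b⟫ = 0 := by rw [real_inner_comm]; exact hbc
  have h7 : ⟪a, J b⟫ = 0 := by linarith
  have h8 : ⟪a, J c⟫ = 0 := by linarith
  have h9 : ⟪b, J c⟫ = 0 := by linarith
  refine ⟨![a, b, c], ⟨fun i j ↦ ?_, fun i j ↦ ?_⟩⟩
  · fin_cases i <;> fin_cases j <;> simp only [Fin.zero_eta, Fin.mk_one, Fin.reduceFinMk,
      Matrix.cons_val, ha, hb, hc, hab, hac, hbc, h4, h5, h6] <;> simp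
  · fin_cases i <;> fin_cases j <;> simp only [Fin.zero_eta, Fin.mk_one, Fin.reduceFinMk,
      Matrix.cons_val, hJ.inner_J_self, h1, h2, h3, h7, h8, h9]

end IsHermitian

/-- The determinant of three vectors of `ℂ³`. -/
def det₃ (x y z : Fin 3 → ℂ) : ℂ :=
  x 0 * (y 1 * z 2 - y 2 * z 1) - x 1 * (y 0 * z 2 - y 2 * z 0) + x 2 * (y 0 * z 1 - y 1 * z 0)

/-- Linear coordinates on a Hermitian vector space in which the Hermitian structure is that of
`ℂ³`. -/
structure IsUnitaryCoord (J : V →ₗ[ℝ] V) (c : V ≃ₗ[ℝ] (Fin 3 → ℂ)) : Prop where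
  map_J : ∀ u k, c (J u) k = Complex.I * c u k
  inner_eq : ∀ u v, ⟪u, v⟫ = ∑ k, ((c u k).re * (c v k).re + (c u k).im * (c v k).im)

/-- The coordinates are `⟨e_k, u⟩ + i⟨Je_k, u⟩`. The vectors `e_k`, `Je_k` form an orthonormal
basis, so Parseval gives the inner product and hence injectivity. -/
theorem IsUnitaryFrame.exists_coord [FiniteDimensional ℝ V] {J : V →ₗ[ℝ] V} (hJ : IsHermitian J)
    (hV : Module.finrank ℝ V = 6) {e : Fin 3 → V} (he : IsUnitaryFrame J e) :
    ∃ c : V ≃ₗ[ℝ] (Fin 3 → ℂ), IsUnitaryCoord J c ∧ ∀ k, c (e k) = Pi.single k 1 := by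
  let b₀ : Fin 3 ⊕ Fin 3 → V := Sum.elim e (fun k ↦ J (e k))
  have horth : Orthonormal ℝ b₀ := by
    rw [orthonormal_iff_ite]
    rintro (i | i) (j | j)
    · simp [b₀, he.inner_eq]
    · simp [b₀, he.inner_J_eq]
    · simp [b₀, hJ.inner_J_left, he.inner_J_eq]
    · simp [b₀, hJ.inner_J_J, he.inner_eq]
  have hcard : Fintype.card (Fin 3 ⊕ Fin 3) = Module.finrank ℝ V := by simp [hV]
  let b : OrthonormalBasis (Fin 3 ⊕ Fin 3) ℝ V :=
    OrthonormalBasis.mk horth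
      (horth.linearIndependent.span_eq_top_of_card_eq_finrank hcard).ge
  have hb1 (k) : b (Sum.inl k) = e k := by simp [b, b₀]
  have hb2 (k) : b (Sum.inr k) = J (e k) := by simp [b, b₀]
  let c₀ : V →ₗ[ℝ] (Fin 3 → ℂ) :=
    { toFun v k := ⟨⟪e k, v⟫, ⟪J (e k), v⟫⟩
      map_add' u v := by ext k; apply Complex.ext <;> simp [inner_add_right]
      map_smul' r v := by ext k; apply Complex.ext <;> simp [inner_smul_right] }
  have hin (u v : V) : ⟪u, v⟫ = ∑ k, ((c₀ u k).re * (c₀ v k).re + (c₀ u k).im * (c₀ v k).im) := by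
    rw [← b.sum_inner_mul_inner u v, Fintype.sum_sum_type, Finset.sum_add_distrib]
    simp only [hb1, hb2]
    congr 1 <;> refine Finset.sum_congr rfl fun k _ ↦ ?_
    · rw [real_inner_comm]; rfl
    · rw [real_inner_comm]; rfl
  have hinj : Function.Injective c₀ := by
    rw [← LinearMap.ker_eq_bot, LinearMap.ker_eq_bot']
    intro u hu
    have := hin u u
    rw [hu] at this
    simpa using this
  refine ⟨LinearEquiv.ofInjectiveOfFinrankEq c₀ hinj
    (by simp [hV, Module.finrank_pi_fintype, Complex.finrank_real_complex]), ⟨fun u k ↦ ?_, ?_⟩, fun k ↦ ?_⟩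
  · change c₀ (J u) k = Complex.I * c₀ u k
    apply Complex.ext
    · simp [c₀, hJ.inner_J_left]
    · simp [c₀, hJ.inner_J_J]
  · exact hin
  · change c₀ (e k) = _
    ext l
    have : c₀ (e k) l = ⟨⟪e l, e k⟫, ⟪J (e l), e k⟫⟩ := rfl
    rw [this, he.inner_eq, hJ.inner_J_left, he.inner_J_eq]
    by_cases h : l = k
    · subst h
      apply Complex.ext <;> simp
    · apply Complex.ext <;> simp [h]

/-- A complex trilinear alternating form on a Hermitian vector space. -/
structure IsComplexVolume (J : V →ₗ[ℝ] V) (A : V → V → V → ℂ) : Prop where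
  add : ∀ u u' v w, A (u + u') v w = A u v w + A u' v w
  smul : ∀ (r : ℝ) u v w, A (r • u) v w = r * A u v w
  map_J : ∀ u v w, A (J u) v w = Complex.I * A u v w
  swap₁₂ : ∀ u v w, A u v w = -A v u w
  swap₂₃ : ∀ u v w, A u v w = -A u w v

theorem IsUnitaryCoord.eq_sum {J : V →ₗ[ℝ] V} {c : V ≃ₗ[ℝ] (Fin 3 → ℂ)} (hc : IsUnitaryCoord J c)
    (u : V) : u = ∑ k, ((c u k).re • c.symm (Pi.single k 1) + (c u k).im • J (c.symm (Pi.single k 1))) := by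
  apply c.injective
  ext l
  have h (l k : Fin 3) : c (J (c.symm (Pi.single k 1))) l = Complex.I * Pi.single (M := fun _ ↦ ℂ) k 1 l := by
    rw [hc.map_J, LinearEquiv.apply_symm_apply]
  fin_cases l <;> simp [Fin.sum_univ_three, h, mul_comm Complex.I, Complex.re_add_im]

/-- A complex volume form is a multiple of the determinant. -/
theorem IsComplexVolume.eq_det {J : V →ₗ[ℝ] V} {c : V ≃ₗ[ℝ] (Fin 3 → ℂ)} (hc : IsUnitaryCoord J c)
    {A : V → V → V → ℂ} (hA : IsComplexVolume J A) (u v w : V) :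
    A u v w = A (c.symm (Pi.single 0 1)) (c.symm (Pi.single 1 1)) (c.symm (Pi.single 2 1))
      * det₃ (c u) (c v) (c w) := by
  set e : Fin 3 → V := fun k ↦ c.symm (Pi.single k 1)
  -- Complex linearity in the first slot; skew symmetry carries it to the other two.
  have h1 (u v w : V) : A u v w = c u 0 * A (e 0) v w + c u 1 * A (e 1) v w + c u 2 * A (e 2) v w := by
    conv_lhs => rw [hc.eq_sum u]
    simp only [Fin.sum_univ_three, hA.add, hA.smul, hA.map_J]
    conv_rhs => rw [← Complex.re_add_im (c u 0), ← Complex.re_add_im (c u 1), ← Complex.re_add_im (c u 2)]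
    ring
  have h2 (u v w : V) : A u v w = c v 0 * A u (e 0) w + c v 1 * A u (e 1) w + c v 2 * A u (e 2) w := by
    rw [hA.swap₁₂, h1, hA.swap₁₂ u (e 0), hA.swap₁₂ u (e 1), hA.swap₁₂ u (e 2)]
    ring
  have h3 (u v w : V) : A u v w = c w 0 * A u v (e 0) + c w 1 * A u v (e 1) + c w 2 * A u v (e 2) := by
    rw [hA.swap₂₃, h2, hA.swap₂₃ u v (e 0), hA.swap₂₃ u v (e 1), hA.swap₂₃ u v (e 2)]
    ring
  have z12 (u w : V) : A u u w = 0 := self_eq_neg.1 (hA.swap₁₂ u u w)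
  have z23 (u w : V) : A u w w = 0 := self_eq_neg.1 (hA.swap₂₃ u w w)
  have z13 (u w : V) : A u w u = 0 := by rw [hA.swap₁₂, z23, neg_zero]
  have a1 : A (e 0) (e 2) (e 1) = -A (e 0) (e 1) (e 2) := hA.swap₂₃ _ _ _
  have a2 : A (e 1) (e 0) (e 2) = -A (e 0) (e 1) (e 2) := hA.swap₁₂ _ _ _
  have a3 : A (e 1) (e 2) (e 0) = A (e 0) (e 1) (e 2) := by rw [hA.swap₂₃, a2, neg_neg]
  have a4 : A (e 2) (e 0) (e 1) = A (e 0) (e 1) (e 2) := by rw [hA.swap₁₂, a1, neg_neg]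
  have a5 : A (e 2) (e 1) (e 0) = -A (e 0) (e 1) (e 2) := by rw [hA.swap₂₃, a4]
  rw [h1 u v w, h2 (e 0) v w, h2 (e 1) v w, h2 (e 2) v w]
  simp only [z12, mul_zero, zero_add, add_zero]
  rw [h3 (e 0) (e 1) w, h3 (e 0) (e 2) w, h3 (e 1) (e 0) w, h3 (e 1) (e 2) w, h3 (e 2) (e 0) w,
    h3 (e 2) (e 1) w]
  simp only [z23, z13, a1, a2, a3, a4, a5, det₃]
  change _ = A (e 0) (e 1) (e 2) * _
  ring

/-- Unitary coordinates in which `Ψ` is the determinant. -/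
structure IsSpecialUnitaryCoord (J : V →ₗ[ℝ] V) (Ψ : V → V → V → ℂ) (c : V ≃ₗ[ℝ] (Fin 3 → ℂ)) : Prop
    extends IsUnitaryCoord J c where
  Ψ_eq : ∀ u v w, Ψ u v w = det₃ (c u) (c v) (c w)

/-- In unitary coordinates `Ψ` is `z` times the determinant with `|z| = 1`. Multiplying one
coordinate by the phase `z` keeps the coordinates unitary and absorbs `z` into the determinant. -/
theorem IsHermitian.exists_isSpecialUnitaryCoord [FiniteDimensional ℝ V]
    {J : V →ₗ[ℝ] V} (hJ : IsHermitian J)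
    (hV : Module.finrank ℝ V = 6) {Ψ : V → V → V → ℂ} (hΨ : IsComplexVolume J Ψ)
    (hnorm : ∀ e, IsUnitaryFrame J e → Complex.normSq (Ψ (e 0) (e 1) (e 2)) = 1) :
    ∃ c : V ≃ₗ[ℝ] (Fin 3 → ℂ), IsSpecialUnitaryCoord J Ψ c := by
  obtain ⟨e, he⟩ := hJ.exists_isUnitaryFrame hV
  obtain ⟨c, hc, hce⟩ := he.exists_coord hJ hV
  have hz := hnorm e he
  have hdet := hΨ.eq_det hc
  simp only [← hce, LinearEquiv.symm_apply_apply] at hdet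
  set z := Ψ (e 0) (e 1) (e 2)
  have hz' : z.re * z.re + z.im * z.im = 1 := by rw [← Complex.normSq_apply]; exact hz
  have hz0 : z ≠ 0 := by rintro h; simp [h] at hz
  let m : (Fin 3 → ℂ) ≃ₗ[ℝ] (Fin 3 → ℂ) :=
    LinearEquiv.piCongrRight fun k ↦ if k = 2 then
      (LinearEquiv.smulOfNeZero ℂ ℂ z hz0).restrictScalars ℝ else LinearEquiv.refl ℝ ℂ
  have m0 (x : Fin 3 → ℂ) : m x 0 = x 0 := by simp [m]
  have m1 (x : Fin 3 → ℂ) : m x 1 = x 1 := by simp [m]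
  have m2 (x : Fin 3 → ℂ) : m x 2 = z * x 2 := by simp [m]
  refine ⟨c.trans m, ⟨⟨fun u k ↦ ?_, fun u v ↦ ?_⟩, fun u v w ↦ ?_⟩⟩
  · fin_cases k <;> simp [m0, m1, m2, hc.map_J]
    ring
  · rw [hc.inner_eq]
    simp only [Fin.sum_univ_three, LinearEquiv.trans_apply, m0, m1, m2, Complex.mul_re, Complex.mul_im]
    linear_combination (-(c u 2).re * (c v 2).re - (c u 2).im * (c v 2).im) * hz'
  · rw [hdet]
    simp only [det₃, LinearEquiv.trans_apply, m0, m1, m2]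
    ring

end HermitianAlgebra

/-! ### Algebra of curvature tensors on a Hermitian vector space: vanishing of `β`, and
Ricci-flatness. -/

noncomputable section AlgebraicCurvature

local notation "⟪" u ", " v "⟫" => inner ℝ u v

variable {V : Type*} [NormedAddCommGroup V] [InnerProductSpace ℝ V]

/-- The symmetries of a curvature tensor. -/
structure IsAlgebraicCurvature (K : V → V → V → V → ℝ) : Prop where
  swap₁₂ : ∀ u v y z, K u v y z = -K v u y z
  swap₃₄ : ∀ u v y z, K u v y z = -K u v z y
  bianchi : ∀ u v y z, K u v y z + K v y u z + K y u v z = 0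
  add₄ : ∀ u v y z z', K u v y (z + z') = K u v y z + K u v y z'
  smul₄ : ∀ u v y (r : ℝ) z, K u v y (r • z) = r * K u v y z

namespace IsAlgebraicCurvature

variable {K : V → V → V → V → ℝ}

/-- The classical combination of four Bianchi identities. -/
theorem pair (hK : IsAlgebraicCurvature K) (u v y z : V) : K u v y z = K y z u v := by
  have b1 := hK.bianchi u v y z
  have b2 := hK.bianchi v y z u
  have b3 := hK.bianchi y z u v
  have b4 := hK.bianchi z u v y
  have := hK.swap₃₄ v y z u
  have := hK.swap₃₄ y z v u
  have := hK.swap₁₂ z v y u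
  have := hK.swap₁₂ z u y v
  have := hK.swap₃₄ u z y v
  have := hK.swap₁₂ u y z v
  have := hK.swap₃₄ y u z v
  have := hK.swap₁₂ z u v y
  have := hK.swap₃₄ u v z y
  have := hK.swap₃₄ v z u y
  linarith

theorem bianchi_last (hK : IsAlgebraicCurvature K) (u v y z : V) :
    K u v y z + K u y z v + K u z v y = 0 := by
  rw [hK.pair u v, hK.pair u y, hK.pair u z, hK.swap₃₄ y z, hK.swap₃₄ z v, hK.swap₃₄ v y]
  linarith [hK.bianchi y z v u]

theorem neg₄ (hK : IsAlgebraicCurvature K) (u v y z : V) : K u v y (-z) = -K u v y z := by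
  rw [← neg_one_smul ℝ z, hK.smul₄, neg_one_mul]

theorem add₃ (hK : IsAlgebraicCurvature K) (u v y y' z : V) :
    K u v (y + y') z = K u v y z + K u v y' z := by
  rw [hK.swap₃₄, hK.add₄, hK.swap₃₄ u v y, hK.swap₃₄ u v y']
  ring

theorem smul₃ (hK : IsAlgebraicCurvature K) (u v : V) (r : ℝ) (y z : V) :
    K u v (r • y) z = r * K u v y z := by
  rw [hK.swap₃₄, hK.smul₄, hK.swap₃₄ u v y]
  ring

theorem add₂ (hK : IsAlgebraicCurvature K) (u v v' y z : V) :
    K u (v + v') y z = K u v y z + K u v' y z := by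
  rw [hK.pair, hK.add₄, hK.pair u v, hK.pair u v']

theorem smul₂ (hK : IsAlgebraicCurvature K) (u : V) (r : ℝ) (v y z : V) :
    K u (r • v) y z = r * K u v y z := by
  rw [hK.pair, hK.smul₄, hK.pair u v]

end IsAlgebraicCurvature

/-- The curvature tensor of the unit sphere. -/
def sphereCurvature (u v y z : V) : ℝ := ⟪u, y⟫ * ⟪v, z⟫ - ⟪u, z⟫ * ⟪v, y⟫

theorem IsAlgebraicCurvature.sub_sphere {K : V → V → V → V → ℝ} (hK : IsAlgebraicCurvature K)
    (α : ℝ) : IsAlgebraicCurvature fun u v y z ↦ K u v y z - α * sphereCurvature u v y z where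
  swap₁₂ u v y z := by simp only [sphereCurvature]; rw [hK.swap₁₂]; ring
  swap₃₄ u v y z := by simp only [sphereCurvature]; rw [hK.swap₃₄]; ring
  bianchi u v y z := by
    simp only [sphereCurvature]
    rw [real_inner_comm v u, real_inner_comm y u, real_inner_comm y v]
    linear_combination hK.bianchi u v y z
  add₄ u v y z z' := by simp only [sphereCurvature, hK.add₄, inner_add_right]; ring
  smul₄ u v y r z := by simp only [sphereCurvature, hK.smul₄, inner_smul_right]; ring

section Coord

variable {J : V →ₗ[ℝ] V} {Ψ : V → V → V → ℂ} {c : V ≃ₗ[ℝ] (Fin 3 → ℂ)}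

namespace IsSpecialUnitaryCoord

theorem Ψ_J₁ (hc : IsSpecialUnitaryCoord J Ψ c) (u v w : V) :
    Ψ (J u) v w = Complex.I * Ψ u v w := by
  simp only [hc.Ψ_eq, det₃, hc.map_J]; ring

theorem Ψ_J₂ (hc : IsSpecialUnitaryCoord J Ψ c) (u v w : V) :
    Ψ u (J v) w = Complex.I * Ψ u v w := by
  simp only [hc.Ψ_eq, det₃, hc.map_J]; ring

theorem Ψ_J₃ (hc : IsSpecialUnitaryCoord J Ψ c) (u v w : V) :
    Ψ u v (J w) = Complex.I * Ψ u v w := by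
  simp only [hc.Ψ_eq, det₃, hc.map_J]; ring

theorem Ψ_frame (hc : IsSpecialUnitaryCoord J Ψ c) :
    Ψ (c.symm (Pi.single 0 1)) (c.symm (Pi.single 1 1)) (c.symm (Pi.single 2 1)) = 1 := by
  simp [hc.Ψ_eq, det₃]

/-- A complex-valued one-form `β` with
`K(u, v, y, Jz) + K(u, v, Jy, z) = Re(β(u)Ψ(v, y, z) - β(v)Ψ(u, y, z))` for a tensor `K` with the
symmetries of a curvature tensor vanishes. -/
theorem eq_zero_of_curvature (hc : IsSpecialUnitaryCoord J Ψ c) (hJ : IsHermitian J)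
    {K : V → V → V → V → ℝ} (hK : IsAlgebraicCurvature K) {β : V →ₗ[ℝ] ℂ}
    (h : ∀ u v y z, K u v y (J z) + K u v (J y) z = (β u * Ψ v y z - β v * Ψ u y z).re) : β = 0 := by
  -- Twice the complex linear part of `β`; `hγ` is its complex linearity in coordinates.
  set γ : V → ℂ := fun u ↦ β u - Complex.I * β (J u)
  have hγ (u : V) : γ u = c u 0 * γ (c.symm (Pi.single 0 1)) + c u 1 * γ (c.symm (Pi.single 1 1))
      + c u 2 * γ (c.symm (Pi.single 2 1)) := by
    have h1 := congrArg β (hc.eq_sum u)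
    have h2 := congrArg (fun x ↦ β (J x)) (hc.eq_sum u)
    simp only [Fin.sum_univ_three, map_add, map_smul, hJ.J_J, Complex.real_smul, map_neg] at h1 h2
    simp only [γ, h1, h2]
    conv_rhs => rw [← Complex.re_add_im (c u 0), ← Complex.re_add_im (c u 1),
      ← Complex.re_add_im (c u 2)]
    linear_combination ((c u 0).im * β (J (c.symm (Pi.single 0 1)))
      + (c u 1).im * β (J (c.symm (Pi.single 1 1)))
      + (c u 2).im * β (J (c.symm (Pi.single 2 1)))) * Complex.I_mul_I
  -- This is `γ ∧ Ψ = 0`: a (4,0)-form in complex dimension three vanishes.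
  have hdet (u v y z : V) : γ u * Ψ v y z = γ v * Ψ u y z + γ y * Ψ u z v + γ z * Ψ u v y := by
    simp only [hc.Ψ_eq, det₃]
    rw [hγ u, hγ v, hγ y, hγ z]
    ring
  -- By Bianchi, the hypothesis summed cyclically over `(v, y, z)` has left side `-∑ K(u, Jv, y,
  -- z)`. The hypothesis at `(u, Jv, y, Jz)`, summed in the same way, has the same left side, since
  -- `∑ K(u, Jv, Jy, Jz) = 0`. Equating the right sides gives `6β(u)Ψ(v, y, z)` against the cyclic
  -- sum of `γ(v)Ψ(u, y, z)`, which `hdet` collapses.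
  have key (u v y z : V) : (6 * β u * Ψ v y z).re = (γ u * Ψ v y z).re := by
    have b1 := hK.bianchi_last u v y (J z)
    have b2 := hK.bianchi_last u v (J y) z
    have b3 := hK.bianchi_last u (J v) y z
    have b4 := hK.bianchi_last u (J v) (J y) (J z)
    have s1 := h u v y z
    have s2 := h u y z v
    have s3 := h u z v y
    have t1 := h u (J v) y (J z)
    have t2 := h u (J y) z (J v)
    have t3 := h u (J z) v (J y)
    rw [hJ.J_J, hK.neg₄] at t1 t2 t3
    rw [hc.Ψ_J₁, hc.Ψ_J₃, hc.Ψ_J₃] at t1 t2 t3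
    have e1 : Ψ y z v = Ψ v y z := by simp only [hc.Ψ_eq, det₃]; ring
    have e2 : Ψ z v y = Ψ v y z := by simp only [hc.Ψ_eq, det₃]; ring
    rw [e1] at s2 t2
    rw [e2] at s3 t3
    have tot : ((β u * Ψ v y z - β v * Ψ u y z) + (β u * Ψ v y z - β y * Ψ u z v)
        + (β u * Ψ v y z - β z * Ψ u v y)).re =
        ((β u * (Complex.I * (Complex.I * Ψ v y z)) - β (J v) * (Complex.I * Ψ u y z))
        + (β u * (Complex.I * (Complex.I * Ψ v y z)) - β (J y) * (Complex.I * Ψ u z v))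
        + (β u * (Complex.I * (Complex.I * Ψ v y z)) - β (J z) * (Complex.I * Ψ u v y))).re := by
      simp only [Complex.add_re] at *
      linarith
    rw [hdet u v y z, ← sub_eq_zero, ← Complex.sub_re]
    rw [← sub_eq_zero, ← Complex.sub_re] at tot
    rw [← tot]
    congr 1
    simp only [γ]
    linear_combination (3 * β u * Ψ v y z) * Complex.I_mul_I
  -- On the frame `Ψ = 1`, and applying `J` to the first frame vector turns the real part into the
  -- imaginary part.
  have h6 (u : V) : 6 * β u = γ u := by
    have k1 := key u (c.symm (Pi.single 0 1)) (c.symm (Pi.single 1 1)) (c.symm (Pi.single 2 1))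
    have k2 := key u (J (c.symm (Pi.single 0 1))) (c.symm (Pi.single 1 1)) (c.symm (Pi.single 2 1))
    rw [hc.Ψ_J₁] at k2
    rw [hc.Ψ_frame, mul_one, mul_one] at k1
    rw [hc.Ψ_frame, mul_one, Complex.mul_I_re, Complex.mul_I_re, neg_inj] at k2
    exact Complex.ext k1 k2
  ext u
  have h1 := h6 u
  have h2 := h6 (J u)
  simp only [γ, hJ.J_J, map_neg] at h1 h2
  -- `6β = γ` makes `β` complex linear, and then `γ = 2β`, so `β = 0`. The combination with
  -- coefficient 24 does both steps at once.
  have h3 : 24 * β u = 0 := by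
    linear_combination 5 * h1 - Complex.I * h2 - β u * Complex.I_mul_I
  simpa using h3

theorem coord_eq_inner (hc : IsSpecialUnitaryCoord J Ψ c) (u : V) (k : Fin 3) :
    c u k = ⟨⟪u, c.symm (Pi.single k 1)⟫, ⟪u, J (c.symm (Pi.single k 1))⟫⟩ := by
  rw [hc.inner_eq, hc.inner_eq]
  simp only [hc.map_J, LinearEquiv.apply_symm_apply]
  apply Complex.ext <;> fin_cases k <;> simp [Fin.sum_univ_three]

/-- The orthonormal basis `e₀, e₁, e₂, Je₀, Je₁, Je₂` of special unitary coordinates. -/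
theorem exists_orthonormalBasis (hc : IsSpecialUnitaryCoord J Ψ c) :
    ∃ b : OrthonormalBasis (Fin 3 ⊕ Fin 3) ℝ V, (∀ k, b (Sum.inl k) = c.symm (Pi.single k 1)) ∧
      ∀ k, b (Sum.inr k) = J (c.symm (Pi.single k 1)) := by
  let b₀ : Fin 3 ⊕ Fin 3 → V :=
    Sum.elim (fun k ↦ c.symm (Pi.single k 1)) (fun k ↦ J (c.symm (Pi.single k 1)))
  have horth : Orthonormal ℝ b₀ := by
    rw [orthonormal_iff_ite]
    rintro (i | i) (j | j) <;> simp only [b₀, Sum.elim_inl, Sum.elim_inr, hc.inner_eq, hc.map_J,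
      LinearEquiv.apply_symm_apply, Fin.sum_univ_three] <;> fin_cases i <;> fin_cases j <;> simp
  have hspan : ⊤ ≤ Submodule.span ℝ (Set.range b₀) := by
    rintro u -
    rw [hc.eq_sum u]
    refine Submodule.sum_mem _ fun k _ ↦ Submodule.add_mem _ (Submodule.smul_mem _ _ ?_)
      (Submodule.smul_mem _ _ ?_)
    · exact Submodule.subset_span ⟨Sum.inl k, rfl⟩
    · exact Submodule.subset_span ⟨Sum.inr k, rfl⟩
  exact ⟨OrthonormalBasis.mk horth hspan, fun k ↦ by simp [b₀], fun k ↦ by simp [b₀]⟩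

end IsSpecialUnitaryCoord

end Coord

/-- The trace of a bilinear form does not depend on the orthonormal basis. -/
theorem sum_orthonormalBasis_eq {ι ι' : Type*} [Fintype ι] [Fintype ι'] (B : V →ₗ[ℝ] V →ₗ[ℝ] ℝ)
    (b : OrthonormalBasis ι ℝ V) (b' : OrthonormalBasis ι' ℝ V) :
    ∑ i, B (b i) (b i) = ∑ j, B (b' j) (b' j) := by
  have h1 (i : ι) : B (b i) (b i) = ∑ j, ⟪b' j, b i⟫ * B (b' j) (b i) := by
    have := congrArg (fun t ↦ B t (b i)) (b'.sum_repr' (b i)).symm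
    simpa only [map_sum, LinearMap.sum_apply, map_smul, LinearMap.smul_apply, smul_eq_mul] using this
  have h2 (j : ι') : B (b' j) (b' j) = ∑ i, ⟪b i, b' j⟫ * B (b' j) (b i) := by
    have := congrArg (fun t ↦ B (b' j) t) (b.sum_repr' (b' j)).symm
    simpa only [map_sum, map_smul, smul_eq_mul] using this
  simp only [h1, h2]
  rw [Finset.sum_comm]
  simp only [real_inner_comm]

/-! ### Curvature with values in `su(3)`. -/

section RicciFlat

variable {J : V →ₗ[ℝ] V} {Ψ : V → V → V → ℂ} {c : V ≃ₗ[ℝ] (Fin 3 → ℂ)}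
  {K : V → V → V → V → ℝ} {ι : Type*} [Fintype ι]

theorem IsAlgebraicCurvature.map_J_J (hK : IsAlgebraicCurvature K) (hJ : IsHermitian J)
    (h : ∀ u v y z, K u v y (J z) + K u v (J y) z = 0) (u v y z : V) :
    K u v (J y) (J z) = K u v y z := by
  have := h u v y (J z)
  rw [hJ.J_J, hK.neg₄] at this
  linarith

/-- The map `J` sends orthonormal bases to orthonormal bases. -/
theorem IsHermitian.exists_orthonormalBasis (hJ : IsHermitian J) (b : OrthonormalBasis ι ℝ V) :
    ∃ b' : OrthonormalBasis ι ℝ V, ∀ i, b' i = J (b i) := by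
  let e : V ≃ₗᵢ[ℝ] V :=
    { toLinearEquiv := LinearEquiv.ofLinearMap J (-J) (by ext; simp [hJ.J_J]) (by ext; simp [hJ.J_J])
      norm_map' u := by
        change ‖J u‖ = ‖u‖
        rw [norm_eq_sqrt_real_inner, hJ.inner_J_J, ← norm_eq_sqrt_real_inner] }
  exact ⟨b.map e, fun i ↦ by simp [e]⟩

/-- A curvature tensor with values in `u(3)` and vanishing complex trace is Ricci-flat. -/
theorem IsAlgebraicCurvature.ricci_eq_zero (hK : IsAlgebraicCurvature K) (hJ : IsHermitian J)
    (h : ∀ u v y z, K u v y (J z) + K u v (J y) z = 0) (b : OrthonormalBasis ι ℝ V)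
    (htr : ∀ u v, ∑ i, K u v (b i) (J (b i)) = 0) (u v : V) : ∑ i, K u (b i) v (b i) = 0 := by
  obtain ⟨b', hb'⟩ := hJ.exists_orthonormalBasis b
  have hJJ := hK.map_J_J hJ h
  -- Replace the basis `b` by `Jb`, then use the invariance of `K` under `J` in either pair of
  -- slots.
  have hinv : ∑ i, K (J v) (b i) (J u) (b i) = ∑ i, K u (b i) v (b i) := by
    let B : V →ₗ[ℝ] V →ₗ[ℝ] ℝ := LinearMap.mk₂ ℝ (fun a d ↦ K (J v) a (J u) d)
      (fun _ _ _ ↦ hK.add₂ _ _ _ _ _) (fun _ _ _ ↦ hK.smul₂ _ _ _ _ _)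
      (fun _ _ _ ↦ hK.add₄ _ _ _ _ _) (fun _ _ _ ↦ hK.smul₄ _ _ _ _ _)
    refine (sum_orthonormalBasis_eq B b b').trans (Finset.sum_congr rfl fun i _ ↦ ?_)
    simp only [B, LinearMap.mk₂_apply, hb']
    rw [hJJ, hK.pair, hJJ]
  have hsum := htr u (J v)
  -- Bianchi splits each summand of the complex trace of `K(u, Jv)` into two Ricci-type terms. By
  -- `hinv` their sums agree, so the trace is twice the Ricci tensor.
  have hterm (i : ι) : K u (J v) (b i) (J (b i)) =
      K (J v) (b i) (J u) (b i) + K u (b i) v (b i) := by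
    have b1 := hK.bianchi u (J v) (b i) (J (b i))
    have b2 := h (J v) (b i) u (b i)
    have b3 := hJJ (b i) u v (b i)
    have b4 := hK.swap₁₂ (b i) u v (b i)
    linarith
  simp only [hterm, Finset.sum_add_distrib, hinv] at hsum
  linarith

/-- A skew endomorphism commuting with `J` that annihilates `Re(w̄Ψ)`, `w ≠ 0`, has vanishing
complex trace. -/
theorem IsSpecialUnitaryCoord.sum_inner_J_eq_zero (hc : IsSpecialUnitaryCoord J Ψ c)
    (hJ : IsHermitian J) {w : ℂ} (hw : w ≠ 0) {A : V →ₗ[ℝ] V} (hskew : ∀ y z, ⟪A y, z⟫ = -⟪A z, y⟫)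
    (hAJ : ∀ y, A (J y) = J (A y))
    (hA : ∀ x y z, ((starRingEnd ℂ) w * (Ψ (A x) y z + Ψ x (A y) z + Ψ x y (A z))).re = 0)
    (b : OrthonormalBasis ι ℝ V) : ∑ i, ⟪A (b i), J (b i)⟫ = 0 := by
  obtain ⟨b', hb1, hb2⟩ := hc.exists_orthonormalBasis
  let B : V →ₗ[ℝ] V →ₗ[ℝ] ℝ := LinearMap.mk₂ ℝ (fun a d ↦ ⟪A a, J d⟫)
    (fun _ _ _ ↦ by simp [inner_add_left]) (fun _ _ _ ↦ by simp [inner_smul_left])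
    (fun _ _ _ ↦ by simp [inner_add_right]) (fun _ _ _ ↦ by simp [inner_smul_right])
  refine (sum_orthonormalBasis_eq B b b').trans ?_
  simp only [B, LinearMap.mk₂_apply, Fintype.sum_sum_type, hb1, hb2, hAJ, hJ.inner_J_J]
  set e : Fin 3 → V := fun k ↦ c.symm (Pi.single k 1)
  have hself (y : V) : ⟪A y, y⟫ = 0 := by linarith [hskew y y]
  have hck (k : Fin 3) : c (A (e k)) k = Complex.I * (⟪A (e k), J (e k)⟫ : ℝ) := by
    rw [hc.coord_eq_inner, hself]
    apply Complex.ext <;> simp [e]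
  -- The action of `A` on the determinant, evaluated on the frame, is the complex trace of `A`. The
  -- diagonal entries of `A` are imaginary by skewness, hence the factor `i`.
  have hΨ : Ψ (A (e 0)) (e 1) (e 2) + Ψ (e 0) (A (e 1)) (e 2) + Ψ (e 0) (e 1) (A (e 2)) =
      Complex.I * ((∑ k, ⟪A (e k), J (e k)⟫ : ℝ) : ℂ) := by
    have : c (A (e 0)) 0 + c (A (e 1)) 1 + c (A (e 2)) 2 =
      Complex.I * ((∑ k, ⟪A (e k), J (e k)⟫ : ℝ) : ℂ) := by
      rw [hck, hck, hck, Fin.sum_univ_three]; push_cast; ring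
    rw [← this]
    simp [hc.Ψ_eq, det₃, e]
  -- Testing on the frame and again with `Je₀` in place of `e₀` gives the imaginary and real parts
  -- of `wτ = 0`.
  have h1 := hA (e 0) (e 1) (e 2)
  have h2 := hA (J (e 0)) (e 1) (e 2)
  rw [hAJ, hc.Ψ_J₁, hc.Ψ_J₁, hc.Ψ_J₁, ← mul_add, ← mul_add, hΨ] at h2
  rw [hΨ] at h1
  set τ : ℝ := ∑ k, ⟪A (e k), J (e k)⟫
  have hτ : τ = 0 := by
    by_contra hτ
    apply hw
    simp at h1 h2
    apply Complex.ext
    · simpa [hτ] using h2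
    · simpa [hτ] using h1
  have : ∑ k, ⟪J (A (e k)), J (J (e k))⟫ = τ := by simp [τ, hJ.inner_J_J]
  simp only [e] at hτ this
  linarith

end RicciFlat

end AlgebraicCurvature

/-! ### Pointwise algebra of the nearly Kähler torsion. -/

noncomputable section TorsionAlgebra

local notation "⟪" u ", " v "⟫" => inner ℝ u v

variable {V : Type*} [NormedAddCommGroup V] [InnerProductSpace ℝ V]
  {J : V →ₗ[ℝ] V} {Ψ : V → V → V → ℂ} {c : V ≃ₗ[ℝ] (Fin 3 → ℂ)}

/-- A skew endomorphism that is orthogonal to the unitary Lie algebra anticommutes with `J`. -/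
theorem IsHermitian.map_J_eq_neg [FiniteDimensional ℝ V] (hJ : IsHermitian J)
    {A : Module.End ℝ V} (hA : ∀ u v, ⟪A u, v⟫ = -⟪u, A v⟫)
    (hperp : ∀ B : Module.End ℝ V, (∀ u v, ⟪B u, v⟫ = -⟪u, B v⟫) → (∀ u, B (J u) = J (B u)) →
      LinearMap.trace ℝ V (A * B) = 0) (u : V) : A (J u) = -J (A u) := by
  let J' : Module.End ℝ V := J
  -- Twice the part of `A` commuting with `J`. It lies in the unitary algebra, so `tr(AB) = 0`.
  -- Since also `tr(B²) = 2 tr(AB)` and `B` is skew, `B = 0`.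
  let B : Module.End ℝ V := A - J' * A * J'
  have hBu (u : V) : B u = A u - J (A (J u)) := rfl
  have hBskew (u v : V) : ⟪B u, v⟫ = -⟪u, B v⟫ := by
    rw [hBu, hBu, inner_sub_left, inner_sub_right, hJ.inner_J_left, hA, hA, hJ.inner_J_left]
    ring
  have hBJ (u : V) : B (J u) = J (B u) := by
    simp only [hBu, map_sub, hJ.J_J, map_neg]
    abel
  have h1 := hperp B hBskew hBJ
  have hJJ : J' * J' = -1 := by
    ext u
    exact hJ.J_J u
  have hcomm : B * J' = J' * B := by
    ext u
    exact hBJ u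
  have h2 : LinearMap.trace ℝ V (B * B) = 0 := by
    have e : B * B = A * B - J' * (A * B * J') := by
      rw [mul_assoc A B J', hcomm, ← mul_assoc A, ← mul_assoc J', ← mul_assoc J', ← sub_mul]
    rw [e, map_sub, LinearMap.trace_mul_comm ℝ J', mul_assoc _ J' J', hJJ, mul_neg, mul_one, map_neg, h1]
    simp
  rw [LinearMap.trace_eq_sum_inner _ (stdOrthonormalBasis ℝ V)] at h2
  have hBself (u : V) : ⟪u, (B * B) u⟫ = -‖B u‖ ^ 2 := by
    rw [← real_inner_self_eq_norm_sq, hBskew, neg_neg]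
    rfl
  simp only [hBself, Finset.sum_neg_distrib, neg_eq_zero] at h2
  rw [Finset.sum_eq_zero_iff_of_nonneg (fun _ _ ↦ by positivity)] at h2
  have hB0 : B = 0 := by
    refine (stdOrthonormalBasis ℝ V).toBasis.ext fun i ↦ ?_
    simpa using h2 i (Finset.mem_univ i)
  have := hBu (J u)
  rw [hB0, hJ.J_J, map_neg, map_neg, sub_neg_eq_add] at this
  exact eq_neg_of_add_eq_zero_left this.symm

/-- The algebraic type of the torsion of a nearly Kähler structure: `ξ u` is skew and anticommutes
with `J`, and `ξ u u = 0`. -/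
structure IsNearlyKahlerTorsion (J : V →ₗ[ℝ] V) (ξ : V →ₗ[ℝ] Module.End ℝ V) : Prop where
  skew : ∀ u v w, ⟪ξ u v, w⟫ = -⟪v, ξ u w⟫
  map_J : ∀ u v, ξ u (J v) = -J (ξ u v)
  alt : ∀ u, ξ u u = 0

namespace IsNearlyKahlerTorsion

variable {ξ ξ' : V →ₗ[ℝ] Module.End ℝ V}

theorem add (h : IsNearlyKahlerTorsion J ξ) (h' : IsNearlyKahlerTorsion J ξ') :
    IsNearlyKahlerTorsion J (ξ + ξ') where
  skew u v w := by
    simp only [LinearMap.add_apply, inner_add_left, inner_add_right, h.skew u v, h'.skew u v]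
    ring
  map_J u v := by
    simp only [LinearMap.add_apply, h.map_J, h'.map_J, map_add]
    abel
  alt u := by simp [h.alt, h'.alt]

theorem swap (h : IsNearlyKahlerTorsion J ξ) (u v : V) : ξ u v = -ξ v u := by
  have := h.alt (u + v)
  simp only [map_add, LinearMap.add_apply, h.alt, zero_add, add_zero] at this
  exact eq_neg_of_add_eq_zero_right this

/-- The torsion form `2⟨ξ_u v, J y⟩` is the real part of a complex volume form. -/
theorem exists_eq (h : IsNearlyKahlerTorsion J ξ) (hJ : IsHermitian J)
    (hc : IsSpecialUnitaryCoord J Ψ c) :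
    ∃ w : ℂ, ∀ u v y, 2 * ⟪ξ u v, J y⟫ = ((starRingEnd ℂ) w * Ψ u v y).re := by
  set a : V → V → V → ℝ := fun u v y ↦ ⟪ξ u v, J y⟫
  have h12 (u v y : V) : a u v y = -a v u y := by
    simp only [a]
    rw [h.swap u v, inner_neg_left]
  have h23 (u v y : V) : a u v y = -a u y v := by
    simp only [a]
    rw [h.skew, h.map_J, inner_neg_right, neg_neg, ← hJ.inner_J_J v, hJ.J_J, inner_neg_right,
      real_inner_comm]
  have hJ23 (u v y : V) : a u (J v) y = a u v (J y) := by
    simp only [a]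
    rw [h.map_J, inner_neg_left, hJ.inner_J_J, hJ.J_J, inner_neg_right]
  have hJ12 (u v y : V) : a (J u) v y = a u (J v) y := by
    rw [h12, hJ23, h12, hJ23, neg_neg]
  -- The form `a` is totally skew and `J` moves freely between its slots, so `a` is the real part of
  -- a form that is complex multilinear, hence a multiple of the determinant.
  have hA : IsComplexVolume J fun u v y ↦ (a u v y - Complex.I * a (J u) v y : ℂ) :=
    { add u u' v w := by simp [a, inner_add_left]; ring
      smul r u v w := by simp [a, inner_smul_left]; ring
      map_J u v w := by
        have : a (J (J u)) v w = -a u v w := by simp [a, hJ.J_J, inner_neg_left]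
        rw [this]
        push_cast
        linear_combination (a (J u) v w : ℂ) * Complex.I_mul_I
      swap₁₂ u v w := by
        have e1 := h12 u v w
        have e2 : a (J u) v w = -a (J v) u w := by rw [hJ12, h12]
        rw [e1, e2]
        push_cast
        ring
      swap₂₃ u v w := by
        rw [h23 u, h23 (J u)]
        push_cast
        ring }
  have hdet := hA.eq_det hc.toIsUnitaryCoord
  set z := (a (c.symm (Pi.single 0 1)) (c.symm (Pi.single 1 1)) (c.symm (Pi.single 2 1))
    - Complex.I * a (J (c.symm (Pi.single 0 1))) (c.symm (Pi.single 1 1)) (c.symm (Pi.single 2 1)) : ℂ)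
  -- The convention is `Re(w̄Ψ)` for `2a`, so `w̄ = 2z`.
  refine ⟨(starRingEnd ℂ) (2 * z), fun u v y ↦ ?_⟩
  have := congrArg Complex.re (hdet u v y)
  rw [Complex.conj_conj, hc.Ψ_eq, mul_assoc, ← Complex.ofReal_ofNat, Complex.re_ofReal_mul, ← this]
  simp [a]

variable {w : ℂ}

/-- Solves `hw` for `ξ`: taking `y` to be a frame vector and its image under `J` yields both parts
of the coordinate. -/
theorem coord_eq (hJ : IsHermitian J) (hc : IsSpecialUnitaryCoord J Ψ c)
    (hw : ∀ u v y, 2 * ⟪ξ u v, J y⟫ = ((starRingEnd ℂ) w * Ψ u v y).re) (u v : V) (k : Fin 3) :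
    c (ξ u v) k = Complex.I / 2 * w * (starRingEnd ℂ) (Ψ u v (c.symm (Pi.single k 1))) := by
  set e := c.symm (Pi.single k (1 : ℂ))
  have h1 := hw u v e
  have h2 := hw u v (J e)
  rw [hJ.J_J, inner_neg_right, hc.Ψ_J₃] at h2
  rw [hc.coord_eq_inner]
  simp only [Complex.mul_re, Complex.conj_re, Complex.conj_im, Complex.mul_im, Complex.I_re,
    Complex.I_im] at h1 h2
  change (⟨⟪ξ u v, e⟫, ⟪ξ u v, J e⟫⟩ : ℂ) = _
  apply Complex.ext <;> simp <;> linarith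

/-- The action of the torsion `ξ u` on the torsion form. -/
theorem re_conj_mul_eq (hJ : IsHermitian J) (hc : IsSpecialUnitaryCoord J Ψ c)
    (hw : ∀ u v y, 2 * ⟪ξ u v, J y⟫ = ((starRingEnd ℂ) w * Ψ u v y).re) (u x y z : V) :
    ((starRingEnd ℂ) w * (Ψ (ξ u x) y z + Ψ x (ξ u y) z + Ψ x y (ξ u z))).re =
      -(Complex.normSq w * (⟪u, x⟫ * ⟪y, J z⟫ - ⟪u, y⟫ * ⟪x, J z⟫ + ⟪u, z⟫ * ⟪x, J y⟫)) := by
  have h0 (x y : V) : Ψ x y (c.symm (Pi.single 0 1)) = c x 1 * c y 2 - c x 2 * c y 1 := by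
    simp [hc.Ψ_eq, det₃]; ring
  have h1 (x y : V) : Ψ x y (c.symm (Pi.single 1 1)) = c x 2 * c y 0 - c x 0 * c y 2 := by
    simp [hc.Ψ_eq, det₃]; ring
  have h2 (x y : V) : Ψ x y (c.symm (Pi.single 2 1)) = c x 0 * c y 1 - c x 1 * c y 0 := by
    simp [hc.Ψ_eq, det₃]
  have hΨ (x y z : V) : Ψ (ξ u x) y z + Ψ x (ξ u y) z + Ψ x y (ξ u z) =
      Complex.I / 2 * w * (
        (starRingEnd ℂ) (Ψ u x (c.symm (Pi.single 0 1))) * (c y 1 * c z 2 - c y 2 * c z 1)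
        - (starRingEnd ℂ) (Ψ u x (c.symm (Pi.single 1 1))) * (c y 0 * c z 2 - c y 2 * c z 0)
        + (starRingEnd ℂ) (Ψ u x (c.symm (Pi.single 2 1))) * (c y 0 * c z 1 - c y 1 * c z 0)
        - ((starRingEnd ℂ) (Ψ u y (c.symm (Pi.single 0 1))) * (c x 1 * c z 2 - c x 2 * c z 1)
        - (starRingEnd ℂ) (Ψ u y (c.symm (Pi.single 1 1))) * (c x 0 * c z 2 - c x 2 * c z 0)
        + (starRingEnd ℂ) (Ψ u y (c.symm (Pi.single 2 1))) * (c x 0 * c z 1 - c x 1 * c z 0))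
        + ((starRingEnd ℂ) (Ψ u z (c.symm (Pi.single 0 1))) * (c x 1 * c y 2 - c x 2 * c y 1)
        - (starRingEnd ℂ) (Ψ u z (c.symm (Pi.single 1 1))) * (c x 0 * c y 2 - c x 2 * c y 0)
        + (starRingEnd ℂ) (Ψ u z (c.symm (Pi.single 2 1))) * (c x 0 * c y 1 - c x 1 * c y 0))) := by
    rw [hc.Ψ_eq, hc.Ψ_eq, hc.Ψ_eq]
    simp only [det₃, coord_eq hJ hc hw]
    ring
  -- The torsion contributes a factor `w`, which pairs with `w̄` to give `|w|²`. What remains is a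
  -- polynomial identity in the coordinates.
  have hre (s : ℂ) : ((starRingEnd ℂ) w * (Complex.I / 2 * w * s)).re =
      -(Complex.normSq w * (s.im / 2)) := by
    have : (starRingEnd ℂ) w * (Complex.I / 2 * w * s) = Complex.normSq w * (Complex.I / 2 * s) := by
      rw [Complex.normSq_eq_conj_mul_self]; ring
    have h : (Complex.I / 2 * s).re = -(s.im / 2) := by simp; ring
    rw [this, Complex.re_ofReal_mul, h, mul_neg]
  rw [hΨ, hre, neg_inj]
  congr 1
  simp only [h0, h1, h2, hc.inner_eq, hc.map_J, Fin.sum_univ_three, Complex.add_im, Complex.sub_im,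
    Complex.mul_im, Complex.mul_re, Complex.sub_re, Complex.conj_re, Complex.conj_im, Complex.I_re,
    Complex.I_im]
  ring

theorem eq_zero (hJ : IsHermitian J) 
    (hw : ∀ u v y, 2 * ⟪ξ u v, J y⟫ = ((starRingEnd ℂ) w * Ψ u v y).re) (h0 : w = 0) : ξ = 0 := by
  ext u v
  refine ext_inner_right ℝ fun y ↦ ?_
  have := hw u v (J y)
  rw [h0, hJ.J_J, inner_neg_right] at this
  simp at this
  simpa using this

end IsNearlyKahlerTorsion

end TorsionAlgebra

/-! ### The intrinsic torsion of type `W₁⁺ + W₁⁻ + W₅` at a point. -/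

noncomputable section TorsionPointwise

local notation "⟪" u ", " v "⟫" => inner ℝ u v

section

variable {X : Type*} (a b c z : X)

theorem update_three₀ : Function.update ![a, b, c] 0 z = ![z, b, c] := by
  ext i; fin_cases i <;> rfl

theorem update_three₁ : Function.update ![a, b, c] 1 z = ![a, z, c] := by
  ext i; fin_cases i <;> rfl

theorem update_three₂ : Function.update ![a, b, c] 2 z = ![a, b, z] := by
  ext i; fin_cases i <;> rfl

theorem update_two₀ : Function.update ![a, b] 0 z = ![z, b] := by
  ext i; fin_cases i <;> rfl

theorem update_two₁ : Function.update ![a, b] 1 z = ![a, z] := by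
  ext i; fin_cases i <;> rfl

end

namespace SU3Structure

variable {M : Type*} [TopologicalSpace M] [ChartedSpace E6 M] [IsManifold (𝓡 6) ∞ M]
  [RiemannianBundle (fun x : M ↦ TangentSpace (𝓡 6) x)]
  [IsContMDiffRiemannianBundle (𝓡 6) ∞ E6 (fun x : M ↦ TangentSpace (𝓡 6) x)]

variable (S : SU3Structure M)

/-- The almost complex structure on the tangent space at `x`. -/
abbrev Jlin (x : M) : TangentSpace (𝓡 6) x →ₗ[ℝ] TangentSpace (𝓡 6) x := S.J x

/-- The complex volume form as a function of three tangent vectors. -/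
def vol (x : M) (u v w : TangentSpace (𝓡 6) x) : ℂ := S.Ψ x ![u, v, w]

theorem isHermitian (x : M) : IsHermitian (S.Jlin x) := ⟨S.J_J x, S.inner_J_J x⟩

theorem vol_swap₁₂ (x : M) (u v w : TangentSpace (𝓡 6) x) : S.vol x u v w = -S.vol x v u w := by
  have := (S.Ψ x).map_swap ![v, u, w] (i := 0) (j := 1) (by decide)
  rw [vol, vol, ← this]
  congr 1
  ext i
  fin_cases i <;> rfl

theorem vol_swap₂₃ (x : M) (u v w : TangentSpace (𝓡 6) x) : S.vol x u v w = -S.vol x u w v := by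
  have := (S.Ψ x).map_swap ![u, w, v] (i := 1) (j := 2) (by decide)
  rw [vol, vol, ← this]
  congr 1
  ext i
  fin_cases i <;> rfl

theorem isComplexVolume (x : M) : IsComplexVolume (S.Jlin x) (S.vol x) where
  add u u' v w := by
    have := (S.Ψ x).map_update_add ![u, v, w] 0 u u'
    rwa [update_three₀, update_three₀, update_three₀] at this
  smul r u v w := by
    have := (S.Ψ x).map_update_smul ![u, v, w] 0 r u
    rwa [update_three₀, update_three₀, Complex.real_smul] at this
  map_J u v w := S.Ψ_J x u v w
  swap₁₂ := S.vol_swap₁₂ x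
  swap₂₃ := S.vol_swap₂₃ x

theorem finrank_tangentSpace (x : M) : Module.finrank ℝ (TangentSpace (𝓡 6) x) = 6 :=
  (finrank_euclideanSpace_fin : Module.finrank ℝ E6 = 6)

/-- Of the 27 terms in the normalisation only the six permutations of the frame are nonzero; they
are equal and cancel `1/3!`. -/
theorem normSq_vol (x : M) (e : Fin 3 → TangentSpace (𝓡 6) x) (he : IsUnitaryFrame (S.Jlin x) e) :
    Complex.normSq (S.vol x (e 0) (e 1) (e 2)) = 1 := by
  have h := S.Ψ_norm x e fun i j ↦ by
    have h1 := he.inner_eq i j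
    have h2 : ⟪e i, S.J x (e j)⟫ = 0 := he.inner_J_eq i j
    rw [h1, h2]
    split_ifs <;> simp
  have hA := S.isComplexVolume x
  have z12 (u w) : S.vol x u u w = 0 := self_eq_neg.1 (hA.swap₁₂ u u w)
  have z23 (u w) : S.vol x u w w = 0 := self_eq_neg.1 (hA.swap₂₃ u w w)
  have z13 (u w) : S.vol x u w u = 0 := by rw [hA.swap₁₂, z23, neg_zero]
  have a1 : S.vol x (e 0) (e 2) (e 1) = -S.vol x (e 0) (e 1) (e 2) := hA.swap₂₃ _ _ _
  have a2 : S.vol x (e 1) (e 0) (e 2) = -S.vol x (e 0) (e 1) (e 2) := hA.swap₁₂ _ _ _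
  have a3 : S.vol x (e 1) (e 2) (e 0) = S.vol x (e 0) (e 1) (e 2) := by rw [hA.swap₂₃, a2, neg_neg]
  have a4 : S.vol x (e 2) (e 0) (e 1) = S.vol x (e 0) (e 1) (e 2) := by rw [hA.swap₁₂, a1, neg_neg]
  have a5 : S.vol x (e 2) (e 1) (e 0) = -S.vol x (e 0) (e 1) (e 2) := by rw [hA.swap₂₃, a4]
  change _ * ∑ i, ∑ j, ∑ k, S.vol x (e i) (e j) (e k) * (starRingEnd ℂ) (S.vol x (e i) (e j) (e k)) = 1 at h
  simp only [Fin.sum_univ_three, z12, z23, z13, a1, a2, a3, a4, a5, map_neg, map_zero] at h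
  have : ((Complex.normSq (S.vol x (e 0) (e 1) (e 2)) : ℝ) : ℂ) = 1 := by
    rw [← Complex.mul_conj, ← h]
    norm_num [Nat.factorial]
    ring
  exact_mod_cast this

theorem exists_isSpecialUnitaryCoord (x : M) :
    ∃ c : TangentSpace (𝓡 6) x ≃ₗ[ℝ] (Fin 3 → ℂ), IsSpecialUnitaryCoord (S.Jlin x) (S.vol x) c :=
  (S.isHermitian x).exists_isSpecialUnitaryCoord (finrank_tangentSpace x) (S.isComplexVolume x)
    (S.normSq_vol x)

theorem torsionForm_eq {x : M} (ξ : Torsion x) (u v w : TangentSpace (𝓡 6) x) :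
    S.torsionForm x ξ u v w = ⟪ξ u v, S.J x w⟫ + ⟪v, S.J x (ξ u w)⟫ := by
  simp [torsionForm, endAction, kahlerForm, Fin.sum_univ_two, Function.update]

/-- Orthogonality to `u(3)` makes `ξ_u` anticommute with `J`, so `a(u, v, w) = 2⟨ξ_u v, Jw⟩`, and
`a(u, u, ·) = 0` becomes `ξ_u u = 0`. -/
theorem isNearlyKahlerTorsion_of_mem_W1 {x : M} {ξ : Torsion x} (h : ξ ∈ S.W1 x) :
    IsNearlyKahlerTorsion (S.Jlin x) ξ := by
  have hJ := S.isHermitian x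
  have hskew (u v w) : ⟪ξ u v, w⟫ = -⟪v, ξ u w⟫ := (h.1 u).1 v w
  have hanti (u v) : ξ u (S.Jlin x v) = -S.Jlin x (ξ u v) :=
    hJ.map_J_eq_neg (hskew u) (fun B hB hBJ ↦ (h.1 u).2 B ⟨hB, hBJ⟩) v
  refine ⟨hskew, hanti, fun u ↦ ext_inner_right ℝ fun w ↦ ?_⟩
  have h1 := h.2 u (S.Jlin x w)
  have h2 : S.J x (S.Jlin x w) = -w := S.J_J x w
  have h3 : S.J x (ξ u (S.Jlin x w)) = ξ u w := by
    rw [hanti]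
    change S.J x (-S.J x (ξ u w)) = _
    rw [map_neg, S.J_J, neg_neg]
  rw [torsionForm_eq, h2, h3, inner_neg_right, ← neg_eq_iff_eq_neg.2 (hskew u u w)] at h1
  rw [inner_zero_left]
  linarith

/-- The intrinsic torsion at `x` is `ξ + η ⊗ J`, where `ξ` corresponds to the three-form
`Re(w̄Ψ)`. -/
structure HasTorsion (x : M) (w : ℂ) (ξ : Torsion x) (η : TangentSpace (𝓡 6) x →ₗ[ℝ] ℝ) : Prop where
  inner_eq : ∀ u v y, 2 * ⟪ξ u v, S.Jlin x y⟫ = ((starRingEnd ℂ) w * S.vol x u v y).re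
  nabla_kahlerForm : ∀ u v y, covDerivForm S.kahlerForm x u ![v, y] =
    ((starRingEnd ℂ) w * S.vol x u v y).re
  nabla_ψp : ∀ u a b c, covDerivForm S.ψp x u ![a, b, c] =
    (S.vol x (ξ u a) b c + S.vol x a (ξ u b) c + S.vol x a b (ξ u c)
      + 3 * Complex.I * η u * S.vol x a b c).re
  nabla_ψm : ∀ u a b c, covDerivForm S.ψm x u ![a, b, c] =
    (S.vol x (ξ u a) b c + S.vol x a (ξ u b) c + S.vol x a b (ξ u c)
      + 3 * Complex.I * η u * S.vol x a b c).im
  mem_W5 : w = 0 → ∃ T, S.IsIntrinsicTorsion x T ∧ T ∈ S.W5 x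

/-- The two `W₁` components are added to a single `ξ`. The remaining part `η ⊗ J` kills `ω` and acts
on `Ψ` by `3iη`. The last field records that `w = 0` leaves only `η ⊗ J`, which is what excludes `w
= 0` everywhere in the end. -/
theorem exists_hasTorsion {x : M} {T : Torsion x} (hT : S.IsIntrinsicTorsion x T)
    (hmem : T ∈ S.W1pW1mW5 x) : ∃ w ξ η, S.HasTorsion x w ξ η := by
  obtain ⟨ξp, hξp, ξm, hξm, η', ⟨η, hη⟩, hTsum⟩ := hmem
  have hJ := S.isHermitian x
  obtain ⟨c, hc⟩ := S.exists_isSpecialUnitaryCoord x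
  have hξ := (S.isNearlyKahlerTorsion_of_mem_W1 hξp.1).add (S.isNearlyKahlerTorsion_of_mem_W1 hξm.1)
  set ξ : Torsion x := ξp + ξm
  obtain ⟨w, hw⟩ := hξ.exists_eq hJ hc
  have hTu (u v) : T u v = ξ u v + η u • S.Jlin x v := by
    rw [hTsum, LinearMap.add_apply, LinearMap.add_apply, hη]
    rfl
  have vadd₂ (a b b' d) : S.vol x a (b + b') d = S.vol x a b d + S.vol x a b' d := by
    rw [S.vol_swap₁₂, (S.isComplexVolume x).add, S.vol_swap₁₂ x a b, S.vol_swap₁₂ x a b']; ring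
  have vadd₃ (a b d d') : S.vol x a b (d + d') = S.vol x a b d + S.vol x a b d' := by
    rw [S.vol_swap₂₃, vadd₂, S.vol_swap₂₃ x a b d, S.vol_swap₂₃ x a b d']; ring
  have vsmul₂ (a) (r : ℝ) (b d) : S.vol x a (r • b) d = r * S.vol x a b d := by
    rw [S.vol_swap₁₂, (S.isComplexVolume x).smul, S.vol_swap₁₂ x a b]; ring
  have vsmul₃ (a b) (r : ℝ) (d) : S.vol x a b (r • d) = r * S.vol x a b d := by
    rw [S.vol_swap₂₃, vsmul₂, S.vol_swap₂₃ x a b]; ring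
  have hsum (u a b d) : S.vol x (T u a) b d + S.vol x a (T u b) d + S.vol x a b (T u d) =
      S.vol x (ξ u a) b d + S.vol x a (ξ u b) d + S.vol x a b (ξ u d)
      + 3 * Complex.I * η u * S.vol x a b d := by
    rw [hTu, hTu, hTu, (S.isComplexVolume x).add, vadd₂, vadd₃, (S.isComplexVolume x).smul, vsmul₂,
      vsmul₃, hc.Ψ_J₁, hc.Ψ_J₂, hc.Ψ_J₃]
    ring
  refine ⟨w, ξ, η, hw, fun u v y ↦ ?_, fun u a b d ↦ ?_, fun u a b d ↦ ?_, fun h0 ↦ ⟨T, hT, η, ?_⟩⟩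
  · have h1 := hT.parallel_kahlerForm u ![v, y]
    have h2 := S.torsionForm_eq T u v y
    rw [torsionForm] at h2
    have h3 : ⟪v, S.J x (T u y)⟫ = -⟪S.J x v, T u y⟫ := by
      have := hJ.inner_J_left v (T u y)
      rw [← neg_eq_iff_eq_neg] at this
      exact this.symm
    -- The `η` terms cancel; skewness of `ξ_u` and its anticommutation with `J` make the two `ξ`
    -- terms equal.
    have h4 : ⟪T u v, S.J x y⟫ + ⟪v, S.J x (T u y)⟫ = 2 * ⟪ξ u v, S.Jlin x y⟫ := by
      rw [h3, hTu, hTu, inner_add_left, inner_add_right, inner_smul_left, inner_smul_right]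
      have h5 : ⟪S.J x v, ξ u y⟫ = -⟪ξ u v, S.Jlin x y⟫ := by
        have := hξ.skew u v (S.Jlin x y)
        rw [hξ.map_J, inner_neg_right, neg_neg] at this
        rw [this]
        have := hJ.inner_J_left v (ξ u y)
        exact this
      have h6 : ⟪S.Jlin x v, S.J x y⟫ = ⟪S.J x v, S.Jlin x y⟫ := rfl
      rw [h5, h6]
      have h7 : ⟪ξ u v, S.J x y⟫ = ⟪ξ u v, S.Jlin x y⟫ := rfl
      rw [h7]
      simp
      ring
    rw [← hw, ← h4, ← h2]
    linarith
  · have h1 := hT.parallel_ψp u ![a, b, d]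
    rw [← hsum]
    simp only [endAction, ψp, Fin.sum_univ_three, update_three₀, update_three₁, update_three₂,
      Matrix.cons_val] at h1
    simp only [Complex.add_re, vol]
    linarith
  · have h1 := hT.parallel_ψm u ![a, b, d]
    rw [← hsum]
    simp only [endAction, ψm, Fin.sum_univ_three, update_three₀, update_three₁, update_three₂,
      Matrix.cons_val] at h1
    simp only [Complex.add_im, vol]
    linarith
  · intro u v
    rw [hTu, IsNearlyKahlerTorsion.eq_zero hJ hw h0]
    simp

end SU3Structure

end TorsionPointwise

/-! ### Differentiating `ω` and `Ψ`; smoothness of `w`. -/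

noncomputable section TorsionDerivative

local notation "⟪" u ", " v "⟫" => inner ℝ u v

local notation "CField" => ContMDiffAt (𝓡 6) (ModelWithCorners.tangent (𝓡 6)) ∞
local notation "DField" => MDifferentiableAt (𝓡 6) (ModelWithCorners.tangent (𝓡 6))
local notation "CFun" => ContMDiffAt (𝓡 6) 𝓘(ℝ, ℝ) ∞
local notation "DFun" => MDifferentiableAt (𝓡 6) 𝓘(ℝ, ℝ)

namespace SU3Structure

variable {M : Type*} [TopologicalSpace M] [ChartedSpace E6 M] [IsManifold (𝓡 6) ∞ M]
  [RiemannianBundle (fun x : M ↦ TangentSpace (𝓡 6) x)]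
  [IsContMDiffRiemannianBundle (𝓡 6) ∞ E6 (fun x : M ↦ TangentSpace (𝓡 6) x)]

variable (S : SU3Structure M) {x : M} {A B C : Π y : M, TangentSpace (𝓡 6) y}

theorem contMDiffAt_J (hA : CField (T% A) x) :
    CField (T% (fun y ↦ S.J y (A y))) x :=
  ContMDiffAt.clm_bundle_apply (F₁ := E6) (F₂ := E6) (E₁ := fun x : M ↦ TangentSpace (𝓡 6) x)
    (E₂ := fun x : M ↦ TangentSpace (𝓡 6) x) (b := id) (S.contMDiff_J x) hA

theorem mdifferentiableAt_J (hA : DField (T% A) x) :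
    DField (T% (fun y ↦ S.J y (A y))) x :=
  MDifferentiableAt.clm_bundle_apply (F₁ := E6) (F₂ := E6) (E₁ := fun x : M ↦ TangentSpace (𝓡 6) x)
    (E₂ := fun x : M ↦ TangentSpace (𝓡 6) x) (b := id)
    ((S.contMDiff_J x).mdifferentiableAt (by simp)) hA

theorem contMDiffAt_vol (hA : CField (T% A) x) (hB : CField (T% B) x)
    (hC : CField (T% C) x) :
    ContMDiffAt (𝓡 6) 𝓘(ℝ, ℂ) ∞ (fun y ↦ S.vol y (A y) (B y) (C y)) x := by
  have := S.contMDiff_Ψ ![A, B, C] x fun i ↦ by fin_cases i <;> assumption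
  refine this.congr_of_eventuallyEq (Filter.Eventually.of_forall fun y ↦ ?_)
  simp only [vol]
  congr 1
  ext i
  fin_cases i <;> rfl

theorem contMDiffAt_vol_re (hA : CField (T% A) x) (hB : CField (T% B) x)
    (hC : CField (T% C) x) : CFun (fun y ↦ (S.vol y (A y) (B y) (C y)).re) x :=
  (Complex.reCLM.contMDiff.contMDiffAt).comp x (S.contMDiffAt_vol hA hB hC)

theorem contMDiffAt_vol_im (hA : CField (T% A) x) (hB : CField (T% B) x)
    (hC : CField (T% C) x) : CFun (fun y ↦ (S.vol y (A y) (B y) (C y)).im) x :=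
  (Complex.imCLM.contMDiff.contMDiffAt).comp x (S.contMDiffAt_vol hA hB hC)

/-- The Kähler form as a multilinear map. -/
def kahlerMultilinear (y : M) : MultilinearMap ℝ (fun _ : Fin 2 ↦ TangentSpace (𝓡 6) y) ℝ where
  toFun := S.kahlerForm y
  map_update_add' m i a b := by
    fin_cases i <;> simp [kahlerForm, Function.update, inner_add_left, inner_add_right]
  map_update_smul' m i r a := by
    fin_cases i <;> simp [kahlerForm, Function.update, inner_smul_left, inner_smul_right]

theorem mvfderiv_kahler (hA : DField (T% A) x) (hB : DField (T% B) x)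
    (u : TangentSpace (𝓡 6) x) :
    mvfderiv (𝓡 6) (fun y ↦ ⟪A y, S.J y (B y)⟫) x u = ⟪leviCivita (𝓡 6) M A x u, S.J x (B x)⟫
      + ⟪A x, S.J x (leviCivita (𝓡 6) M B x u)⟫ + covDerivForm S.kahlerForm x u ![A x, B x] := by
  have h := mvfderiv_form (φ := S.kahlerMultilinear) (x := x)
    (fun V hV ↦ mdifferentiableAt_inner (hV 0) (S.mdifferentiableAt_J (hV 1))) u (V := ![A, B])
    (fun i ↦ by fin_cases i <;> assumption)
  have e : (fun j ↦ (![A, B] : Fin 2 → Π y : M, TangentSpace (𝓡 6) y) j x) = ![A x, B x] := by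
    ext i; fin_cases i <;> rfl
  rw [e, Fin.sum_univ_two, update_two₀, update_two₁] at h
  exact h

theorem mvfderiv_vol_re (hA : DField (T% A) x) (hB : DField (T% B) x) (hC : DField (T% C) x)
    (u : TangentSpace (𝓡 6) x) :
    mvfderiv (𝓡 6) (fun y ↦ (S.vol y (A y) (B y) (C y)).re) x u =
      (S.vol x (leviCivita (𝓡 6) M A x u) (B x) (C x)
        + S.vol x (A x) (leviCivita (𝓡 6) M B x u) (C x)
        + S.vol x (A x) (B x) (leviCivita (𝓡 6) M C x u)).re
      + covDerivForm S.ψp x u ![A x, B x, C x] := by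
  let φ (y : M) : MultilinearMap ℝ (fun _ : Fin 3 ↦ TangentSpace (𝓡 6) y) ℝ :=
    Complex.reLm.compMultilinearMap (S.Ψ y).toMultilinearMap
  have hφ (V : Fin 3 → Π y : M, TangentSpace (𝓡 6) y) (hV : ∀ i, CField (T% (V i)) x) :
      DFun (fun y ↦ φ y (fun i ↦ V i y)) x :=
    ((Complex.reCLM.contMDiff.contMDiffAt).comp x (S.contMDiff_Ψ V x hV)).mdifferentiableAt
      (by simp)
  -- Smoothness of `Ψ` is given only on smooth fields; `mdifferentiableAt_multilinear` extends it to
  -- differentiable ones.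
  have h := mvfderiv_form (φ := φ) (fun V hV ↦ mdifferentiableAt_multilinear hφ hV) u
    (V := ![A, B, C]) (fun i ↦ by fin_cases i <;> assumption)
  have e (y : M) : (fun j ↦ (![A, B, C] : Fin 3 → Π y : M, TangentSpace (𝓡 6) y) j y) =
      ![A y, B y, C y] := by
    ext i; fin_cases i <;> rfl
  simp only [e, Fin.sum_univ_three, update_three₀, update_three₁, update_three₂] at h
  rw [Complex.add_re, Complex.add_re]
  exact h

theorem mvfderiv_vol_im (hA : DField (T% A) x) (hB : DField (T% B) x) (hC : DField (T% C) x)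
    (u : TangentSpace (𝓡 6) x) :
    mvfderiv (𝓡 6) (fun y ↦ (S.vol y (A y) (B y) (C y)).im) x u =
      (S.vol x (leviCivita (𝓡 6) M A x u) (B x) (C x)
        + S.vol x (A x) (leviCivita (𝓡 6) M B x u) (C x)
        + S.vol x (A x) (B x) (leviCivita (𝓡 6) M C x u)).im
      + covDerivForm S.ψm x u ![A x, B x, C x] := by
  let φ (y : M) : MultilinearMap ℝ (fun _ : Fin 3 ↦ TangentSpace (𝓡 6) y) ℝ :=
    Complex.imLm.compMultilinearMap (S.Ψ y).toMultilinearMap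
  have hφ (V : Fin 3 → Π y : M, TangentSpace (𝓡 6) y) (hV : ∀ i, CField (T% (V i)) x) :
      DFun (fun y ↦ φ y (fun i ↦ V i y)) x :=
    ((Complex.imCLM.contMDiff.contMDiffAt).comp x (S.contMDiff_Ψ V x hV)).mdifferentiableAt
      (by simp)
  have h := mvfderiv_form (φ := φ) (fun V hV ↦ mdifferentiableAt_multilinear hφ hV) u
    (V := ![A, B, C]) (fun i ↦ by fin_cases i <;> assumption)
  have e (y : M) : (fun j ↦ (![A, B, C] : Fin 3 → Π y : M, TangentSpace (𝓡 6) y) j y) =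
      ![A y, B y, C y] := by
    ext i; fin_cases i <;> rfl
  simp only [e, Fin.sum_univ_three, update_three₀, update_three₁, update_three₂] at h
  rw [Complex.add_im, Complex.add_im]
  exact h

variable {S} {w : M → ℂ} {ξ : Π x : M, Torsion x} {η : Π x : M, TangentSpace (𝓡 6) x →ₗ[ℝ] ℝ}

/-- The function equals `(∇_A ω)(B, C)`, which the Leibniz rule expresses through smooth quantities.
No regularity of `w` is presupposed. -/
theorem contMDiffAt_nabla_kahlerForm (h : ∀ x, S.HasTorsion x (w x) (ξ x) (η x))
    (hA : SmoothNear x A) (hB : SmoothNear x B) (hC : SmoothNear x C) :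
    CFun (fun y ↦ ((starRingEnd ℂ) (w y) * S.vol y (A y) (B y) (C y)).re) x := by
  have h1 : CFun (fun y ↦ mvfderiv (𝓡 6) (fun z ↦ ⟪B z, S.J z (C z)⟫) y (A y)
      - ⟪leviCivita (𝓡 6) M B y (A y), S.J y (C y)⟫
      - ⟪B y, S.J y (leviCivita (𝓡 6) M C y (A y))⟫) x :=
    ((contMDiffAt_mvfderiv_apply (contMDiffAt_inner hB.contMDiffAt (S.contMDiffAt_J hC.contMDiffAt))
      hA.contMDiffAt).sub (contMDiffAt_inner (hA.leviCivita hB).contMDiffAt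
        (S.contMDiffAt_J hC.contMDiffAt))).sub
      (contMDiffAt_inner hB.contMDiffAt (S.contMDiffAt_J (hA.leviCivita hC).contMDiffAt))
  refine h1.congr_of_eventuallyEq ?_
  filter_upwards [hB, hC] with y hB hC
  rw [S.mvfderiv_kahler (hB.mdifferentiableAt (by simp)) (hC.mdifferentiableAt (by simp)),
    (h y).nabla_kahlerForm]
  ring

theorem contMDiffAt_w (h : ∀ x, S.HasTorsion x (w x) (ξ x) (η x)) (x : M) :
    CFun (fun y ↦ (w y).re) x ∧ CFun (fun y ↦ (w y).im) x := by
  obtain ⟨c, hc⟩ := S.exists_isSpecialUnitaryCoord x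
  let e (k : Fin 3) : TangentSpace (𝓡 6) x := c.symm (Pi.single k 1)
  let X (k : Fin 3) : Π y : M, TangentSpace (𝓡 6) y := extend E6 (e k)
  have hX (k : Fin 3) : SmoothNear x (X k) := SmoothNear.extend (e k)
  have hJX : SmoothNear x (fun y ↦ S.J y (X 2 y)) := by
    filter_upwards [hX 2] with y hy using S.contMDiffAt_J hy
  let D (y : M) : ℂ := S.vol y (X 0 y) (X 1 y) (X 2 y)
  have h1 := contMDiffAt_nabla_kahlerForm h (hX 0) (hX 1) (hX 2)
  have h2 := contMDiffAt_nabla_kahlerForm h (hX 0) (hX 1) hJX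
  have hre : CFun (fun y ↦ (D y).re) x :=
    S.contMDiffAt_vol_re (hX 0).contMDiffAt (hX 1).contMDiffAt (hX 2).contMDiffAt
  have him : CFun (fun y ↦ (D y).im) x :=
    S.contMDiffAt_vol_im (hX 0).contMDiffAt (hX 1).contMDiffAt (hX 2).contMDiffAt
  have hDx : D x = 1 := by
    have := hc.Ψ_frame
    simpa [D, X, e] using this
  have hN : CFun (fun y ↦ (D y).re * (D y).re + (D y).im * (D y).im) x :=
    (hre.mul hre).add (him.mul him)
  have hne : ∀ᶠ y in 𝓝 x, (D y).re * (D y).re + (D y).im * (D y).im ≠ 0 :=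
    hN.continuousAt.eventually_ne (by simp [hDx])
  have hN' : CFun (fun y ↦ ((D y).re * (D y).re + (D y).im * (D y).im)⁻¹) x :=
    hN.inv₀ (by simp [hDx])
  have hJ₃ (y : M) (a b d : TangentSpace (𝓡 6) y) :
      S.vol y a b (S.J y d) = Complex.I * S.vol y a b d := by
    obtain ⟨c, hc⟩ := S.exists_isSpecialUnitaryCoord y
    exact hc.Ψ_J₃ a b d
  constructor
  · refine (((h1.mul hre).sub (h2.mul him)).mul hN').congr_of_eventuallyEq ?_
    filter_upwards [hne] with y hy
    change _ = (((starRingEnd ℂ) (w y) * D y).re * (D y).re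
      - ((starRingEnd ℂ) (w y) * S.vol y _ _ _).re * (D y).im) * _
    rw [hJ₃, ← div_eq_mul_inv, eq_div_iff hy]
    change _ = _ - ((starRingEnd ℂ) (w y) * (Complex.I * D y)).re * _
    simp
    ring
  · refine (((h1.mul him).add (h2.mul hre)).mul hN').congr_of_eventuallyEq ?_
    filter_upwards [hne] with y hy
    change _ = (((starRingEnd ℂ) (w y) * D y).re * (D y).im
      + ((starRingEnd ℂ) (w y) * S.vol y _ _ _).re * (D y).re) * _
    rw [hJ₃, ← div_eq_mul_inv, eq_div_iff hy]
    change _ = _ + ((starRingEnd ℂ) (w y) * (Complex.I * D y)).re * _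
    simp
    ring

end SU3Structure

end TorsionDerivative

/-! ### Ricci tensors of a sphere plus a Ricci-flat Kähler curvature. -/

noncomputable section ConstantHolomorphicType

local notation "⟪" u ", " v "⟫" => inner ℝ u v

variable {V : Type*} [NormedAddCommGroup V] [InnerProductSpace ℝ V] {J : V →ₗ[ℝ] V}
  {K : V → V → V → V → ℝ} {α : ℝ} {ι : Type*} [Fintype ι]

/-- The Ricci and `*`-Ricci tensors of a curvature tensor that differs from that of a sphere by a
Ricci-flat Kähler curvature tensor. -/
theorem IsAlgebraicCurvature.ricci_eq_of_sub_sphere (hK : IsAlgebraicCurvature K)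
    (hJ : IsHermitian J)
    (h : ∀ u v y z, K u v y (J z) - α * sphereCurvature u v y (J z)
      + (K u v (J y) z - α * sphereCurvature u v (J y) z) = 0) (b : OrthonormalBasis ι ℝ V)
    (htr : ∀ u v, ∑ i, (K u v (b i) (J (b i)) - α * sphereCurvature u v (b i) (J (b i))) = 0)
    (u v : V) :
    ∑ i, K u (b i) v (b i) = α * (Fintype.card ι - 1) * ⟪u, v⟫ ∧
      ∑ i, K u (b i) (J v) (J (b i)) = α * ⟪u, v⟫ := by
  have hflat := (hK.sub_sphere α).ricci_eq_zero hJ h b htr u v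
  have hJJ := (hK.sub_sphere α).map_J_J hJ h
  have hbb (i : ι) : ⟪b i, b i⟫ = 1 := by simp
  -- By the `J`-invariance of the last two slots, the `*`-Ricci tensor of the difference equals its
  -- Ricci tensor; only the sphere contributes to either trace.
  have hflat' : ∑ i, (K u (b i) (J v) (J (b i))
      - α * sphereCurvature u (b i) (J v) (J (b i))) = 0 := by
    rw [← hflat]
    exact Finset.sum_congr rfl fun i _ ↦ hJJ u (b i) v (b i)
  rw [Finset.sum_sub_distrib, sub_eq_zero] at hflat hflat'
  rw [hflat, hflat', ← Finset.mul_sum, ← Finset.mul_sum]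
  constructor
  · simp only [sphereCurvature, Finset.sum_sub_distrib, hbb, b.sum_inner_mul_inner]
    simp
    ring
  · have hterm (i : ι) : sphereCurvature u (b i) (J v) (J (b i)) = ⟪J u, b i⟫ * ⟪b i, J v⟫ := by
      rw [sphereCurvature, hJ.inner_J_self, hJ.inner_J_left]
      ring
    simp only [hterm, b.sum_inner_mul_inner, hJ.inner_J_J]

end ConstantHolomorphicType

/-! ### Product rules for real functions. -/

section Leibniz

variable {E : Type*} [NormedAddCommGroup E] [NormedSpace ℝ E]
  {M : Type*} [TopologicalSpace M] [ChartedSpace E M] {x : M}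

theorem mvfderiv_const_mul_mul {f g : M → ℝ} (hf : MDiffAt f x) (hg : MDiffAt g x) (r : ℝ)
    (u : TangentSpace 𝓘(ℝ, E) x) :
    d% (fun y ↦ r * (f y * g y)) x u = r * (f x * d% g x u + g x * d% f x u) := by
  have h1 : MDiffAt (fun y ↦ f y * g y) x := hf.mul hg
  have h2 : MDiffAt (fun _ : M ↦ r) x := mdifferentiableAt_const
  rw [mvfderiv_fun_mul h2 h1, mvfderiv_fun_mul hf hg]
  simp [mvfderiv_const]
  ring

theorem mvfderiv_mul_add_mul {f g f' g' : M → ℝ} (hf : MDiffAt f x) (hg : MDiffAt g x)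
    (hf' : MDiffAt f' x) (hg' : MDiffAt g' x) (u : TangentSpace 𝓘(ℝ, E) x) :
    d% (fun y ↦ f y * g y + f' y * g' y) x u =
      f x * d% g x u + g x * d% f x u + (f' x * d% g' x u + g' x * d% f' x u) := by
  have h1 : MDiffAt (fun y ↦ f y * g y) x := hf.mul hg
  have h2 : MDiffAt (fun y ↦ f' y * g' y) x := hf'.mul hg'
  rw [mvfderiv_fun_add h1 h2, mvfderiv_fun_mul hf hg, mvfderiv_fun_mul hf' hg']
  simp

end Leibniz

/-! ### The two Ricci identities on the manifold and the Einstein equation. -/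

noncomputable section NearlyKahlerCurvature

local notation "⟪" u ", " v "⟫" => inner ℝ u v

local notation "CField" => ContMDiffAt (𝓡 6) (ModelWithCorners.tangent (𝓡 6)) ∞
local notation "CFun" => ContMDiffAt (𝓡 6) 𝓘(ℝ, ℝ) ∞
local notation "DFun" => MDifferentiableAt (𝓡 6) 𝓘(ℝ, ℝ)

namespace SU3Structure

variable {M : Type*} [TopologicalSpace M] [ChartedSpace E6 M] [IsManifold (𝓡 6) ∞ M]
  [RiemannianBundle (fun x : M ↦ TangentSpace (𝓡 6) x)]
  [IsContMDiffRiemannianBundle (𝓡 6) ∞ E6 (fun x : M ↦ TangentSpace (𝓡 6) x)]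

/-- The Riemann curvature tensor at `x`. -/
def riemann (x : M) (u v y z : TangentSpace (𝓡 6) x) : ℝ := ⟪curvature (𝓡 6) M x u v y, z⟫

/-- `curvature` is computed on extensions, so its linearity is not evident. Linearity in the
inner-product slot is, and the symmetries carry it to the other slots. -/
theorem isAlgebraicCurvature_riemann (x : M) : IsAlgebraicCurvature (riemann x) where
  swap₁₂ u v y z := by rw [riemann, riemann, curvature_swap, inner_neg_left]
  swap₃₄ u v y z := inner_curvature_skew u v y z
  bianchi u v y z := by
    simp only [riemann]
    rw [← inner_add_left, ← inner_add_left, curvature_bianchi, inner_zero_left]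
  add₄ u v y z z' := inner_add_right _ _ _
  smul₄ u v y r z := inner_smul_right _ _ _

variable (S : SU3Structure M)

/-- The three-form `Re(w̄Ψ)`. -/
def volRe (w : M → ℂ) (x : M) (a b c : TangentSpace (𝓡 6) x) : ℝ :=
  ((starRingEnd ℂ) (w x) * S.vol x a b c).re

theorem volRe_eq (w : M → ℂ) (x : M) (a b c : TangentSpace (𝓡 6) x) :
    S.volRe w x a b c = (w x).re * (S.vol x a b c).re + (w x).im * (S.vol x a b c).im := by
  simp [volRe]

theorem volRe_swap₁₂ (w : M → ℂ) (x : M) (a b c : TangentSpace (𝓡 6) x) :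
    S.volRe w x a b c = -S.volRe w x b a c := by
  simp only [volRe]; rw [S.vol_swap₁₂, mul_neg, Complex.neg_re]

theorem volRe_swap₂₃ (w : M → ℂ) (x : M) (a b c : TangentSpace (𝓡 6) x) :
    S.volRe w x a b c = -S.volRe w x a c b := by
  simp only [volRe]; rw [S.vol_swap₂₃, mul_neg, Complex.neg_re]

theorem volRe_sub₁ (w : M → ℂ) (x : M) (a a' b c : TangentSpace (𝓡 6) x) :
    S.volRe w x (a - a') b c = S.volRe w x a b c - S.volRe w x a' b c := by
  have h := (S.isComplexVolume x).add (a - a') a' b c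
  rw [sub_add_cancel] at h
  simp only [volRe, h, mul_add, Complex.add_re]
  ring

theorem volRe_smul₁ (w : M → ℂ) (x : M) (r : ℝ) (a b c : TangentSpace (𝓡 6) x) :
    S.volRe w x (r • a) b c = r * S.volRe w x a b c := by
  rw [volRe, (S.isComplexVolume x).smul, volRe, mul_left_comm, Complex.re_ofReal_mul]

theorem volRe_sub₂ (w : M → ℂ) (x : M) (a b b' c : TangentSpace (𝓡 6) x) :
    S.volRe w x a (b - b') c = S.volRe w x a b c - S.volRe w x a b' c := by
  rw [S.volRe_swap₁₂, volRe_sub₁, S.volRe_swap₁₂ w x a b, S.volRe_swap₁₂ w x a b']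
  ring

theorem volRe_sub₃ (w : M → ℂ) (x : M) (a b c c' : TangentSpace (𝓡 6) x) :
    S.volRe w x a b (c - c') = S.volRe w x a b c - S.volRe w x a b c' := by
  rw [S.volRe_swap₂₃, volRe_sub₂, S.volRe_swap₂₃ w x a b c, S.volRe_swap₂₃ w x a b c']
  ring

/-- The four-tensor `⟨u, ·⟩ ∧ ω`. -/
def wedgeKahler (x : M) (u a b c : TangentSpace (𝓡 6) x) : ℝ :=
  ⟪u, a⟫ * ⟪b, S.J x c⟫ - ⟪u, b⟫ * ⟪a, S.J x c⟫ + ⟪u, c⟫ * ⟪a, S.J x b⟫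

/-- The one-form `β` with `∇ Re(w̄Ψ) = -|w|² ⟨·, ·⟩ ∧ ω + Re(βΨ)`. -/
def volReDeriv (w : M → ℂ) (η : Π x : M, TangentSpace (𝓡 6) x →ₗ[ℝ] ℝ) (x : M) :
    TangentSpace (𝓡 6) x →ₗ[ℝ] ℂ where
  -- The real and imaginary parts of `β = dw̄ + 3iηw̄`.
  toFun u := ⟨mvfderiv (𝓡 6) (fun y ↦ (w y).re) x u + 3 * η x u * (w x).im,
    -mvfderiv (𝓡 6) (fun y ↦ (w y).im) x u + 3 * η x u * (w x).re⟩
  map_add' u v := by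
    apply Complex.ext <;> simp <;> ring
  map_smul' r u := by
    apply Complex.ext <;> simp <;> ring

variable {S} {w : M → ℂ} {ξ : Π x : M, Torsion x} {η : Π x : M, TangentSpace (𝓡 6) x →ₗ[ℝ] ℝ}

theorem contMDiffAt_volRe (h : ∀ x, S.HasTorsion x (w x) (ξ x) (η x)) {x : M}
    {A B C : Π y : M, TangentSpace (𝓡 6) y} (hA : CField (T% A) x) (hB : CField (T% B) x)
    (hC : CField (T% C) x) : CFun (fun y ↦ S.volRe w y (A y) (B y) (C y)) x := by
  simp only [volRe_eq]
  exact ((contMDiffAt_w h x).1.mul (S.contMDiffAt_vol_re hA hB hC)).add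
    ((contMDiffAt_w h x).2.mul (S.contMDiffAt_vol_im hA hB hC))

/-- The product rule: differentiating `w` and the `η` part of `∇Ψ` give `β`, and the `ξ` part of
`∇Ψ` gives the wedge term by `re_conj_mul_eq`. -/
theorem mvfderiv_volRe (h : ∀ x, S.HasTorsion x (w x) (ξ x) (η x)) {x : M}
    {A B C : Π y : M, TangentSpace (𝓡 6) y} (hA : CField (T% A) x) (hB : CField (T% B) x)
    (hC : CField (T% C) x) (u : TangentSpace (𝓡 6) x) :
    mvfderiv (𝓡 6) (fun y ↦ S.volRe w y (A y) (B y) (C y)) x u =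
      S.volRe w x (leviCivita (𝓡 6) M A x u) (B x) (C x)
      + S.volRe w x (A x) (leviCivita (𝓡 6) M B x u) (C x)
      + S.volRe w x (A x) (B x) (leviCivita (𝓡 6) M C x u)
      + (-(Complex.normSq (w x) * S.wedgeKahler x u (A x) (B x) (C x))
        + (volReDeriv w η x u * S.vol x (A x) (B x) (C x)).re) := by
  obtain ⟨c, hc⟩ := S.exists_isSpecialUnitaryCoord x
  have hp : DFun (fun y ↦ (w y).re) x := (contMDiffAt_w h x).1.mdifferentiableAt (by simp)
  have hm : DFun (fun y ↦ (w y).im) x := (contMDiffAt_w h x).2.mdifferentiableAt (by simp)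
  have hre : DFun (fun y ↦ (S.vol y (A y) (B y) (C y)).re) x :=
    (S.contMDiffAt_vol_re hA hB hC).mdifferentiableAt (by simp)
  have him : DFun (fun y ↦ (S.vol y (A y) (B y) (C y)).im) x :=
    (S.contMDiffAt_vol_im hA hB hC).mdifferentiableAt (by simp)
  have hA' := hA.mdifferentiableAt (by simp)
  have hB' := hB.mdifferentiableAt (by simp)
  have hC' := hC.mdifferentiableAt (by simp)
  have e1 := S.mvfderiv_vol_re hA' hB' hC' u
  have e2 := S.mvfderiv_vol_im hA' hB' hC' u
  rw [(h x).nabla_ψp] at e1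
  rw [(h x).nabla_ψm] at e2
  have e3 := IsNearlyKahlerTorsion.re_conj_mul_eq (S.isHermitian x) hc (h x).inner_eq u
    (A x) (B x) (C x)
  have e4 : mvfderiv (𝓡 6) (fun y ↦ S.volRe w y (A y) (B y) (C y)) x u =
      (w x).re * mvfderiv (𝓡 6) (fun y ↦ (S.vol y (A y) (B y) (C y)).re) x u
      + (S.vol x (A x) (B x) (C x)).re * mvfderiv (𝓡 6) (fun y ↦ (w y).re) x u
      + ((w x).im * mvfderiv (𝓡 6) (fun y ↦ (S.vol y (A y) (B y) (C y)).im) x u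
      + (S.vol x (A x) (B x) (C x)).im * mvfderiv (𝓡 6) (fun y ↦ (w y).im) x u) := by
    simp only [volRe_eq]
    exact mvfderiv_mul_add_mul hp hre hm him u
  rw [e4, e1, e2]
  have e5 : S.wedgeKahler x u (A x) (B x) (C x) = ⟪u, A x⟫ * ⟪B x, S.Jlin x (C x)⟫
      - ⟪u, B x⟫ * ⟪A x, S.Jlin x (C x)⟫ + ⟪u, C x⟫ * ⟪A x, S.Jlin x (B x)⟫ := rfl
  rw [e5, ← e3]
  have e6 : volReDeriv w η x u = ⟨mvfderiv (𝓡 6) (fun y ↦ (w y).re) x u + 3 * η x u * (w x).im,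
    -mvfderiv (𝓡 6) (fun y ↦ (w y).im) x u + 3 * η x u * (w x).re⟩ := rfl
  rw [e6]
  simp only [volRe, Complex.add_re, Complex.add_im, Complex.mul_re, Complex.mul_im, Complex.conj_re,
    Complex.conj_im, Complex.ofReal_re, Complex.ofReal_im, Complex.I_re, Complex.I_im,
    Complex.re_ofNat, Complex.im_ofNat]
  ring

theorem mvfderiv_kahler_volRe (h : ∀ x, S.HasTorsion x (w x) (ξ x) (η x)) {x : M}
    {A B : Π y : M, TangentSpace (𝓡 6) y} (hA : CField (T% A) x) (hB : CField (T% B) x)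
    (u : TangentSpace (𝓡 6) x) :
    mvfderiv (𝓡 6) (fun y ↦ ⟪A y, S.J y (B y)⟫) x u = ⟪leviCivita (𝓡 6) M A x u, S.J x (B x)⟫
      + ⟪A x, S.J x (leviCivita (𝓡 6) M B x u)⟫ + S.volRe w x u (A x) (B x) := by
  rw [S.mvfderiv_kahler (hA.mdifferentiableAt (by simp)) (hB.mdifferentiableAt (by simp)),
    (h x).nabla_kahlerForm]
  rfl

/-- The curvature tensor commutes with `J` up to that of a sphere and the form `β`. -/
theorem riemann_J (h : ∀ x, S.HasTorsion x (w x) (ξ x) (η x)) {x : M}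
    (u v a b : TangentSpace (𝓡 6) x) :
    riemann x u v a (S.Jlin x b) - Complex.normSq (w x) * sphereCurvature u v a (S.Jlin x b)
      + (riemann x u v (S.Jlin x a) b - Complex.normSq (w x) * sphereCurvature u v (S.Jlin x a) b) =
      (volReDeriv w η x u * S.vol x v a b - volReDeriv w η x v * S.vol x u a b).re := by
  -- Antisymmetrised in the two derivative directions, the wedge term loses `⟨u, v⟩ω` and becomes
  -- the action of the sphere's curvature on `ω`, hence the subtraction of `sphereCurvature`.
  have key := ricci_identity_two (E := E6) (M := M) (φ := fun y a b ↦ ⟪a, S.J y b⟫)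
    (χ := S.volRe w)
    (θ := fun y u a b c ↦ -(Complex.normSq (w y) * S.wedgeKahler y u a b c)
        + (volReDeriv w η y u * S.vol y a b c).re)
    (fun y A B hA hB ↦ contMDiffAt_inner hA (S.contMDiffAt_J hB))
    (fun y A B C hA hB hC ↦ (contMDiffAt_volRe h hA hB hC).mdifferentiableAt (by simp))
    (fun y A B hA hB u ↦ mvfderiv_kahler_volRe h hA hB u)
    (fun y A B C hA hB hC u ↦ mvfderiv_volRe h hA hB hC u)
    (fun y a b c ↦ inner_sub_left _ _ _)
    (fun y a b c ↦ by rw [map_sub, inner_sub_right]) u v a b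
  have e1 : ⟪a, S.J x (curvature (𝓡 6) M x u v b)⟫ = riemann x u v (S.Jlin x a) b := by
    have h1 := inner_curvature_skew (E := E6) u v (S.Jlin x a) b
    have h2 := (S.isHermitian x).inner_J_left a (curvature (𝓡 6) M x u v b)
    rw [real_inner_comm] at h2
    have h3 : ⟪a, S.J x (curvature (𝓡 6) M x u v b)⟫ =
      ⟪a, S.Jlin x (curvature (𝓡 6) M x u v b)⟫ := rfl
    rw [h3, riemann, h1, h2, neg_neg]
  have e2 : ⟪curvature (𝓡 6) M x u v a, S.J x b⟫ = riemann x u v a (S.Jlin x b) := rfl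
  simp only [wedgeKahler] at key
  have e3 (p q : TangentSpace (𝓡 6) x) : ⟪p, S.J x q⟫ = ⟪p, S.Jlin x q⟫ := rfl
  rw [e1] at key
  simp only [e3] at key
  change riemann x u v a (S.Jlin x b) + _ = _ at key
  rw [Complex.sub_re]
  simp only [sphereCurvature]
  rw [real_inner_comm v u] at key
  linear_combination key

theorem volReDeriv_eq_zero (h : ∀ x, S.HasTorsion x (w x) (ξ x) (η x)) (x : M) :
    volReDeriv w η x = 0 := by
  obtain ⟨c, hc⟩ := S.exists_isSpecialUnitaryCoord x
  exact hc.eq_zero_of_curvature (S.isHermitian x)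
    ((isAlgebraicCurvature_riemann x).sub_sphere (Complex.normSq (w x))) (riemann_J h)

/-- `β = 0` reads `dw = 3iηw` with `η` real: only the phase of `w` varies. -/
theorem mvfderiv_normSq_eq_zero (h : ∀ x, S.HasTorsion x (w x) (ξ x) (η x)) (x : M) :
    mvfderiv (𝓡 6) (fun y ↦ Complex.normSq (w y)) x = 0 := by
  have hp : DFun (fun y ↦ (w y).re) x := (contMDiffAt_w h x).1.mdifferentiableAt (by simp)
  have hm : DFun (fun y ↦ (w y).im) x := (contMDiffAt_w h x).2.mdifferentiableAt (by simp)
  simp only [Complex.normSq_apply]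
  ext u
  have h0 := DFunLike.congr_fun (volReDeriv_eq_zero h x) u
  have h1 : mvfderiv (𝓡 6) (fun y ↦ (w y).re) x u + 3 * η x u * (w x).im = 0 :=
    congrArg Complex.re h0
  have h2 : -mvfderiv (𝓡 6) (fun y ↦ (w y).im) x u + 3 * η x u * (w x).re = 0 :=
    congrArg Complex.im h0
  rw [mvfderiv_mul_add_mul hp hp hm hm, zero_apply]
  linear_combination 2 * (w x).re * h1 - 2 * (w x).im * h2

/-- The metric is parallel, so the derivative falls on `ω` and replaces it by `Re(w̄Ψ)`. -/
theorem mvfderiv_wedgeKahler (h : ∀ x, S.HasTorsion x (w x) (ξ x) (η x)) {x : M}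
    {A B C D : Π y : M, TangentSpace (𝓡 6) y} (hA : CField (T% A) x) (hB : CField (T% B) x)
    (hC : CField (T% C) x) (hD : CField (T% D) x) (α : ℝ) (u : TangentSpace (𝓡 6) x) :
    mvfderiv (𝓡 6) (fun y ↦ -(α * S.wedgeKahler y (A y) (B y) (C y) (D y))) x u =
      -(α * S.wedgeKahler x (leviCivita (𝓡 6) M A x u) (B x) (C x) (D x))
      + -(α * S.wedgeKahler x (A x) (leviCivita (𝓡 6) M B x u) (C x) (D x))
      + -(α * S.wedgeKahler x (A x) (B x) (leviCivita (𝓡 6) M C x u) (D x))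
      + -(α * S.wedgeKahler x (A x) (B x) (C x) (leviCivita (𝓡 6) M D x u))
      + -(α * (⟪A x, B x⟫ * S.volRe w x u (C x) (D x) - ⟪A x, C x⟫ * S.volRe w x u (B x) (D x)
        + ⟪A x, D x⟫ * S.volRe w x u (B x) (C x))) := by
  have hg {P Q : Π y : M, TangentSpace (𝓡 6) y} (hP : CField (T% P) x) (hQ : CField (T% Q) x) :
      DFun (fun y ↦ ⟪P y, Q y⟫) x := (contMDiffAt_inner hP hQ).mdifferentiableAt (by simp)
  have hk {P Q : Π y : M, TangentSpace (𝓡 6) y} (hP : CField (T% P) x) (hQ : CField (T% Q) x) :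
      DFun (fun y ↦ ⟪P y, S.J y (Q y)⟫) x := hg hP (S.contMDiffAt_J hQ)
  have hterm {P Q P' Q' : Π y : M, TangentSpace (𝓡 6) y} (hP : CField (T% P) x)
      (hQ : CField (T% Q) x) (hP' : CField (T% P') x) (hQ' : CField (T% Q') x) (r : ℝ) :
      DFun (fun y ↦ r * (⟪P y, Q y⟫ * ⟪P' y, S.J y (Q' y)⟫)) x :=
    mdifferentiableAt_const.mul ((hg hP hQ).mul (hk hP' hQ'))
  have e : (fun y ↦ -(α * S.wedgeKahler y (A y) (B y) (C y) (D y))) = fun y ↦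
      -α * (⟪A y, B y⟫ * ⟪C y, S.J y (D y)⟫) + α * (⟪A y, C y⟫ * ⟪B y, S.J y (D y)⟫)
      + -α * (⟪A y, D y⟫ * ⟪B y, S.J y (C y)⟫) := by
    ext y
    rw [wedgeKahler]
    ring
  have hdg {P Q : Π y : M, TangentSpace (𝓡 6) y} (hP : CField (T% P) x) (hQ : CField (T% Q) x) :=
    mvfderiv_inner (hP.mdifferentiableAt (by simp)) (hQ.mdifferentiableAt (by simp)) u
  rw [e, mvfderiv_add_three (hterm hA hB hC hD (-α)) (hterm hA hC hB hD α) (hterm hA hD hB hC (-α)),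
    mvfderiv_const_mul_mul (hg hA hB) (hk hC hD), mvfderiv_const_mul_mul (hg hA hC) (hk hB hD),
    mvfderiv_const_mul_mul (hg hA hD) (hk hB hC), mvfderiv_kahler_volRe h hC hD,
    mvfderiv_kahler_volRe h hB hD, mvfderiv_kahler_volRe h hB hC, hdg hA hB, hdg hA hC, hdg hA hD]
  simp only [wedgeKahler]
  ring

/-- The difference of the curvature operator `R_{u,v}` and that of a sphere of curvature `α`. -/
def curvatureSubSphere (x : M) (α : ℝ) (u v : TangentSpace (𝓡 6) x) :
    TangentSpace (𝓡 6) x →ₗ[ℝ] TangentSpace (𝓡 6) x where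
  toFun y := curvature (𝓡 6) M x u v y - (α • ⟪u, y⟫ • v - α • ⟪v, y⟫ • u)
  map_add' y y' := by
    refine ext_inner_right ℝ fun z ↦ ?_
    have := (isAlgebraicCurvature_riemann x).add₃ u v y y' z
    simp only [riemann] at this
    simp only [inner_sub_left, inner_add_left, inner_smul_left, inner_add_right, this]
    simp
    ring
  map_smul' r y := by
    refine ext_inner_right ℝ fun z ↦ ?_
    have := (isAlgebraicCurvature_riemann x).smul₃ u v r y z
    simp only [riemann] at this
    simp only [inner_sub_left, inner_smul_left, inner_smul_right, this]
    simp
    ring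

theorem inner_curvatureSubSphere (x : M) (α : ℝ) (u v y z : TangentSpace (𝓡 6) x) :
    ⟪curvatureSubSphere x α u v y, z⟫ = riemann x u v y z - α * sphereCurvature u v y z := by
  have : curvatureSubSphere x α u v y =
    curvature (𝓡 6) M x u v y - (α • ⟪u, y⟫ • v - α • ⟪v, y⟫ • u) := rfl
  rw [this]
  simp only [inner_sub_left, inner_smul_left, riemann, sphereCurvature]
  simp
  ring

/-- With `β = 0` and `|w|²` constant, the second covariant derivative of `χ = Re(w̄Ψ)` is algebraic
in `χ` and the metric. Its antisymmetrisation is `α` times the sphere's curvature acting on `χ`. -/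
theorem volRe_curvatureSubSphere (h : ∀ x, S.HasTorsion x (w x) (ξ x) (η x)) {α : ℝ}
    (hα : ∀ x, Complex.normSq (w x) = α) {x : M} (u v a b c : TangentSpace (𝓡 6) x) :
    S.volRe w x (curvatureSubSphere x α u v a) b c + S.volRe w x a (curvatureSubSphere x α u v b) c
      + S.volRe w x a b (curvatureSubSphere x α u v c) = 0 := by
  have key := ricci_identity_three (E := E6) (M := M) (χ := S.volRe w)
    (θ := fun y u a b c ↦ -(α * S.wedgeKahler y u a b c))
    (κ := fun y u v a b c ↦ -(α * (⟪v, a⟫ * S.volRe w y u b c - ⟪v, b⟫ * S.volRe w y u a c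
        + ⟪v, c⟫ * S.volRe w y u a b)))
    (fun y A B C hA hB hC ↦ contMDiffAt_volRe h hA hB hC)
    (fun y A B C D hA hB hC hD ↦ by
      have hg {P Q : Π y : M, TangentSpace (𝓡 6) y} (hP : CField (T% P) y) (hQ : CField (T% Q) y) :
        DFun (fun y ↦ ⟪P y, Q y⟫) y := (contMDiffAt_inner hP hQ).mdifferentiableAt (by simp)
      have hk {P Q : Π y : M, TangentSpace (𝓡 6) y} (hP : CField (T% P) y) (hQ : CField (T% Q) y) :
        DFun (fun y ↦ ⟪P y, S.J y (Q y)⟫) y := hg hP (S.contMDiffAt_J hQ)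
      exact (mdifferentiableAt_const.mul ((((hg hA hB).mul (hk hC hD)).sub
        ((hg hA hC).mul (hk hB hD))).add ((hg hA hD).mul (hk hB hC)))).neg)
    (fun y A B C hA hB hC u ↦ by
      have := mvfderiv_volRe h hA hB hC u
      rwa [volReDeriv_eq_zero h, hα, LinearMap.zero_apply, zero_mul, Complex.zero_re,
        add_zero] at this)
    (fun y A B C D hA hB hC hD u ↦ mvfderiv_wedgeKahler h hA hB hC hD α u)
    (S.volRe_sub₁ w) (S.volRe_sub₂ w) (S.volRe_sub₃ w) u v a b c
  have hR (y : TangentSpace (𝓡 6) x) : curvatureSubSphere x α u v y =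
    curvature (𝓡 6) M x u v y - (α • ⟪u, y⟫ • v - α • ⟪v, y⟫ • u) := rfl
  have smul₂ (r : ℝ) (a b c : TangentSpace (𝓡 6) x) :
      S.volRe w x a (r • b) c = -(r * S.volRe w x b a c) := by
    rw [S.volRe_swap₁₂, volRe_smul₁]
  have smul₃ (r : ℝ) (a b c : TangentSpace (𝓡 6) x) :
      S.volRe w x a b (r • c) = r * S.volRe w x c a b := by
    rw [S.volRe_swap₂₃, smul₂, neg_neg]
  simp only [hR, volRe_sub₁, volRe_sub₂, volRe_sub₃, volRe_smul₁, smul₂, smul₃]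
  linear_combination key

/-- The Ricci and `*`-Ricci curvatures of a nearly Kähler six-manifold. -/
theorem ricci_eq (h : ∀ x, S.HasTorsion x (w x) (ξ x) (η x)) {α : ℝ} (hα0 : α ≠ 0)
    (hα : ∀ x, Complex.normSq (w x) = α) {x : M} (u v : TangentSpace (𝓡 6) x) :
    ricci (𝓡 6) M x u v = 5 * α * ⟪u, v⟫ ∧ ricciStar M S.J x u v = α * ⟪u, v⟫ := by
  obtain ⟨c, hc⟩ := S.exists_isSpecialUnitaryCoord x
  have hJ := S.isHermitian x
  have hK := isAlgebraicCurvature_riemann x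
  have hKJ (u v y z : TangentSpace (𝓡 6) x) : riemann x u v y (S.Jlin x z)
      - α * sphereCurvature u v y (S.Jlin x z)
      + (riemann x u v (S.Jlin x y) z - α * sphereCurvature u v (S.Jlin x y) z) = 0 := by
    have := riemann_J h u v y z
    rwa [volReDeriv_eq_zero h, hα, LinearMap.zero_apply, LinearMap.zero_apply, zero_mul, zero_mul,
      sub_zero, Complex.zero_re] at this
  have hw : w x ≠ 0 := by
    intro h0
    apply hα0
    rw [← hα x, h0, map_zero]
  have htr (u v : TangentSpace (𝓡 6) x) :
      ∑ i, (riemann x u v (stdOrthonormalBasis ℝ (TangentSpace (𝓡 6) x) i)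
        (S.Jlin x (stdOrthonormalBasis ℝ (TangentSpace (𝓡 6) x) i))
      - α * sphereCurvature u v (stdOrthonormalBasis ℝ (TangentSpace (𝓡 6) x) i)
        (S.Jlin x (stdOrthonormalBasis ℝ (TangentSpace (𝓡 6) x) i))) = 0 := by
    -- The operator is skew, commutes with `J` by `hKJ` and annihilates `Re(w̄Ψ)`, so its complex
    -- trace vanishes.
    simp only [← inner_curvatureSubSphere]
    refine hc.sum_inner_J_eq_zero hJ hw (fun y z ↦ ?_) (fun y ↦ ?_) (fun a b d ↦ ?_) _
    · rw [inner_curvatureSubSphere, inner_curvatureSubSphere, (hK.sub_sphere α).swap₃₄]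
    · refine ext_inner_right ℝ fun z ↦ ?_
      rw [hJ.inner_J_left, inner_curvatureSubSphere, inner_curvatureSubSphere]
      linarith [hKJ u v y z]
    · have := volRe_curvatureSubSphere h hα u v a b d
      rw [mul_add, mul_add, Complex.add_re, Complex.add_re]
      exact this
  have := hK.ricci_eq_of_sub_sphere hJ hKJ (stdOrthonormalBasis ℝ (TangentSpace (𝓡 6) x)) htr u v
  refine ⟨Eq.trans this.1 ?_, this.2⟩
  rw [Fintype.card_fin, finrank_tangentSpace]
  push_cast
  ring

end SU3Structure

end NearlyKahlerCurvature

/-! ### The main theorem. -/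

theorem theorem3p5 {M : Type*} [TopologicalSpace M] [T2Space M] [SecondCountableTopology M]
    [ConnectedSpace M] [ChartedSpace (EuclideanSpace ℝ (Fin 6)) M] [IsManifold (𝓡 6) ∞ M]
    [RiemannianBundle (fun x : M ↦ TangentSpace (𝓡 6) x)]
    [IsContMDiffRiemannianBundle (𝓡 6) ∞ (EuclideanSpace ℝ (Fin 6))
      (fun x : M ↦ TangentSpace (𝓡 6) x)]
    (S : SU3Structure M) (htype : S.IsOfType S.W1pW1mW5) (hnot : ¬ S.IsOfType S.W5) :
    ∃ w₁p w₁m : M → ℝ,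
      ContMDiff (𝓡 6) 𝓘(ℝ, ℝ) ∞ w₁p ∧ ContMDiff (𝓡 6) 𝓘(ℝ, ℝ) ∞ w₁m ∧
      (∀ (x : M) (u v w : TangentSpace (𝓡 6) x),
        S.nablaKahler x u v w = w₁p x * S.ψp x ![u, v, w] + w₁m x * S.ψm x ![u, v, w]) ∧
      ∃ α : ℝ, 0 < α ∧ (∀ x : M, α = w₁p x ^ 2 + w₁m x ^ 2) ∧
        ∀ (x : M) (u v : TangentSpace (𝓡 6) x),
          ricci (𝓡 6) M x u v = 5 * ricciStar M S.J x u v ∧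
          ricci (𝓡 6) M x u v = 5 * α * inner ℝ u v := by
  have hex (x : M) : ∃ w ξ η, S.HasTorsion x w ξ η := by
    obtain ⟨T, hT, hmem⟩ := htype x
    exact S.exists_hasTorsion hT hmem
  -- A pointwise choice without regularity; `w` is then shown to be smooth, and its real and
  -- imaginary parts are `w₁⁺` and `w₁⁻`.
  choose w ξ η h using hex
  have hp : ContMDiff (𝓡 6) 𝓘(ℝ, ℝ) ∞ (fun y ↦ (w y).re) := fun x ↦ (S.contMDiffAt_w h x).1
  have hm : ContMDiff (𝓡 6) 𝓘(ℝ, ℝ) ∞ (fun y ↦ (w y).im) := fun x ↦ (S.contMDiffAt_w h x).2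
  have hsmooth : ContMDiff (𝓡 6) 𝓘(ℝ, ℝ) ∞ (fun y ↦ Complex.normSq (w y)) := by
    simp only [Complex.normSq_apply]
    exact (hp.mul hp).add (hm.mul hm)
  obtain ⟨α, hα⟩ := exists_eq_of_mvfderiv_eq_zero hsmooth (S.mvfderiv_normSq_eq_zero h)
  -- If `α = 0`, then `w` vanishes everywhere and the structure is of type `W₅`.
  have hα0 : α ≠ 0 := by
    rintro rfl
    exact hnot fun x ↦ (h x).mem_W5 (Complex.normSq_eq_zero.1 (hα x))
  obtain ⟨x₀⟩ := (inferInstance : Nonempty M)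
  have hαpos : 0 < α := lt_of_le_of_ne (hα x₀ ▸ Complex.normSq_nonneg _) hα0.symm
  refine ⟨fun y ↦ (w y).re, fun y ↦ (w y).im, hp, hm, fun x u v y ↦ ?_, α, hαpos, fun x ↦ ?_,
    fun x u v ↦ ?_⟩
  · exact ((h x).nabla_kahlerForm u v y).trans (S.volRe_eq w x u v y)
  · rw [← hα x, Complex.normSq_apply]
    ring
  · obtain ⟨h1, h2⟩ := S.ricci_eq h hα0 hα u v
    exact ⟨by rw [h1, h2]; ring, h1⟩
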